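/- \textbf{Setting.} A \emph{pseudo $n$-fold category} consists of a category $\mathrm{Mor}_S$ for every $S\subseteq\{1,\dots,n\}$ (its objects are the $k$-morphisms in the directions $S$, $k=|S|$; its morphisms are called transversal), and, for $i\in S$, source and target functors $s_i,t_i:\mathrm{Mor}_S\to\mathrm{Mor}_{S\setminus i}$, identity functors $\mathrm{id}_i:\mathrm{Mor}_{S\setminus i}\to\mathrm{Mor}_S$ and composition functors $\circ_i$ on the strict pullback $\mathrm{Mor}_S\times_{\mathrm{Mor}_{S\setminus i}}\mathrm{Mor}_S$ of pairs $(x,y)$ with $t_ix=s_iy$. For $i\ne j$ and on objects and morphisms alike, one requires strictly: $s_is_j=s_js_i$, $s_it_j=t_js_i$, $t_it_j=t_jt_i$; $s_i\mathrm{id}_i=t_i\mathrm{id}_i=1$, $s_i\mathrm{id}_j=\mathrm{id}_js_i$, $t_i\mathrm{id}_j=\mathrm{id}_jt_i$, $\mathrm{id}_i\mathrm{id}_j=\mathrm{id}_j\mathrm{id}_i$; $s_i(x\circ_iy)=s_ix$, $t_i(x\circ_iy)=t_iy$, $s_i(x\circ_jy)=s_ix\circ_js_iy$, $t_i(x\circ_jy)=t_ix\circ_jt_iy$;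 $\mathrm{id}_i(x\circ_jy)=\mathrm{id}_ix\circ_j\mathrm{id}_iy$ and $\mathrm{id}_is_i(x)\circ_ix=x=x\circ_i\mathrm{id}_it_i(x)$. Furthermore there are natural isomorphisms $$\alpha_i:(x\circ_iy)\circ_iz\to x\circ_i(y\circ_iz),\qquad \beta_{ij}:(x\circ_iy)\circ_j(x'\circ_iy')\to(x\circ_jx')\circ_i(y\circ_jy')\quad(i\neq j)$$ (associators and interchangers) with $\beta_{ji}=\beta_{ij}^{-1}$. They are compatible with sources and targets: $s_i,t_i$ send $\alpha_i$ to an identity, $s_i,t_i,s_j,t_j$ send $\beta_{ij}$ to identities, and $s_l,t_l$ in any other direction $l$ send $\alpha_i$, $\beta_{ij}$ to the corresponding $\alpha_i$, $\beta_{ij}$ of the sources, targets. They satisfy: (1) the pentagon axiom for each $\alpha_i$; (2) for $i\ne j$, the two maps from $((x\circ_iy)\circ_iz)\circ_j((x'\circ_iy')\circ_iz')$ to $(x\circ_jx')\circ_i((y\circ_jy')\circ_i(z\circ_jz'))$, namely $\alpha_i\,(\beta_{ij}\circ_i\mathrm{id})\,\beta_{ij}$ and $(\mathrm{id}\circ_i\beta_{ij})\,\beta_{ij}\,(\alpha_i\circ_j\alpha_i)$,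 are equal; (3) for distinct $i,j,k$, the two maps $(\beta_{jk}\circ_i\beta_{jk})\,\beta_{ik}\,(\beta_{ij}\circ_k\beta_{ij})$ and $\beta_{ij}\,(\beta_{ik}\circ_j\beta_{ik})\,\beta_{jk}$ from $((x_0\circ_iy_0)\circ_j(x_1\circ_iy_1))\circ_k((x_2\circ_iy_2)\circ_j(x_3\circ_iy_3))$ to $((x_0\circ_kx_2)\circ_j(x_1\circ_kx_3))\circ_i((y_0\circ_ky_2)\circ_j(y_1\circ_ky_3))$ are equal; (4) $\alpha_i$ is the identity on $(\mathrm{id}_is_ix,x,y)$, $(x,\mathrm{id}_is_iy,y)$ and $(x,y,\mathrm{id}_it_iy)$, and $\beta_{ij}$ is the identity on $(x,y;\mathrm{id}_jt_jx,\mathrm{id}_jt_jy)$ and $(\mathrm{id}_js_jx,\mathrm{id}_js_jy;x,y)$. \textbf{Regular diagrams.} Fix a set $S$ of $k$ directions and integers $p_i\ge1$ ($i\in S$), and let $c$ be the $k$-cube with axes $S$ cut by hyperplanes into $p=\prod_{i\in S}p_i$ equal blocks, $p_i$ along the axis $i$. Let $(k\mathrm{Mor})^p_c$ be the category whose objects are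 the families of objects of $\mathrm{Mor}_S$, one for each block, such that the $t_i$ of each block equals the $s_i$ of the next block in the direction $i$; its morphisms are the families of morphisms of $\mathrm{Mor}_S$ satisfying the same conditions. \textbf{Bracketings.} A \emph{bracketing} of a box of blocks is either the box itself, if it is one block, or a formal composite $A\circ_iB$ of bracketings of the two boxes into which a hyperplane $x_i=m$ cuts it. Its formal source $s_jA$ and target $t_jA$ are the bracketings of faces computed by $s_j(A\circ_jB)=s_jA$, $t_j(A\circ_jB)=t_jB$, $s_j(A\circ_iB)=s_jA\circ_is_jB$, $t_j(A\circ_iB)=t_jA\circ_it_jB$ for $i\neq j$. The functors $F_A:(k\mathrm{Mor})^p_c\to k\mathrm{Mor}$ \emph{built from morphism composition} and the natural isomorphisms \emph{built from $\alpha$ and $\beta$} are defined by simultaneous induction. A single block defines the corresponding projection. If $A,B$ define $F_A,F_B$ and $t_iF_A=s_iF_B$, then $A\circ_iB$ is defined, with $F_{A\circ_iB}=F_A\circ_iF_B$, if the formal target $t_iA$ equals the formal source $s_iB$ or, more generally, if there are bracketings $A',B'$ of the same boxes with $t_iA'=s_iB'$ formally, and isomorphisms $\varphi:F_A\to F_{A'}$,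 $\psi:F_B\to F_{B'}$ built from $\alpha$ and $\beta$, such that $t_i\varphi=s_i\psi$. (Thus a mere coincidence $t_iF_A=s_iF_B$ in one particular pseudo $n$-fold category does not suffice.) The isomorphisms built from $\alpha$ and $\beta$ are those between functors of defined bracketings of the same box obtained from identities and from the $\alpha_i$ and $\beta_{ij}$ (between defined bracketings) by composing, inverting, and forming $\varphi\circ_i\psi$ for $\varphi,\psi$ with $t_i\varphi=s_i\psi$ (between defined bracketings). \textbf{Theorem (Regular Coherence Theorem).} Let $c$ be a regular gluing diagram as above in a pseudo $n$-fold category. Every bracketing of the whole cube $c$ in which $t_iA=s_iB$ formally whenever $A\circ_iB$ is formed defines exactly one functor $(k\mathrm{Mor})^p_c\to k\mathrm{Mor}$. For any two bracketings $A,B$ of the whole cube that define functors $F_A,F_B:(k\mathrm{Mor})^p_c\to k\mathrm{Mor}$, there is exactly one natural isomorphism $F_A\cong F_B$ built from associators $\alpha$ and interchangers $\beta$ (from the bracketing $A$ to the bracketing $B$). -/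

import Mathlib

open CategoryTheory

universe v u v₁ u₁ v₂ u₂ v₃ u₃

/-- Equality of arrows of a category whose endpoints are not syntactically the same: the
endpoints agree and the arrows are identified under this agreement. -/
def SameArrow {D : Type u} [Category.{v} D] {a b a' b' : D} (f : a ⟶ b) (g : a' ⟶ b') : Prop :=
  Arrow.mk f = Arrow.mk g

namespace SameArrow

variable {D : Type u} [Category.{v} D] {E : Type u₁} [Category.{v₁} E]

theorem refl {a b : D} (f : a ⟶ b) : SameArrow f f := rfl

theorem symm {a b a' b' : D} {f : a ⟶ b} {g : a' ⟶ b'} (h : SameArrow f g) : SameArrow g f :=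
  Eq.symm h

theorem trans {a b a' b' a'' b'' : D} {f : a ⟶ b} {g : a' ⟶ b'} {k : a'' ⟶ b''}
    (h : SameArrow f g) (h' : SameArrow g k) : SameArrow f k :=
  Eq.trans h h'

theorem of_eq {a b : D} {f g : a ⟶ b} (h : f = g) : SameArrow f g := by rw [h]; exact refl g

theorem id {a a' : D} (h : a = a') : SameArrow (𝟙 a) (𝟙 a') := by subst h; exact refl _

theorem comp {a b c a' b' c' : D} {f : a ⟶ b} {f' : b ⟶ c} {g : a' ⟶ b'} {g' : b' ⟶ c'}
    (h : SameArrow f g) (h' : SameArrow f' g') : SameArrow (f ≫ f') (g ≫ g') := by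
  have ha : a = a' := congrArg Comma.left h
  have hb : b = b' := congrArg Comma.right h
  have hc : c = c' := congrArg Comma.right h'
  subst ha hb hc
  have h₁ : f = g := Arrow.mk_injective _ _ h
  have h₂ : f' = g' := Arrow.mk_injective _ _ h'
  rw [h₁, h₂]; exact refl _

theorem inv {a b a' b' : D} {f : a ≅ b} {g : a' ≅ b'} (h : SameArrow f.hom g.hom) :
    SameArrow f.inv g.inv := by
  have ha : a = a' := congrArg Comma.left h
  have hb : b = b' := congrArg Comma.right h
  subst ha hb
  have h₁ : f = g := Iso.ext (Arrow.mk_injective _ _ h)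
  rw [h₁]; exact refl _

theorem map (F : D ⥤ E) {a b a' b' : D} {f : a ⟶ b} {g : a' ⟶ b'} (h : SameArrow f g) :
    SameArrow (F.map f) (F.map g) :=
  congrArg F.mapArrow.obj h

theorem of_functor_eq {F G : D ⥤ E} (h : F = G) {a b : D} (f : a ⟶ b) :
    SameArrow (F.map f) (G.map f) := by subst h; exact refl _

theorem map_id (F : D ⥤ E) (a : D) : SameArrow (F.map (𝟙 a)) (𝟙 (F.obj a)) :=
  of_eq (F.map_id a)

end SameArrow

theorem functor_eq {D : Type u} [Category.{v} D] {E : Type u₁} [Category.{v₁} E] {F G : D ⥤ E}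
    (h : ∀ a, F.obj a = G.obj a) (h' : ∀ {a b : D} (f : a ⟶ b), SameArrow (F.map f) (G.map f)) :
    F = G :=
  CategoryTheory.Functor.ext h fun _ _ f => by
    obtain ⟨_, _, e⟩ := (Arrow.mk_eq_mk_iff _ _).mp (h' f)
    exact e

/-- The strict pullback `A ×_D B` of categories along functors `F : A ⥤ D` and `G : B ⥤ D`. -/
structure StrictPullback {A : Type u₁} [Category.{v₁} A] {B : Type u₂} [Category.{v₂} B]
    {D : Type u₃} [Category.{v₃} D] (F : A ⥤ D) (G : B ⥤ D) where
  fst : A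
  snd : B
  eq : F.obj fst = G.obj snd

namespace StrictPullback

variable {A : Type u₁} [Category.{v₁} A] {B : Type u₂} [Category.{v₂} B]
  {D : Type u₃} [Category.{v₃} D] {F : A ⥤ D} {G : B ⥤ D}

/-- A morphism of the strict pullback: a pair of morphisms with the same image. -/
@[ext]
structure Hom (P Q : StrictPullback F G) where
  fst : P.fst ⟶ Q.fst
  snd : P.snd ⟶ Q.snd
  same : SameArrow (F.map fst) (G.map snd)

instance category : Category (StrictPullback F G) where
  Hom := Hom
  id P := ⟨𝟙 _, 𝟙 _, by
    rw [F.map_id, G.map_id]; exact SameArrow.id P.eq⟩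
  comp f g := ⟨f.fst ≫ g.fst, f.snd ≫ g.snd, by
    rw [F.map_comp, G.map_comp]; exact f.same.comp g.same⟩
  id_comp f := Hom.ext (Category.id_comp _) (Category.id_comp _)
  comp_id f := Hom.ext (Category.comp_id _) (Category.comp_id _)
  assoc f g h := Hom.ext (Category.assoc _ _ _) (Category.assoc _ _ _)

/-- The first projection. -/
def π₁ (F : A ⥤ D) (G : B ⥤ D) : StrictPullback F G ⥤ A where
  obj P := P.fst
  map f := Hom.fst f

/-- The second projection. -/
def π₂ (F : A ⥤ D) (G : B ⥤ D) : StrictPullback F G ⥤ B where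
  obj P := P.snd
  map f := Hom.snd f

theorem condition (F : A ⥤ D) (G : B ⥤ D) : π₁ F G ⋙ F = π₂ F G ⋙ G :=
  functor_eq (fun P => P.eq) fun f => Hom.same f

/-- The functor into the strict pullback given by a pair of functors that agree over the base. -/
def lift {X : Type u} [Category.{v} X] (H : X ⥤ A) (K : X ⥤ B) (e : H ⋙ F = K ⋙ G) :
    X ⥤ StrictPullback F G where
  obj x := ⟨H.obj x, K.obj x, Functor.congr_obj e x⟩
  map f := ⟨H.map f, K.map f, SameArrow.of_functor_eq e f⟩
  map_id x := Hom.ext (H.map_id x) (K.map_id x)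
  map_comp f g := Hom.ext (H.map_comp f g) (K.map_comp f g)

/-- An isomorphism of the strict pullback from a pair of isomorphisms with the same image. -/
def mkIso {P Q : StrictPullback F G} (f : P.fst ≅ Q.fst) (g : P.snd ≅ Q.snd)
    (h : SameArrow (F.map f.hom) (G.map g.hom)) : P ≅ Q where
  hom := ⟨f.hom, g.hom, h⟩
  inv := ⟨f.inv, g.inv, SameArrow.inv (f := F.mapIso f) (g := G.mapIso g) h⟩
  hom_inv_id := Hom.ext f.hom_inv_id g.hom_inv_id
  inv_hom_id := Hom.ext f.inv_hom_id g.inv_hom_id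

end StrictPullback

/-- `S` is the set of directions obtained from `T` by adding one new direction `i`. -/
structure IsFace {n : ℕ} (i : Fin n) (T S : Finset (Fin n)) : Prop where
  notMem : i ∉ T
  insert_eq : insert i T = S

namespace IsFace

variable {n : ℕ} {i j : Fin n} {T T' S U : Finset (Fin n)}

theorem erase (h : i ∈ S) : IsFace i (S.erase i) S :=
  ⟨Finset.notMem_erase i S, Finset.insert_erase h⟩

theorem exists_common (hij : i ≠ j) (hi : IsFace i T S) (hj : IsFace j T' S) :
    ∃ U, IsFace i U T' ∧ IsFace j U T := by
  obtain ⟨hi₁, rfl⟩ := hi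
  obtain ⟨hj₁, hj₂⟩ := hj
  have hjT : j ∈ T := by
    have : j ∈ insert i T := hj₂ ▸ Finset.mem_insert_self j T'
    exact (Finset.mem_insert.mp this).resolve_left (Ne.symm hij)
  refine ⟨T.erase j, ⟨fun h => hi₁ (Finset.mem_of_mem_erase h), ?_⟩, erase hjT⟩
  have h₁ : T' = (insert i T).erase j := by rw [← hj₂, Finset.erase_insert hj₁]
  rw [h₁, Finset.erase_insert_of_ne hij]

end IsFace

/-- Categories of `k`-morphisms in all `k`-element sets of directions, with strictly compatible
sources, targets and identities. The category of `k`-morphisms `kMor` is the coproduct of the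
categories `Mor S` over the sets `S` of `k` directions. -/
structure CubeFaces (n : ℕ) where
  /-- `k`-morphisms in the directions `S`, where `k = S.card`. -/
  Mor : Finset (Fin n) → Type u
  /-- The transversal morphisms between `k`-morphisms. -/
  [cat : ∀ S, Category.{v} (Mor S)]
  src {i : Fin n} {T S : Finset (Fin n)} : IsFace i T S → (Mor S ⥤ Mor T)
  tgt {i : Fin n} {T S : Finset (Fin n)} : IsFace i T S → (Mor S ⥤ Mor T)
  unit {i : Fin n} {T S : Finset (Fin n)} : IsFace i T S → (Mor T ⥤ Mor S)
  unit_src {i : Fin n} {T S : Finset (Fin n)} (h : IsFace i T S) : unit h ⋙ src h = 𝟭 (Mor T)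
  unit_tgt {i : Fin n} {T S : Finset (Fin n)} (h : IsFace i T S) : unit h ⋙ tgt h = 𝟭 (Mor T)
  src_src {i j : Fin n} {U T T' S : Finset (Fin n)} (hi : IsFace i T S) (hj : IsFace j T' S)
    (hi' : IsFace i U T') (hj' : IsFace j U T) : src hi ⋙ src hj' = src hj ⋙ src hi'
  src_tgt {i j : Fin n} {U T T' S : Finset (Fin n)} (hi : IsFace i T S) (hj : IsFace j T' S)
    (hi' : IsFace i U T') (hj' : IsFace j U T) : src hi ⋙ tgt hj' = tgt hj ⋙ src hi'
  tgt_tgt {i j : Fin n} {U T T' S : Finset (Fin n)} (hi : IsFace i T S) (hj : IsFace j T' S)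
    (hi' : IsFace i U T') (hj' : IsFace j U T) : tgt hi ⋙ tgt hj' = tgt hj ⋙ tgt hi'
  unit_src_ne {i j : Fin n} {U T T' S : Finset (Fin n)} (hi : IsFace i T S) (hj : IsFace j T' S)
    (hi' : IsFace i U T') (hj' : IsFace j U T) : unit hj ⋙ src hi = src hi' ⋙ unit hj'
  unit_tgt_ne {i j : Fin n} {U T T' S : Finset (Fin n)} (hi : IsFace i T S) (hj : IsFace j T' S)
    (hi' : IsFace i U T') (hj' : IsFace j U T) : unit hj ⋙ tgt hi = tgt hi' ⋙ unit hj'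
  unit_unit {i j : Fin n} {U T T' S : Finset (Fin n)} (hi : IsFace i T S) (hj : IsFace j T' S)
    (hi' : IsFace i U T') (hj' : IsFace j U T) : unit hj' ⋙ unit hi = unit hi' ⋙ unit hj

attribute [instance] CubeFaces.cat

namespace CubeFaces

variable {n : ℕ} (C : CubeFaces.{v, u} n) {i j : Fin n} {U T T' S : Finset (Fin n)}

/-- The category `kMor ×_{(k-1)𝐌𝐨𝐫} kMor` of pairs composable in a given direction. -/
abbrev Pairs (h : IsFace i T S) : Type _ := StrictPullback (C.tgt h) (C.src h)

/-- `x` and `y` are composable: the target of `x` is the source of `y`. -/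
def Meets (h : IsFace i T S) (x y : C.Mor S) : Prop := (C.tgt h).obj x = (C.src h).obj y

/-- `f` and `g` are composable: the target of `f` is the source of `g`. -/
def MeetsMap (h : IsFace i T S) {x x' y y' : C.Mor S} (f : x ⟶ x') (g : y ⟶ y') : Prop :=
  SameArrow ((C.tgt h).map f) ((C.src h).map g)

variable {C}

theorem MeetsMap.left {h : IsFace i T S} {x x' y y' : C.Mor S} {f : x ⟶ x'} {g : y ⟶ y'}
    (e : C.MeetsMap h f g) : C.Meets h x y :=
  congrArg Comma.left e

theorem MeetsMap.right {h : IsFace i T S} {x x' y y' : C.Mor S} {f : x ⟶ x'} {g : y ⟶ y'}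
    (e : C.MeetsMap h f g) : C.Meets h x' y' :=
  congrArg Comma.right e

variable (C)

theorem pairs_src (hi : IsFace i T S) (hj : IsFace j T' S) (hi' : IsFace i U T')
    (hj' : IsFace j U T) :
    (StrictPullback.π₁ (C.tgt hi) (C.src hi) ⋙ C.src hj) ⋙ C.tgt hi' =
      (StrictPullback.π₂ (C.tgt hi) (C.src hi) ⋙ C.src hj) ⋙ C.src hi' := by
  rw [Functor.assoc, C.src_tgt hj hi hj' hi', ← Functor.assoc, StrictPullback.condition,
    Functor.assoc, C.src_src hi hj hi' hj', ← Functor.assoc]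

theorem pairs_tgt (hi : IsFace i T S) (hj : IsFace j T' S) (hi' : IsFace i U T')
    (hj' : IsFace j U T) :
    (StrictPullback.π₁ (C.tgt hi) (C.src hi) ⋙ C.tgt hj) ⋙ C.tgt hi' =
      (StrictPullback.π₂ (C.tgt hi) (C.src hi) ⋙ C.tgt hj) ⋙ C.src hi' := by
  rw [Functor.assoc, C.tgt_tgt hj hi hj' hi', ← Functor.assoc, StrictPullback.condition,
    Functor.assoc, C.src_tgt hi hj hi' hj', ← Functor.assoc]

theorem pairs_unit (hi : IsFace i T S) (hj : IsFace j T' S) (hi' : IsFace i U T')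
    (hj' : IsFace j U T) :
    (StrictPullback.π₁ (C.tgt hi') (C.src hi') ⋙ C.unit hj) ⋙ C.tgt hi =
      (StrictPullback.π₂ (C.tgt hi') (C.src hi') ⋙ C.unit hj) ⋙ C.src hi := by
  rw [Functor.assoc, C.unit_tgt_ne hi hj hi' hj', ← Functor.assoc, StrictPullback.condition,
    Functor.assoc, ← C.unit_src_ne hi hj hi' hj', ← Functor.assoc]

theorem unit_left_meets (h : IsFace i T S) :
    (C.src h ⋙ C.unit h) ⋙ C.tgt h = 𝟭 (C.Mor S) ⋙ C.src h := by
  rw [Functor.assoc, C.unit_tgt]; rfl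

theorem unit_right_meets (h : IsFace i T S) :
    𝟭 (C.Mor S) ⋙ C.tgt h = (C.tgt h ⋙ C.unit h) ⋙ C.src h := by
  rw [Functor.assoc, C.unit_src]; rfl

end CubeFaces

/-- Compositions in all directions, strictly unital and strictly compatible with sources, targets
and identities. -/
structure CubeCompositions (n : ℕ) extends CubeFaces.{v, u} n where
  comp {i : Fin n} {T S : Finset (Fin n)} (h : IsFace i T S) : toCubeFaces.Pairs h ⥤ Mor S
  comp_src {i : Fin n} {T S : Finset (Fin n)} (h : IsFace i T S) :
    comp h ⋙ src h = StrictPullback.π₁ (tgt h) (src h) ⋙ src h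
  comp_tgt {i : Fin n} {T S : Finset (Fin n)} (h : IsFace i T S) :
    comp h ⋙ tgt h = StrictPullback.π₂ (tgt h) (src h) ⋙ tgt h
  comp_src_ne {i j : Fin n} {U T T' S : Finset (Fin n)} (hi : IsFace i T S) (hj : IsFace j T' S)
    (hi' : IsFace i U T') (hj' : IsFace j U T) :
    comp hi ⋙ src hj =
      StrictPullback.lift (StrictPullback.π₁ (tgt hi) (src hi) ⋙ src hj)
        (StrictPullback.π₂ (tgt hi) (src hi) ⋙ src hj)
        (toCubeFaces.pairs_src hi hj hi' hj') ⋙ comp hi'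
  comp_tgt_ne {i j : Fin n} {U T T' S : Finset (Fin n)} (hi : IsFace i T S) (hj : IsFace j T' S)
    (hi' : IsFace i U T') (hj' : IsFace j U T) :
    comp hi ⋙ tgt hj =
      StrictPullback.lift (StrictPullback.π₁ (tgt hi) (src hi) ⋙ tgt hj)
        (StrictPullback.π₂ (tgt hi) (src hi) ⋙ tgt hj)
        (toCubeFaces.pairs_tgt hi hj hi' hj') ⋙ comp hi'
  comp_unit_ne {i j : Fin n} {U T T' S : Finset (Fin n)} (hi : IsFace i T S) (hj : IsFace j T' S)
    (hi' : IsFace i U T') (hj' : IsFace j U T) :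
    comp hi' ⋙ unit hj =
      StrictPullback.lift (StrictPullback.π₁ (tgt hi') (src hi') ⋙ unit hj)
        (StrictPullback.π₂ (tgt hi') (src hi') ⋙ unit hj)
        (toCubeFaces.pairs_unit hi hj hi' hj') ⋙ comp hi
  unit_comp {i : Fin n} {T S : Finset (Fin n)} (h : IsFace i T S) :
    StrictPullback.lift (src h ⋙ unit h) (𝟭 (Mor S)) (toCubeFaces.unit_left_meets h) ⋙ comp h =
      𝟭 (Mor S)
  comp_unit {i : Fin n} {T S : Finset (Fin n)} (h : IsFace i T S) :
    StrictPullback.lift (𝟭 (Mor S)) (tgt h ⋙ unit h) (toCubeFaces.unit_right_meets h) ⋙ comp h =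
      𝟭 (Mor S)

namespace CubeCompositions

variable {n : ℕ} (C : CubeCompositions.{v, u} n) {i j k : Fin n} {U T T' S : Finset (Fin n)}

/-- The composite `x ∘ᵢ y` of objects. -/
def op (h : IsFace i T S) (x y : C.Mor S) (e : C.Meets h x y) : C.Mor S := (C.comp h).obj ⟨x, y, e⟩

/-- The composite `f ∘ᵢ g` of transversal morphisms. -/
def opMap (h : IsFace i T S) {x x' y y' : C.Mor S} (f : x ⟶ x') (g : y ⟶ y')
    (e : C.MeetsMap h f g) : C.op h x y e.left ⟶ C.op h x' y' e.right :=
  (C.comp h).map (X := ⟨x, y, e.left⟩) (Y := ⟨x', y', e.right⟩) ⟨f, g, e⟩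

variable {C}

theorem src_op (h : IsFace i T S) {x y : C.Mor S} (e : C.Meets h x y) :
    (C.src h).obj (C.op h x y e) = (C.src h).obj x :=
  Functor.congr_obj (C.comp_src h) ⟨x, y, e⟩

theorem tgt_op (h : IsFace i T S) {x y : C.Mor S} (e : C.Meets h x y) :
    (C.tgt h).obj (C.op h x y e) = (C.tgt h).obj y :=
  Functor.congr_obj (C.comp_tgt h) ⟨x, y, e⟩

theorem src_opMap (h : IsFace i T S) {x x' y y' : C.Mor S} {f : x ⟶ x'} {g : y ⟶ y'}
    (e : C.MeetsMap h f g) : SameArrow ((C.src h).map (C.opMap h f g e)) ((C.src h).map f) :=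
  SameArrow.of_functor_eq (C.comp_src h) _

theorem tgt_opMap (h : IsFace i T S) {x x' y y' : C.Mor S} {f : x ⟶ x'} {g : y ⟶ y'}
    (e : C.MeetsMap h f g) : SameArrow ((C.tgt h).map (C.opMap h f g e)) ((C.tgt h).map g) :=
  SameArrow.of_functor_eq (C.comp_tgt h) _

theorem op_congr (h : IsFace i T S) {x y x' y' : C.Mor S} (hx : x = x') (hy : y = y')
    (e : C.Meets h x y) (e' : C.Meets h x' y') : C.op h x y e = C.op h x' y' e' := by
  subst hx hy; rfl

theorem opMap_congr (h : IsFace i T S) {a a' b b' c c' d d' : C.Mor S} {f : a ⟶ a'} {g : b ⟶ b'}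
    {f' : c ⟶ c'} {g' : d ⟶ d'} (hf : SameArrow f f') (hg : SameArrow g g')
    (e : C.MeetsMap h f g) (e' : C.MeetsMap h f' g') :
    SameArrow (C.opMap h f g e) (C.opMap h f' g' e') := by
  have h₁ : a = c := congrArg Comma.left hf
  have h₂ : a' = c' := congrArg Comma.right hf
  have h₃ : b = d := congrArg Comma.left hg
  have h₄ : b' = d' := congrArg Comma.right hg
  subst h₁ h₂ h₃ h₄
  have h₅ : f = f' := Arrow.mk_injective _ _ hf
  have h₆ : g = g' := Arrow.mk_injective _ _ hg
  subst h₅ h₆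
  exact SameArrow.refl _

theorem op_meets (h : IsFace i T S) {x y z : C.Mor S} (e₁ : C.Meets h x y) (e₂ : C.Meets h y z) :
    C.Meets h (C.op h x y e₁) z :=
  (tgt_op h e₁).trans e₂

theorem meets_op (h : IsFace i T S) {x y z : C.Mor S} (e₁ : C.Meets h x y) (e₂ : C.Meets h y z) :
    C.Meets h x (C.op h y z e₂) :=
  e₁.trans (src_op h e₂).symm

theorem opMap_meets (h : IsFace i T S) {x x' y y' z z' : C.Mor S} {f : x ⟶ x'} {g : y ⟶ y'}
    {k : z ⟶ z'} (e₁ : C.MeetsMap h f g) (e₂ : C.MeetsMap h g k) :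
    C.MeetsMap h (C.opMap h f g e₁) k :=
  (tgt_opMap h e₁).trans e₂

theorem meets_opMap (h : IsFace i T S) {x x' y y' z z' : C.Mor S} {f : x ⟶ x'} {g : y ⟶ y'}
    {k : z ⟶ z'} (e₁ : C.MeetsMap h f g) (e₂ : C.MeetsMap h g k) :
    C.MeetsMap h f (C.opMap h g k e₂) :=
  SameArrow.trans e₁ (src_opMap h e₂).symm

theorem src_meets (hi : IsFace i T S) (hj : IsFace j T' S) (hi' : IsFace i U T')
    (hj' : IsFace j U T) {x y : C.Mor S} (e : C.Meets hi x y) :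
    C.Meets hi' ((C.src hj).obj x) ((C.src hj).obj y) :=
  Functor.congr_obj (C.pairs_src hi hj hi' hj') ⟨x, y, e⟩

theorem tgt_meets (hi : IsFace i T S) (hj : IsFace j T' S) (hi' : IsFace i U T')
    (hj' : IsFace j U T) {x y : C.Mor S} (e : C.Meets hi x y) :
    C.Meets hi' ((C.tgt hj).obj x) ((C.tgt hj).obj y) :=
  Functor.congr_obj (C.pairs_tgt hi hj hi' hj') ⟨x, y, e⟩

theorem src_meetsMap (hi : IsFace i T S) (hj : IsFace j T' S) (hi' : IsFace i U T')
    (hj' : IsFace j U T) {x x' y y' : C.Mor S} {f : x ⟶ x'} {g : y ⟶ y'}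
    (e : C.MeetsMap hi f g) : C.MeetsMap hi' ((C.src hj).map f) ((C.src hj).map g) :=
  SameArrow.of_functor_eq (C.pairs_src hi hj hi' hj')
    (a := ⟨x, y, e.left⟩) (b := ⟨x', y', e.right⟩) ⟨f, g, e⟩

theorem tgt_meetsMap (hi : IsFace i T S) (hj : IsFace j T' S) (hi' : IsFace i U T')
    (hj' : IsFace j U T) {x x' y y' : C.Mor S} {f : x ⟶ x'} {g : y ⟶ y'}
    (e : C.MeetsMap hi f g) : C.MeetsMap hi' ((C.tgt hj).map f) ((C.tgt hj).map g) :=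
  SameArrow.of_functor_eq (C.pairs_tgt hi hj hi' hj')
    (a := ⟨x, y, e.left⟩) (b := ⟨x', y', e.right⟩) ⟨f, g, e⟩

/-- `s_j (x ∘ᵢ y) = s_j x ∘ᵢ s_j y` -/
theorem src_op_ne (hi : IsFace i T S) (hj : IsFace j T' S) (hi' : IsFace i U T')
    (hj' : IsFace j U T) {x y : C.Mor S} (e : C.Meets hi x y) :
    (C.src hj).obj (C.op hi x y e) =
      C.op hi' ((C.src hj).obj x) ((C.src hj).obj y) (src_meets hi hj hi' hj' e) :=
  Functor.congr_obj (C.comp_src_ne hi hj hi' hj') ⟨x, y, e⟩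

/-- `t_j (x ∘ᵢ y) = t_j x ∘ᵢ t_j y` -/
theorem tgt_op_ne (hi : IsFace i T S) (hj : IsFace j T' S) (hi' : IsFace i U T')
    (hj' : IsFace j U T) {x y : C.Mor S} (e : C.Meets hi x y) :
    (C.tgt hj).obj (C.op hi x y e) =
      C.op hi' ((C.tgt hj).obj x) ((C.tgt hj).obj y) (tgt_meets hi hj hi' hj' e) :=
  Functor.congr_obj (C.comp_tgt_ne hi hj hi' hj') ⟨x, y, e⟩

theorem src_opMap_ne (hi : IsFace i T S) (hj : IsFace j T' S) (hi' : IsFace i U T')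
    (hj' : IsFace j U T) {x x' y y' : C.Mor S} {f : x ⟶ x'} {g : y ⟶ y'}
    (e : C.MeetsMap hi f g) :
    SameArrow ((C.src hj).map (C.opMap hi f g e))
      (C.opMap hi' ((C.src hj).map f) ((C.src hj).map g) (src_meetsMap hi hj hi' hj' e)) :=
  SameArrow.of_functor_eq (C.comp_src_ne hi hj hi' hj') _

theorem tgt_opMap_ne (hi : IsFace i T S) (hj : IsFace j T' S) (hi' : IsFace i U T')
    (hj' : IsFace j U T) {x x' y y' : C.Mor S} {f : x ⟶ x'} {g : y ⟶ y'}
    (e : C.MeetsMap hi f g) :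
    SameArrow ((C.tgt hj).map (C.opMap hi f g e))
      (C.opMap hi' ((C.tgt hj).map f) ((C.tgt hj).map g) (tgt_meetsMap hi hj hi' hj' e)) :=
  SameArrow.of_functor_eq (C.comp_tgt_ne hi hj hi' hj') _

theorem op_meets_op (hij : i ≠ j) (hi : IsFace i T S) (hj : IsFace j T' S) {x y x' y' : C.Mor S}
    (e : C.Meets hi x y) (e' : C.Meets hi x' y') (ex : C.Meets hj x x') (ey : C.Meets hj y y') :
    C.Meets hj (C.op hi x y e) (C.op hi x' y' e') := by
  obtain ⟨U, hi', hj'⟩ := IsFace.exists_common hij hi hj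
  exact (tgt_op_ne hi hj hi' hj' e).trans
    ((op_congr hi' ex ey _ _).trans (src_op_ne hi hj hi' hj' e').symm)

theorem opMap_meets_opMap (hij : i ≠ j) (hi : IsFace i T S) (hj : IsFace j T' S)
    {x y x' y' a b a' b' : C.Mor S} {f : x ⟶ a} {g : y ⟶ b} {f' : x' ⟶ a'} {g' : y' ⟶ b'}
    (e : C.MeetsMap hi f g) (e' : C.MeetsMap hi f' g') (ef : C.MeetsMap hj f f')
    (eg : C.MeetsMap hj g g') :
    C.MeetsMap hj (C.opMap hi f g e) (C.opMap hi f' g' e') := by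
  obtain ⟨U, hi', hj'⟩ := IsFace.exists_common hij hi hj
  exact (tgt_opMap_ne hi hj hi' hj' e).trans
    ((opMap_congr hi' ef eg _ _).trans (src_opMap_ne hi hj hi' hj' e').symm)

end CubeCompositions

open CubeCompositions in
/-- Associators and interchangers: natural isomorphisms, compatible with sources and targets. -/
structure CubeConstraints {n : ℕ} (C : CubeCompositions.{v, u} n) where
  /-- `αᵢ : (x ∘ᵢ y) ∘ᵢ z ≅ x ∘ᵢ (y ∘ᵢ z)` -/
  assoc {i : Fin n} {T S : Finset (Fin n)} (h : IsFace i T S) (x y z : C.Mor S)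
    (e₁ : C.Meets h x y) (e₂ : C.Meets h y z) :
    C.op h (C.op h x y e₁) z (op_meets h e₁ e₂) ≅
      C.op h x (C.op h y z e₂) (meets_op h e₁ e₂)
  assoc_naturality {i : Fin n} {T S : Finset (Fin n)} (h : IsFace i T S) {x y z x' y' z' : C.Mor S}
    (f : x ⟶ x') (g : y ⟶ y') (k : z ⟶ z')
    (e₁ : C.MeetsMap h f g) (e₂ : C.MeetsMap h g k) :
    C.opMap h (C.opMap h f g e₁) k (opMap_meets h e₁ e₂) ≫
        (assoc h x' y' z' e₁.right e₂.right).hom =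
      (assoc h x y z e₁.left e₂.left).hom ≫
        C.opMap h f (C.opMap h g k e₂) (meets_opMap h e₁ e₂)
  src_assoc {i : Fin n} {T S : Finset (Fin n)} (h : IsFace i T S) (x y z : C.Mor S)
    (e₁ : C.Meets h x y) (e₂ : C.Meets h y z) :
    SameArrow ((C.src h).map (assoc h x y z e₁ e₂).hom) (𝟙 ((C.src h).obj x))
  tgt_assoc {i : Fin n} {T S : Finset (Fin n)} (h : IsFace i T S) (x y z : C.Mor S)
    (e₁ : C.Meets h x y) (e₂ : C.Meets h y z) :
    SameArrow ((C.tgt h).map (assoc h x y z e₁ e₂).hom) (𝟙 ((C.tgt h).obj z))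
  src_assoc_ne {i j : Fin n} {U T T' S : Finset (Fin n)} (hi : IsFace i T S) (hj : IsFace j T' S)
    (hi' : IsFace i U T') (hj' : IsFace j U T) (x y z : C.Mor S)
    (e₁ : C.Meets hi x y) (e₂ : C.Meets hi y z) :
    SameArrow ((C.src hj).map (assoc hi x y z e₁ e₂).hom)
      (assoc hi' ((C.src hj).obj x) ((C.src hj).obj y) ((C.src hj).obj z)
        (src_meets hi hj hi' hj' e₁) (src_meets hi hj hi' hj' e₂)).hom
  tgt_assoc_ne {i j : Fin n} {U T T' S : Finset (Fin n)} (hi : IsFace i T S) (hj : IsFace j T' S)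
    (hi' : IsFace i U T') (hj' : IsFace j U T) (x y z : C.Mor S)
    (e₁ : C.Meets hi x y) (e₂ : C.Meets hi y z) :
    SameArrow ((C.tgt hj).map (assoc hi x y z e₁ e₂).hom)
      (assoc hi' ((C.tgt hj).obj x) ((C.tgt hj).obj y) ((C.tgt hj).obj z)
        (tgt_meets hi hj hi' hj' e₁) (tgt_meets hi hj hi' hj' e₂)).hom
  /-- `βᵢⱼ : (x ∘ᵢ y) ∘ⱼ (x' ∘ᵢ y') ≅ (x ∘ⱼ x') ∘ᵢ (y ∘ⱼ y')` -/
  inter {i j : Fin n} {T T' S : Finset (Fin n)} (hij : i ≠ j) (hi : IsFace i T S)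
    (hj : IsFace j T' S) (x y x' y' : C.Mor S)
    (e : C.Meets hi x y) (e' : C.Meets hi x' y')
    (ex : C.Meets hj x x') (ey : C.Meets hj y y') :
    C.op hj (C.op hi x y e) (C.op hi x' y' e')
        (op_meets_op hij hi hj e e' ex ey) ≅
      C.op hi (C.op hj x x' ex) (C.op hj y y' ey)
        (op_meets_op hij.symm hj hi ex ey e e')
  inter_naturality {i j : Fin n} {T T' S : Finset (Fin n)} (hij : i ≠ j) (hi : IsFace i T S)
    (hj : IsFace j T' S) {x y x' y' a b a' b' : C.Mor S}
    (f : x ⟶ a) (g : y ⟶ b) (f' : x' ⟶ a') (g' : y' ⟶ b')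
    (e : C.MeetsMap hi f g) (e' : C.MeetsMap hi f' g')
    (ef : C.MeetsMap hj f f') (eg : C.MeetsMap hj g g') :
    C.opMap hj (C.opMap hi f g e)
          (C.opMap hi f' g' e') (opMap_meets_opMap hij hi hj e e' ef eg) ≫
        (inter hij hi hj a b a' b' e.right e'.right ef.right eg.right).hom =
      (inter hij hi hj x y x' y' e.left e'.left ef.left eg.left).hom ≫
        C.opMap hi (C.opMap hj f f' ef)
          (C.opMap hj g g' eg) (opMap_meets_opMap hij.symm hj hi ef eg e e')
  /-- `βⱼᵢ = βᵢⱼ⁻¹` -/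
  inter_symm {i j : Fin n} {T T' S : Finset (Fin n)} (hij : i ≠ j) (hi : IsFace i T S)
    (hj : IsFace j T' S) (x y x' y' : C.Mor S)
    (e : C.Meets hi x y) (e' : C.Meets hi x' y')
    (ex : C.Meets hj x x') (ey : C.Meets hj y y') :
    inter hij.symm hj hi x x' y y' ex ey e e' = (inter hij hi hj x y x' y' e e' ex ey).symm
  src_inter {i j : Fin n} {T T' S : Finset (Fin n)} (hij : i ≠ j) (hi : IsFace i T S)
    (hj : IsFace j T' S) (x y x' y' : C.Mor S)
    (e : C.Meets hi x y) (e' : C.Meets hi x' y')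
    (ex : C.Meets hj x x') (ey : C.Meets hj y y') :
    SameArrow ((C.src hj).map (inter hij hi hj x y x' y' e e' ex ey).hom)
      (𝟙 ((C.src hj).obj (C.op hi x y e)))
  tgt_inter {i j : Fin n} {T T' S : Finset (Fin n)} (hij : i ≠ j) (hi : IsFace i T S)
    (hj : IsFace j T' S) (x y x' y' : C.Mor S)
    (e : C.Meets hi x y) (e' : C.Meets hi x' y')
    (ex : C.Meets hj x x') (ey : C.Meets hj y y') :
    SameArrow ((C.tgt hj).map (inter hij hi hj x y x' y' e e' ex ey).hom)
      (𝟙 ((C.tgt hj).obj (C.op hi x' y' e')))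
  src_inter_ne {i j l : Fin n} {T T' R S Uᵢ Uⱼ : Finset (Fin n)} (hij : i ≠ j)
    (hi : IsFace i T S) (hj : IsFace j T' S) (hl : IsFace l R S)
    (hi' : IsFace i Uᵢ R) (hj' : IsFace j Uⱼ R) (hli : IsFace l Uᵢ T) (hlj : IsFace l Uⱼ T')
    (x y x' y' : C.Mor S)
    (e : C.Meets hi x y) (e' : C.Meets hi x' y')
    (ex : C.Meets hj x x') (ey : C.Meets hj y y') :
    SameArrow ((C.src hl).map (inter hij hi hj x y x' y' e e' ex ey).hom)
      (inter hij hi' hj' ((C.src hl).obj x) ((C.src hl).obj y) ((C.src hl).obj x') ((C.src hl).obj y')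
        (src_meets hi hl hi' hli e) (src_meets hi hl hi' hli e')
        (src_meets hj hl hj' hlj ex) (src_meets hj hl hj' hlj ey)).hom
  tgt_inter_ne {i j l : Fin n} {T T' R S Uᵢ Uⱼ : Finset (Fin n)} (hij : i ≠ j)
    (hi : IsFace i T S) (hj : IsFace j T' S) (hl : IsFace l R S)
    (hi' : IsFace i Uᵢ R) (hj' : IsFace j Uⱼ R) (hli : IsFace l Uᵢ T) (hlj : IsFace l Uⱼ T')
    (x y x' y' : C.Mor S)
    (e : C.Meets hi x y) (e' : C.Meets hi x' y')
    (ex : C.Meets hj x x') (ey : C.Meets hj y y') :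
    SameArrow ((C.tgt hl).map (inter hij hi hj x y x' y' e e' ex ey).hom)
      (inter hij hi' hj' ((C.tgt hl).obj x) ((C.tgt hl).obj y) ((C.tgt hl).obj x') ((C.tgt hl).obj y')
        (tgt_meets hi hl hi' hli e) (tgt_meets hi hl hi' hli e')
        (tgt_meets hj hl hj' hlj ex) (tgt_meets hj hl hj' hlj ey)).hom

namespace CubeConstraints

variable {n : ℕ} {C : CubeCompositions.{v, u} n} (K : CubeConstraints C) {i j k : Fin n}
  {T T' T'' S : Finset (Fin n)}

theorem assoc_meets_id (h : IsFace i T S) {x y z w : C.Mor S} (e₁ : C.Meets h x y)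
    (e₂ : C.Meets h y z) (e₃ : C.Meets h z w) :
    C.MeetsMap h (K.assoc h x y z e₁ e₂).hom (𝟙 w) :=
  (K.tgt_assoc h x y z e₁ e₂).trans ((SameArrow.id e₃).trans (SameArrow.map_id _ _).symm)

theorem id_meets_assoc (h : IsFace i T S) {x y z w : C.Mor S} (e₁ : C.Meets h x y)
    (e₂ : C.Meets h y z) (e₃ : C.Meets h z w) :
    C.MeetsMap h (𝟙 x) (K.assoc h y z w e₂ e₃).hom :=
  (SameArrow.map_id _ _).trans ((SameArrow.id e₁).trans (K.src_assoc h y z w e₂ e₃).symm)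

theorem assoc_congr (h : IsFace i T S) {x y z x' y' z' : C.Mor S} (hx : x = x') (hy : y = y')
    (hz : z = z') (e₁ : C.Meets h x y) (e₂ : C.Meets h y z) (e₁' : C.Meets h x' y')
    (e₂' : C.Meets h y' z') :
    SameArrow (K.assoc h x y z e₁ e₂).hom (K.assoc h x' y' z' e₁' e₂').hom := by
  subst hx hy hz; exact SameArrow.refl _

theorem inter_congr (hij : i ≠ j) (hi : IsFace i T S) (hj : IsFace j T' S)
    {x y x' y' a b a' b' : C.Mor S} (hx : x = a) (hy : y = b) (hx' : x' = a') (hy' : y' = b')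
    (e : C.Meets hi x y) (e' : C.Meets hi x' y') (ex : C.Meets hj x x') (ey : C.Meets hj y y')
    (d : C.Meets hi a b) (d' : C.Meets hi a' b') (dx : C.Meets hj a a') (dy : C.Meets hj b b') :
    SameArrow (K.inter hij hi hj x y x' y' e e' ex ey).hom
      (K.inter hij hi hj a b a' b' d d' dx dy).hom := by
  subst hx hy hx' hy'; exact SameArrow.refl _

theorem assoc_meets_assoc (hij : i ≠ j) (hi : IsFace i T S) (hj : IsFace j T' S)
    {x y z x' y' z' : C.Mor S} (e₁ : C.Meets hi x y) (e₂ : C.Meets hi y z)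
    (e₁' : C.Meets hi x' y') (e₂' : C.Meets hi y' z')
    (ex : C.Meets hj x x') (ey : C.Meets hj y y') (ez : C.Meets hj z z') :
    C.MeetsMap hj (K.assoc hi x y z e₁ e₂).hom (K.assoc hi x' y' z' e₁' e₂').hom := by
  obtain ⟨U, hi', hj'⟩ := IsFace.exists_common hij hi hj
  exact (K.tgt_assoc_ne hi hj hi' hj' x y z e₁ e₂).trans
    ((K.assoc_congr hi' ex ey ez _ _ _ _).trans
      (K.src_assoc_ne hi hj hi' hj' x' y' z' e₁' e₂').symm)

/-- The target of `βᵢⱼ` in the direction `i` is an identity. -/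
theorem tgt_inter_left (hij : i ≠ j) (hi : IsFace i T S) (hj : IsFace j T' S)
    (x y x' y' : C.Mor S) (e : C.Meets hi x y) (e' : C.Meets hi x' y') (ex : C.Meets hj x x')
    (ey : C.Meets hj y y') :
    SameArrow ((C.tgt hi).map (K.inter hij hi hj x y x' y' e e' ex ey).hom)
      (𝟙 ((C.tgt hi).obj (C.op hj y y' ey))) := by
  have h := K.tgt_inter hij.symm hj hi x x' y y' ex ey e e'
  rw [K.inter_symm hij hi hj x y x' y' e e' ex ey] at h
  exact SameArrow.inv (f := (C.tgt hi).mapIso (K.inter hij hi hj x y x' y' e e' ex ey).symm)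
    (g := Iso.refl _) h

/-- The source of `βᵢⱼ` in the direction `i` is an identity. -/
theorem src_inter_left (hij : i ≠ j) (hi : IsFace i T S) (hj : IsFace j T' S)
    (x y x' y' : C.Mor S) (e : C.Meets hi x y) (e' : C.Meets hi x' y') (ex : C.Meets hj x x')
    (ey : C.Meets hj y y') :
    SameArrow ((C.src hi).map (K.inter hij hi hj x y x' y' e e' ex ey).hom)
      (𝟙 ((C.src hi).obj (C.op hj x x' ex))) := by
  have h := K.src_inter hij.symm hj hi x x' y y' ex ey e e'
  rw [K.inter_symm hij hi hj x y x' y' e e' ex ey] at h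
  exact SameArrow.inv (f := (C.src hi).mapIso (K.inter hij hi hj x y x' y' e e' ex ey).symm)
    (g := Iso.refl _) h

theorem inter_meets_id (hij : i ≠ j) (hi : IsFace i T S) (hj : IsFace j T' S)
    {x y x' y' w : C.Mor S} (e : C.Meets hi x y) (e' : C.Meets hi x' y') (ex : C.Meets hj x x')
    (ey : C.Meets hj y y') (ew : C.Meets hi (C.op hj y y' ey) w) :
    C.MeetsMap hi (K.inter hij hi hj x y x' y' e e' ex ey).hom (𝟙 w) :=
  (K.tgt_inter_left hij hi hj x y x' y' e e' ex ey).trans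
    ((SameArrow.id ew).trans (SameArrow.map_id _ _).symm)

theorem id_meets_inter (hij : i ≠ j) (hi : IsFace i T S) (hj : IsFace j T' S)
    {x y x' y' w : C.Mor S} (e : C.Meets hi x y) (e' : C.Meets hi x' y') (ex : C.Meets hj x x')
    (ey : C.Meets hj y y') (ew : C.Meets hi w (C.op hj x x' ex)) :
    C.MeetsMap hi (𝟙 w) (K.inter hij hi hj x y x' y' e e' ex ey).hom :=
  (SameArrow.map_id _ _).trans
    ((SameArrow.id ew).trans (K.src_inter_left hij hi hj x y x' y' e e' ex ey).symm)

theorem inter_meets_inter (hij : i ≠ j) (hik : i ≠ k) (hjk : j ≠ k)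
    (hi : IsFace i T S) (hj : IsFace j T' S) (hk : IsFace k T'' S)
    {x y x' y' a b a' b' : C.Mor S}
    (e : C.Meets hi x y) (e' : C.Meets hi x' y') (ex : C.Meets hj x x') (ey : C.Meets hj y y')
    (d : C.Meets hi a b) (d' : C.Meets hi a' b') (dx : C.Meets hj a a') (dy : C.Meets hj b b')
    (fx : C.Meets hk x a) (fy : C.Meets hk y b) (fx' : C.Meets hk x' a')
    (fy' : C.Meets hk y' b') :
    C.MeetsMap hk (K.inter hij hi hj x y x' y' e e' ex ey).hom
      (K.inter hij hi hj a b a' b' d d' dx dy).hom := by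
  obtain ⟨U, hi', hki⟩ := IsFace.exists_common hik hi hk
  obtain ⟨V, hj', hkj⟩ := IsFace.exists_common hjk hj hk
  exact (K.tgt_inter_ne hij hi hj hk hi' hj' hki hkj x y x' y' e e' ex ey).trans
    ((K.inter_congr hij hi' hj' fx fy fx' fy' _ _ _ _ _ _ _ _).trans
      (K.src_inter_ne hij hi hj hk hi' hj' hki hkj a b a' b' d d' dx dy).symm)

end CubeConstraints

theorem CubeFaces.unit_meets {n : ℕ} (C : CubeFaces.{v, u} n) {i : Fin n}
    {T S : Finset (Fin n)} (h : IsFace i T S) (x : C.Mor S) :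
    C.Meets h ((C.unit h).obj ((C.src h).obj x)) x :=
  Functor.congr_obj (C.unit_left_meets h) x

theorem CubeFaces.meets_unit {n : ℕ} (C : CubeFaces.{v, u} n) {i : Fin n}
    {T S : Finset (Fin n)} (h : IsFace i T S) (x : C.Mor S) :
    C.Meets h x ((C.unit h).obj ((C.tgt h).obj x)) :=
  Functor.congr_obj (C.unit_right_meets h) x

theorem CubeFaces.meets_unit' {n : ℕ} (C : CubeFaces.{v, u} n) {i : Fin n}
    {T S : Finset (Fin n)} (h : IsFace i T S) {x y : C.Mor S} (e : C.Meets h x y) :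
    C.Meets h x ((C.unit h).obj ((C.src h).obj y)) := by
  have h' := C.meets_unit h x
  have e' : (C.tgt h).obj x = (C.src h).obj y := e
  rwa [e'] at h'

theorem CubeFaces.unit_meets_unit_src {n : ℕ} (C : CubeFaces.{v, u} n) {i j : Fin n}
    {T T' S : Finset (Fin n)} (hij : i ≠ j) (hi : IsFace i T S) (hj : IsFace j T' S)
    {x y : C.Mor S} (e : C.Meets hi x y) :
    C.Meets hi ((C.unit hj).obj ((C.src hj).obj x)) ((C.unit hj).obj ((C.src hj).obj y)) := by
  obtain ⟨U, hi', hj'⟩ := IsFace.exists_common hij hi hj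
  have e' : C.Meets hi' ((C.src hj).obj x) ((C.src hj).obj y) :=
    Functor.congr_obj (C.pairs_src hi hj hi' hj') ⟨x, y, e⟩
  exact Functor.congr_obj (C.pairs_unit hi hj hi' hj') ⟨_, _, e'⟩

theorem CubeFaces.unit_meets_unit_tgt {n : ℕ} (C : CubeFaces.{v, u} n) {i j : Fin n}
    {T T' S : Finset (Fin n)} (hij : i ≠ j) (hi : IsFace i T S) (hj : IsFace j T' S)
    {x y : C.Mor S} (e : C.Meets hi x y) :
    C.Meets hi ((C.unit hj).obj ((C.tgt hj).obj x)) ((C.unit hj).obj ((C.tgt hj).obj y)) := by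
  obtain ⟨U, hi', hj'⟩ := IsFace.exists_common hij hi hj
  have e' : C.Meets hi' ((C.tgt hj).obj x) ((C.tgt hj).obj y) :=
    Functor.congr_obj (C.pairs_tgt hi hj hi' hj') ⟨x, y, e⟩
  exact Functor.congr_obj (C.pairs_unit hi hj hi' hj') ⟨_, _, e'⟩

open CubeCompositions CubeConstraints in
/-- The coherence axioms for associators, interchangers and identities. -/
structure CubeConstraints.Coherent {n : ℕ} {C : CubeCompositions.{v, u} n}
    (K : CubeConstraints C) : Prop where
  pentagon {i : Fin n} {T S : Finset (Fin n)} (h : IsFace i T S) (x y z w : C.Mor S)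
    (e₁ : C.Meets h x y) (e₂ : C.Meets h y z) (e₃ : C.Meets h z w) :
    (K.assoc h (C.op h x y e₁) z w (op_meets h e₁ e₂) e₃).hom ≫
        (K.assoc h x y (C.op h z w e₃) e₁ (meets_op h e₂ e₃)).hom =
      C.opMap h (K.assoc h x y z e₁ e₂).hom (𝟙 w) (K.assoc_meets_id h e₁ e₂ e₃) ≫
        (K.assoc h x (C.op h y z e₂) w (meets_op h e₁ e₂) (op_meets h e₂ e₃)).hom ≫
          C.opMap h (𝟙 x) (K.assoc h y z w e₂ e₃).hom (K.id_meets_assoc h e₁ e₂ e₃)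
  /-- The hexagon from `((x ∘ᵢ y) ∘ᵢ z) ∘ⱼ ((x' ∘ᵢ y') ∘ᵢ z')` to
  `(x ∘ⱼ x') ∘ᵢ ((y ∘ⱼ y') ∘ᵢ (z ∘ⱼ z'))`. -/
  hexagon {i j : Fin n} {T T' S : Finset (Fin n)} (hij : i ≠ j) (hi : IsFace i T S)
    (hj : IsFace j T' S) (x y z x' y' z' : C.Mor S)
    (e₁ : C.Meets hi x y) (e₂ : C.Meets hi y z) (e₁' : C.Meets hi x' y') (e₂' : C.Meets hi y' z')
    (ex : C.Meets hj x x') (ey : C.Meets hj y y') (ez : C.Meets hj z z') :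
    (K.inter hij hi hj (C.op hi x y e₁) z (C.op hi x' y' e₁') z'
          (op_meets hi e₁ e₂) (op_meets hi e₁' e₂') (op_meets_op hij hi hj e₁ e₁' ex ey) ez).hom ≫
        C.opMap hi (K.inter hij hi hj x y x' y' e₁ e₁' ex ey).hom (𝟙 (C.op hj z z' ez))
          (K.inter_meets_id hij hi hj e₁ e₁' ex ey
            (op_meets_op hij.symm hj hi ey ez e₂ e₂')) ≫
        (K.assoc hi (C.op hj x x' ex) (C.op hj y y' ey) (C.op hj z z' ez)
          (op_meets_op hij.symm hj hi ex ey e₁ e₁')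
          (op_meets_op hij.symm hj hi ey ez e₂ e₂')).hom =
      C.opMap hj (K.assoc hi x y z e₁ e₂).hom (K.assoc hi x' y' z' e₁' e₂').hom
          (K.assoc_meets_assoc hij hi hj e₁ e₂ e₁' e₂' ex ey ez) ≫
        (K.inter hij hi hj x (C.op hi y z e₂) x' (C.op hi y' z' e₂')
          (meets_op hi e₁ e₂) (meets_op hi e₁' e₂') ex (op_meets_op hij hi hj e₂ e₂' ey ez)).hom ≫
        C.opMap hi (𝟙 (C.op hj x x' ex)) (K.inter hij hi hj y z y' z' e₂ e₂' ey ez).hom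
          (K.id_meets_inter hij hi hj e₂ e₂' ey ez
            (op_meets_op hij.symm hj hi ex ey e₁ e₁'))
  /-- The hexagon from `((x₀ ∘ᵢ y₀) ∘ⱼ (x₁ ∘ᵢ y₁)) ∘ₖ ((x₂ ∘ᵢ y₂) ∘ⱼ (x₃ ∘ᵢ y₃))` to
  `((x₀ ∘ₖ x₂) ∘ⱼ (x₁ ∘ₖ x₃)) ∘ᵢ ((y₀ ∘ₖ y₂) ∘ⱼ (y₁ ∘ₖ y₃))`. -/
  hexagon' {i j k : Fin n} {T T' T'' S : Finset (Fin n)} (hij : i ≠ j) (hik : i ≠ k) (hjk : j ≠ k)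
    (hi : IsFace i T S) (hj : IsFace j T' S) (hk : IsFace k T'' S)
    (x₀ y₀ x₁ y₁ x₂ y₂ x₃ y₃ : C.Mor S)
    (i₀ : C.Meets hi x₀ y₀) (i₁ : C.Meets hi x₁ y₁) (i₂ : C.Meets hi x₂ y₂)
    (i₃ : C.Meets hi x₃ y₃)
    (jx : C.Meets hj x₀ x₁) (jy : C.Meets hj y₀ y₁) (jx' : C.Meets hj x₂ x₃)
    (jy' : C.Meets hj y₂ y₃)
    (kx : C.Meets hk x₀ x₂) (ky : C.Meets hk y₀ y₂) (kx' : C.Meets hk x₁ x₃)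
    (ky' : C.Meets hk y₁ y₃) :
    C.opMap hk (K.inter hij hi hj x₀ y₀ x₁ y₁ i₀ i₁ jx jy).hom
          (K.inter hij hi hj x₂ y₂ x₃ y₃ i₂ i₃ jx' jy').hom
          (K.inter_meets_inter hij hik hjk hi hj hk i₀ i₁ jx jy i₂ i₃ jx' jy' kx ky kx' ky') ≫
        (K.inter hik hi hk (C.op hj x₀ x₁ jx) (C.op hj y₀ y₁ jy) (C.op hj x₂ x₃ jx')
          (C.op hj y₂ y₃ jy')
          (op_meets_op hij.symm hj hi jx jy i₀ i₁) (op_meets_op hij.symm hj hi jx' jy' i₂ i₃)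
          (op_meets_op hjk hj hk jx jx' kx kx') (op_meets_op hjk hj hk jy jy' ky ky')).hom ≫
        C.opMap hi (K.inter hjk hj hk x₀ x₁ x₂ x₃ jx jx' kx kx').hom
          (K.inter hjk hj hk y₀ y₁ y₂ y₃ jy jy' ky ky').hom
          (K.inter_meets_inter hjk hij.symm hik.symm hj hk hi jx jx' kx kx' jy jy' ky ky'
            i₀ i₁ i₂ i₃) =
      (K.inter hjk hj hk (C.op hi x₀ y₀ i₀) (C.op hi x₁ y₁ i₁) (C.op hi x₂ y₂ i₂)
          (C.op hi x₃ y₃ i₃)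
          (op_meets_op hij hi hj i₀ i₁ jx jy) (op_meets_op hij hi hj i₂ i₃ jx' jy')
          (op_meets_op hik hi hk i₀ i₂ kx ky) (op_meets_op hik hi hk i₁ i₃ kx' ky')).hom ≫
        C.opMap hj (K.inter hik hi hk x₀ y₀ x₂ y₂ i₀ i₂ kx ky).hom
          (K.inter hik hi hk x₁ y₁ x₃ y₃ i₁ i₃ kx' ky').hom
          (K.inter_meets_inter hik hij hjk.symm hi hk hj i₀ i₂ kx ky i₁ i₃ kx' ky'
            jx jy jx' jy') ≫
        (K.inter hij hi hj (C.op hk x₀ x₂ kx) (C.op hk y₀ y₂ ky) (C.op hk x₁ x₃ kx')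
          (C.op hk y₁ y₃ ky')
          (op_meets_op hik.symm hk hi kx ky i₀ i₂) (op_meets_op hik.symm hk hi kx' ky' i₁ i₃)
          (op_meets_op hjk.symm hk hj kx kx' jx jx') (op_meets_op hjk.symm hk hj ky ky' jy jy')).hom
  assoc_unit_left {i : Fin n} {T S : Finset (Fin n)} (h : IsFace i T S) (x y : C.Mor S)
    (e : C.Meets h x y) :
    SameArrow (K.assoc h ((C.unit h).obj ((C.src h).obj x)) x y (C.unit_meets h x) e).hom
      (𝟙 (C.op h x y e))
  assoc_unit_mid {i : Fin n} {T S : Finset (Fin n)} (h : IsFace i T S) (x y : C.Mor S)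
    (e : C.Meets h x y) :
    SameArrow
      (K.assoc h x ((C.unit h).obj ((C.src h).obj y)) y (C.meets_unit' h e) (C.unit_meets h y)).hom
      (𝟙 (C.op h x y e))
  assoc_unit_right {i : Fin n} {T S : Finset (Fin n)} (h : IsFace i T S) (x y : C.Mor S)
    (e : C.Meets h x y) :
    SameArrow (K.assoc h x y ((C.unit h).obj ((C.tgt h).obj y)) e (C.meets_unit h y)).hom
      (𝟙 (C.op h x y e))
  inter_unit_tgt {i j : Fin n} {T T' S : Finset (Fin n)} (hij : i ≠ j) (hi : IsFace i T S)
    (hj : IsFace j T' S) (x y : C.Mor S) (e : C.Meets hi x y) :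
    SameArrow
      (K.inter hij hi hj x y ((C.unit hj).obj ((C.tgt hj).obj x))
        ((C.unit hj).obj ((C.tgt hj).obj y)) e (C.unit_meets_unit_tgt hij hi hj e)
        (C.meets_unit hj x) (C.meets_unit hj y)).hom
      (𝟙 (C.op hi x y e))
  inter_unit_src {i j : Fin n} {T T' S : Finset (Fin n)} (hij : i ≠ j) (hi : IsFace i T S)
    (hj : IsFace j T' S) (x y : C.Mor S) (e : C.Meets hi x y) :
    SameArrow
      (K.inter hij hi hj ((C.unit hj).obj ((C.src hj).obj x))
        ((C.unit hj).obj ((C.src hj).obj y)) x y (C.unit_meets_unit_src hij hi hj e) e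
        (C.unit_meets hj x) (C.unit_meets hj y)).hom
      (𝟙 (C.op hi x y e))

/-- A pseudo `n`-fold category. -/
structure PseudoFoldCategory (n : ℕ) extends CubeCompositions.{v, u} n where
  constraints : CubeConstraints toCubeCompositions
  coherent : constraints.Coherent

/-! ### Composition of functors with values in `k`-morphisms -/

namespace CubeCompositions

variable {n : ℕ} (C : CubeCompositions.{v, u} n) {i j : Fin n} {T T' S : Finset (Fin n)}
  {X : Type u₁} [Category.{v₁} X]

/-- The functors `F` and `G` are composable: the target of `F` is the source of `G`. -/
def FunctorMeets (h : IsFace i T S) (F G : X ⥤ C.Mor S) : Prop := F ⋙ C.tgt h = G ⋙ C.src h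

/-- The composite functor `F ∘ᵢ G`. -/
def opFunctor (h : IsFace i T S) (F G : X ⥤ C.Mor S) (e : C.FunctorMeets h F G) : X ⥤ C.Mor S :=
  StrictPullback.lift F G e ⋙ C.comp h

/-- The isomorphism `φ ∘ᵢ ψ : F ∘ᵢ G ≅ F' ∘ᵢ G'`. -/
def opIso (h : IsFace i T S) {F F' G G' : X ⥤ C.Mor S} (φ : F ≅ F') (ψ : G ≅ G')
    (e : C.FunctorMeets h F G) (e' : C.FunctorMeets h F' G')
    (a : ∀ x, C.MeetsMap h (φ.hom.app x) (ψ.hom.app x)) :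
    C.opFunctor h F G e ≅ C.opFunctor h F' G' e' :=
  Functor.isoWhiskerRight
    (NatIso.ofComponents (F := StrictPullback.lift F G e) (G := StrictPullback.lift F' G' e')
      (fun x => StrictPullback.mkIso (φ.app x) (ψ.app x) (a x))
      (fun f => StrictPullback.Hom.ext (φ.hom.naturality f) (ψ.hom.naturality f)))
    (C.comp h)

variable {C}

theorem FunctorMeets.obj {h : IsFace i T S} {F G : X ⥤ C.Mor S} (e : C.FunctorMeets h F G)
    (x : X) : C.Meets h (F.obj x) (G.obj x) :=
  Functor.congr_obj e x

theorem FunctorMeets.map {h : IsFace i T S} {F G : X ⥤ C.Mor S} (e : C.FunctorMeets h F G)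
    {x y : X} (f : x ⟶ y) : C.MeetsMap h (F.map f) (G.map f) :=
  SameArrow.of_functor_eq e f

theorem opFunctor_meets {h : IsFace i T S} {F G H : X ⥤ C.Mor S} (e₁ : C.FunctorMeets h F G)
    (e₂ : C.FunctorMeets h G H) : C.FunctorMeets h (C.opFunctor h F G e₁) H :=
  functor_eq (fun x => op_meets h (e₁.obj x) (e₂.obj x))
    fun f => opMap_meets h (e₁.map f) (e₂.map f)

theorem meets_opFunctor {h : IsFace i T S} {F G H : X ⥤ C.Mor S} (e₁ : C.FunctorMeets h F G)
    (e₂ : C.FunctorMeets h G H) : C.FunctorMeets h F (C.opFunctor h G H e₂) :=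
  functor_eq (fun x => meets_op h (e₁.obj x) (e₂.obj x))
    fun f => meets_opMap h (e₁.map f) (e₂.map f)

theorem opFunctor_meets_opFunctor (hij : i ≠ j) {hi : IsFace i T S} {hj : IsFace j T' S}
    {F G F' G' : X ⥤ C.Mor S} (e : C.FunctorMeets hi F G) (e' : C.FunctorMeets hi F' G')
    (eF : C.FunctorMeets hj F F') (eG : C.FunctorMeets hj G G') :
    C.FunctorMeets hj (C.opFunctor hi F G e) (C.opFunctor hi F' G' e') :=
  functor_eq (fun x => op_meets_op hij hi hj (e.obj x) (e'.obj x) (eF.obj x) (eG.obj x))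
    fun f => opMap_meets_opMap hij hi hj (e.map f) (e'.map f) (eF.map f) (eG.map f)

end CubeCompositions

namespace CubeConstraints

variable {n : ℕ} {C : CubeCompositions.{v, u} n} (K : CubeConstraints C) {i j : Fin n}
  {T T' S : Finset (Fin n)} {X : Type u₁} [Category.{v₁} X]

open CubeCompositions in
/-- The associator `(F ∘ᵢ G) ∘ᵢ H ≅ F ∘ᵢ (G ∘ᵢ H)` of functors. -/
def assocFunctor (h : IsFace i T S) (F G H : X ⥤ C.Mor S) (e₁ : C.FunctorMeets h F G)
    (e₂ : C.FunctorMeets h G H) :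
    C.opFunctor h (C.opFunctor h F G e₁) H (opFunctor_meets e₁ e₂) ≅
      C.opFunctor h F (C.opFunctor h G H e₂) (meets_opFunctor e₁ e₂) :=
  NatIso.ofComponents
    (fun x => K.assoc h (F.obj x) (G.obj x) (H.obj x) (e₁.obj x) (e₂.obj x))
    (fun f => K.assoc_naturality h (F.map f) (G.map f) (H.map f) (e₁.map f) (e₂.map f))

open CubeCompositions in
/-- The interchanger `(F ∘ᵢ G) ∘ⱼ (F' ∘ᵢ G') ≅ (F ∘ⱼ F') ∘ᵢ (G ∘ⱼ G')` of functors. -/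
def interFunctor (hij : i ≠ j) (hi : IsFace i T S) (hj : IsFace j T' S)
    (F G F' G' : X ⥤ C.Mor S) (e : C.FunctorMeets hi F G) (e' : C.FunctorMeets hi F' G')
    (eF : C.FunctorMeets hj F F') (eG : C.FunctorMeets hj G G') :
    C.opFunctor hj (C.opFunctor hi F G e) (C.opFunctor hi F' G' e')
        (opFunctor_meets_opFunctor hij e e' eF eG) ≅
      C.opFunctor hi (C.opFunctor hj F F' eF) (C.opFunctor hj G G' eG)
        (opFunctor_meets_opFunctor hij.symm eF eG e e') :=
  NatIso.ofComponents
    (fun x => K.inter hij hi hj (F.obj x) (G.obj x) (F'.obj x) (G'.obj x)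
      (e.obj x) (e'.obj x) (eF.obj x) (eG.obj x))
    (fun f => K.inter_naturality hij hi hj (F.map f) (G.map f) (F'.map f) (G'.map f)
      (e.map f) (e'.map f) (eF.map f) (eG.map f))

end CubeConstraints

/-! ### Regular gluing diagrams -/

/-- The positions of the blocks of a cube with axes `S` cut into `p i` slices along each axis. -/
abbrev GridPos {n : ℕ} {S : Finset (Fin n)} (p : S → ℕ) : Type := {q : S → ℕ // ∀ i, q i < p i}

/-- An object of `(kMor)^p_c` for the regular diagram `c` with `p i` slices along each axis `i`:
a family of `k`-morphisms, one for each block, such that any two adjacent blocks are composable. -/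
structure Grid {n : ℕ} (C : CubeFaces.{v, u} n) (S : Finset (Fin n)) (p : S → ℕ) where
  cell : GridPos p → C.Mor S
  meets : ∀ (i : S) (q q' : GridPos p), q'.1 = Function.update q.1 i (q.1 i + 1) →
    C.Meets (IsFace.erase i.2) (cell q) (cell q')

namespace Grid

variable {n : ℕ} {C : CubeFaces.{v, u} n} {S : Finset (Fin n)} {p : S → ℕ}

/-- A morphism of `(kMor)^p_c`: a composable family of transversal morphisms. -/
@[ext]
structure Hom (x y : Grid C S p) where
  cell : ∀ q, x.cell q ⟶ y.cell q
  meets : ∀ (i : S) (q q' : GridPos p), q'.1 = Function.update q.1 i (q.1 i + 1) →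
    C.MeetsMap (IsFace.erase i.2) (cell q) (cell q')

instance category : Category (Grid C S p) where
  Hom := Hom
  id x := ⟨fun _ => 𝟙 _, fun i q q' h => (SameArrow.map_id _ _).trans
    ((SameArrow.id (x.meets i q q' h)).trans (SameArrow.map_id _ _).symm)⟩
  comp f g := ⟨fun q => f.cell q ≫ g.cell q, fun i q q' h => by
    unfold CubeFaces.MeetsMap
    rw [Functor.map_comp, Functor.map_comp]
    exact SameArrow.comp (f.meets i q q' h) (g.meets i q q' h)⟩
  id_comp f := Hom.ext (funext fun _ => Category.id_comp _)
  comp_id f := Hom.ext (funext fun _ => Category.comp_id _)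
  assoc f g h := Hom.ext (funext fun _ => Category.assoc _ _ _)

/-- The functor selecting the `k`-morphism in the block at position `q`. -/
def proj (q : GridPos p) : Grid C S p ⥤ C.Mor S where
  obj x := x.cell q
  map f := Hom.cell f q

end Grid

/-- The box `[lo, hi)` is cut by the hyperplane `xᵢ = m` into the boxes `[lo, hi₁)` and
`[lo₂, hi)`. -/
structure IsCut {n : ℕ} {S : Finset (Fin n)} (i : S) (m : ℕ) (lo hi₁ lo₂ hi : S → ℕ) : Prop where
  lower : lo i < m
  upper : m < hi i
  left_eq : hi₁ = Function.update hi i m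
  right_eq : lo₂ = Function.update lo i m

/-- The ways to glue the unit blocks of the box `[lo, hi)` together by successive binary
compositions. -/
inductive Bracketing {n : ℕ} (S : Finset (Fin n)) : (S → ℕ) → (S → ℕ) → Type
  /-- a single block -/
  | block (lo hi : S → ℕ) (h : ∀ i, hi i = lo i + 1) : Bracketing S lo hi
  /-- `A ∘ᵢ B`, where `A` and `B` meet along the hyperplane `xᵢ = m` -/
  | cut {lo hi₁ lo₂ hi : S → ℕ} (i : S) (m : ℕ) (hc : IsCut i m lo hi₁ lo₂ hi)
      (A : Bracketing S lo hi₁) (B : Bracketing S lo₂ hi) : Bracketing S lo hi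

/-- A bracketing of a face of a box. The cuts carry their absolute positions, and unit faces of
adjacent blocks have equal values in a composable family, so for the two sides of a common
hyperplane equality of shapes is equality of formal composites. -/
inductive FaceShape {n : ℕ} (S : Finset (Fin n)) : Type
  | block : FaceShape S
  | cut (i : S) (m : ℕ) (A B : FaceShape S) : FaceShape S

namespace Bracketing

variable {n : ℕ} {S : Finset (Fin n)}

/-- The formal source in the direction `i`, computed by `sᵢ (x ∘ᵢ y) = sᵢ x` and
`sᵢ (x ∘ⱼ y) = sᵢ x ∘ⱼ sᵢ y`. -/
def srcShape (i : S) {lo hi : S → ℕ} : Bracketing S lo hi → FaceShape S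
  | block _ _ _ => FaceShape.block
  | cut j m _ A B =>
      if j = i then A.srcShape i else FaceShape.cut j m (A.srcShape i) (B.srcShape i)

/-- The formal target in the direction `i`, computed by `tᵢ (x ∘ᵢ y) = tᵢ y` and
`tᵢ (x ∘ⱼ y) = tᵢ x ∘ⱼ tᵢ y`. -/
def tgtShape (i : S) {lo hi : S → ℕ} : Bracketing S lo hi → FaceShape S
  | block _ _ _ => FaceShape.block
  | cut j m _ A B =>
      if j = i then B.tgtShape i else FaceShape.cut j m (A.tgtShape i) (B.tgtShape i)

/-- Whenever `A ∘ᵢ B` is formed, the formal target of `A` in the direction `i` is the formal source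
of `B`. Such a bracketing defines a functor in every pseudo `n`-fold category. -/
def Matching {lo hi : S → ℕ} : Bracketing S lo hi → Prop
  | block _ _ _ => True
  | cut i _ _ A B => A.Matching ∧ B.Matching ∧ A.tgtShape i = B.srcShape i

end Bracketing

open CubeCompositions

mutual

/-- `Realizes K A F`: the bracketing `A` is defined, and `F` is the functor that it defines.

A composite `A ∘ᵢ B` of functors only makes sense if the target of `A` equals the source of `B`. It
is admitted if the formal target of `A` is the formal source of `B` (take `φ` and `ψ` to be
identities), or if `A` and `B` are related to such `A'` and `B'` by coherence isomorphisms that agree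
on the common face. So, a mere coincidence of two functors, not explained by coherence, is not
enough, but all composites are admitted whenever associators and interchangers are identities in
lower dimensions. -/
inductive Realizes {n : ℕ} {C : CubeCompositions.{v, u} n} (K : CubeConstraints C)
    {S : Finset (Fin n)} {p : S → ℕ} :
    ∀ {lo hi : S → ℕ}, Bracketing S lo hi → (Grid C.toCubeFaces S p ⥤ C.Mor S) → Prop
  | block {lo hi : S → ℕ} (h : ∀ i, hi i = lo i + 1) (hlo : ∀ i, lo i < p i) :
      Realizes K (Bracketing.block lo hi h) (Grid.proj ⟨lo, hlo⟩)
  | cut {lo hi₁ lo₂ hi : S → ℕ} {i : S} {m : ℕ} (hc : IsCut i m lo hi₁ lo₂ hi)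
      {A A' : Bracketing S lo hi₁} {B B' : Bracketing S lo₂ hi}
      {F F' G G' : Grid C.toCubeFaces S p ⥤ C.Mor S} {φ : F ≅ F'} {ψ : G ≅ G'}
      (hφ : IsCoherence K A A' φ) (hψ : IsCoherence K B B' ψ)
      (hface : A'.tgtShape i = B'.srcShape i)
      (agree : ∀ x, C.MeetsMap (IsFace.erase i.2) (φ.hom.app x) (ψ.hom.app x))
      (e : C.FunctorMeets (IsFace.erase i.2) F G) :
      Realizes K (Bracketing.cut i m hc A B) (C.opFunctor (IsFace.erase i.2) F G e)

/-- `IsCoherence K A B φ`: `φ` is a natural isomorphism between the functors defined by the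
bracketings `A` and `B` that is built from associators and interchangers: by composing, inverting,
and pasting along a common face (in particular with an identity). -/
inductive IsCoherence {n : ℕ} {C : CubeCompositions.{v, u} n} (K : CubeConstraints C)
    {S : Finset (Fin n)} {p : S → ℕ} :
    ∀ {lo hi : S → ℕ}, Bracketing S lo hi → Bracketing S lo hi →
      ∀ {F G : Grid C.toCubeFaces S p ⥤ C.Mor S}, (F ≅ G) → Prop
  | refl {lo hi : S → ℕ} {A : Bracketing S lo hi} {F : Grid C.toCubeFaces S p ⥤ C.Mor S}
      (hA : Realizes K A F) : IsCoherence K A A (Iso.refl F)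
  | symm {lo hi : S → ℕ} {A B : Bracketing S lo hi}
      {F G : Grid C.toCubeFaces S p ⥤ C.Mor S} {φ : F ≅ G} (hφ : IsCoherence K A B φ) :
      IsCoherence K B A φ.symm
  | trans {lo hi : S → ℕ} {A B D : Bracketing S lo hi}
      {F G H : Grid C.toCubeFaces S p ⥤ C.Mor S} {φ : F ≅ G} {ψ : G ≅ H}
      (hφ : IsCoherence K A B φ) (hψ : IsCoherence K B D ψ) : IsCoherence K A D (φ ≪≫ ψ)
  | comp {lo hi₁ lo₂ hi : S → ℕ} {i : S} {m : ℕ} (hc : IsCut i m lo hi₁ lo₂ hi)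
      {A A' : Bracketing S lo hi₁} {B B' : Bracketing S lo₂ hi}
      {F F' G G' : Grid C.toCubeFaces S p ⥤ C.Mor S} {φ : F ≅ F'} {ψ : G ≅ G'}
      (hφ : IsCoherence K A A' φ) (hψ : IsCoherence K B B' ψ)
      (agree : ∀ x, C.MeetsMap (IsFace.erase i.2) (φ.hom.app x) (ψ.hom.app x))
      (e : C.FunctorMeets (IsFace.erase i.2) F G) (e' : C.FunctorMeets (IsFace.erase i.2) F' G')
      (h : Realizes K (Bracketing.cut i m hc A B) (C.opFunctor (IsFace.erase i.2) F G e))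
      (h' : Realizes K (Bracketing.cut i m hc A' B') (C.opFunctor (IsFace.erase i.2) F' G' e')) :
      IsCoherence K (Bracketing.cut i m hc A B) (Bracketing.cut i m hc A' B')
        (C.opIso (IsFace.erase i.2) φ ψ e e' agree)
  | assoc {a b c d f g : S → ℕ} {i : S} {m m' : ℕ}
      (h₁ : IsCut i m a b c d) (h₁₂ : IsCut i m' a d f g)
      (h₂ : IsCut i m' c d f g) (h₂₁ : IsCut i m a b c g)
      {X : Bracketing S a b} {Y : Bracketing S c d} {Z : Bracketing S f g}
      {F G H : Grid C.toCubeFaces S p ⥤ C.Mor S}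
      (hX : Realizes K X F) (hY : Realizes K Y G) (hZ : Realizes K Z H)
      (e₁ : C.FunctorMeets (IsFace.erase i.2) F G) (e₂ : C.FunctorMeets (IsFace.erase i.2) G H)
      (h : Realizes K (Bracketing.cut i m' h₁₂ (Bracketing.cut i m h₁ X Y) Z)
        (C.opFunctor (IsFace.erase i.2) (C.opFunctor (IsFace.erase i.2) F G e₁) H
          (opFunctor_meets e₁ e₂)))
      (h' : Realizes K (Bracketing.cut i m h₂₁ X (Bracketing.cut i m' h₂ Y Z))
        (C.opFunctor (IsFace.erase i.2) F (C.opFunctor (IsFace.erase i.2) G H e₂)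
          (meets_opFunctor e₁ e₂))) :
      IsCoherence K (Bracketing.cut i m' h₁₂ (Bracketing.cut i m h₁ X Y) Z)
        (Bracketing.cut i m h₂₁ X (Bracketing.cut i m' h₂ Y Z))
        (K.assocFunctor (IsFace.erase i.2) F G H e₁ e₂)
  | inter {a b c d a' b' c' d' : S → ℕ} {i j : S} {m m' : ℕ} (hij : (i : Fin n) ≠ j)
      (h₁ : IsCut i m a b c d) (h₁' : IsCut i m a' b' c' d') (h₂ : IsCut j m' a d a' d')
      (k₁ : IsCut j m' a b a' b') (k₁' : IsCut j m' c d c' d') (k₂ : IsCut i m a b' c d')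
      {X : Bracketing S a b} {Y : Bracketing S c d}
      {X' : Bracketing S a' b'} {Y' : Bracketing S c' d'}
      {F G F' G' : Grid C.toCubeFaces S p ⥤ C.Mor S}
      (hX : Realizes K X F) (hY : Realizes K Y G) (hX' : Realizes K X' F') (hY' : Realizes K Y' G')
      (e : C.FunctorMeets (IsFace.erase i.2) F G) (e' : C.FunctorMeets (IsFace.erase i.2) F' G')
      (eF : C.FunctorMeets (IsFace.erase j.2) F F') (eG : C.FunctorMeets (IsFace.erase j.2) G G')
      (h : Realizes K
        (Bracketing.cut j m' h₂ (Bracketing.cut i m h₁ X Y) (Bracketing.cut i m h₁' X' Y'))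
        (C.opFunctor (IsFace.erase j.2) (C.opFunctor (IsFace.erase i.2) F G e)
          (C.opFunctor (IsFace.erase i.2) F' G' e') (opFunctor_meets_opFunctor hij e e' eF eG)))
      (h' : Realizes K
        (Bracketing.cut i m k₂ (Bracketing.cut j m' k₁ X X') (Bracketing.cut j m' k₁' Y Y'))
        (C.opFunctor (IsFace.erase i.2) (C.opFunctor (IsFace.erase j.2) F F' eF)
          (C.opFunctor (IsFace.erase j.2) G G' eG)
          (opFunctor_meets_opFunctor hij.symm eF eG e e'))) :
      IsCoherence K
        (Bracketing.cut j m' h₂ (Bracketing.cut i m h₁ X Y) (Bracketing.cut i m h₁' X' Y'))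
        (Bracketing.cut i m k₂ (Bracketing.cut j m' k₁ X X') (Bracketing.cut j m' k₁' Y Y'))
        (K.interFunctor hij (IsFace.erase i.2) (IsFace.erase j.2) F G F' G' e e' eF eG)

end

/-!
Every bracketing of a box of blocks is compared with one fixed bracketing of that box, its normal
form, by a canonical isomorphism, and it is shown that associators and interchangers commute with
the canonical isomorphisms.

The normal form (`IsNormal`) splits off the first slice in the first direction in which the box is
more than one block thick. If a hyperplane cuts a box in two, the composite of the normal forms of
the parts has a distinguished isomorphism to the normal form of the whole (`IsMerge`), given by
recursion: an associator shifts the first slice to the outside if the hyperplane is parallel to it,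
and an interchanger gathers the two halves of the first slice if it is transverse. The canonical
isomorphism of `A ∘ᵢ B` (`IsCanonical`) takes `A` and `B` to their normal forms and then merges
these.

For this recursion to make sense, isomorphisms of adjacent boxes have to agree on the common face.
No induction on the dimension is needed: a merge is trivial on the two faces parallel to its
hyperplane (`IsMerge.src_app`, `IsMerge.tgt_app`), merges of adjacent boxes along the same
transverse hyperplane agree (`IsMerge.isoMeets`), and so the canonical isomorphisms of bracketings
with matching formal faces agree (`IsCanonical.isoMeets`). In particular every matching bracketing
is defined (`IsCanonical.exists_of_matching`).

The heart of the matter is that merging three normal forms along parallel cuts commutes with the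
associator (`IsNormal.assoc_square`), and merging four along crossing cuts with the interchanger
(`IsNormal.inter_square`). Both follow by induction on the normal form of the whole box, and the
axiom behind the induction step depends on the direction of the first slice. For the associator it
is the pentagon if that direction is the direction of the cuts, and the hexagon relating `α` and `β`
otherwise. For the interchanger it is the same hexagon if that direction is one of the two
directions of the cuts, and the hexagon for three interchangers otherwise.

It follows that every coherence isomorphism `φ` from `A` to `B` satisfies `φ ≫ d = c` for the
canonical isomorphisms `c` of `A` and `d` of `B` (`IsCoherence.exists_canonical`), which determines
`φ`. Conversely `c` and `d` are themselves built from associators and interchangers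
(`IsCanonical.isCoherence`), so `c ≫ d⁻¹` is such a `φ`.
-/

/-! ### Algebra of composites of functors -/

theorem SameArrow.comp_id {D : Type u} [Category.{v} D] {a b c d a' b' : D} {f : a ⟶ b} {g : b ⟶ c}
    {f' : a' ⟶ b'} (hf : SameArrow f f') (hg : SameArrow g (𝟙 d)) : SameArrow (f ≫ g) f' := by
  have h₁ : b = d := congrArg Comma.left hg
  have h₂ : b = b' := congrArg Comma.right hf
  subst h₁ h₂
  exact (hf.comp hg).trans (SameArrow.of_eq (Category.comp_id _))

theorem SameArrow.id_comp {D : Type u} [Category.{v} D] {a b c d a' b' : D} {f : a ⟶ b} {g : b ⟶ c}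
    {g' : a' ⟶ b'} (hf : SameArrow f (𝟙 d)) (hg : SameArrow g g') : SameArrow (f ≫ g) g' := by
  have h₁ : b = d := congrArg Comma.right hf
  have h₂ : b = a' := congrArg Comma.left hg
  subst h₁ h₂
  exact (hf.comp hg).trans (SameArrow.of_eq (Category.id_comp _))

namespace CubeCompositions

variable {n : ℕ} {C : CubeCompositions.{v, u} n} {i j k : Fin n} {T T' T'' S : Finset (Fin n)}
  {X : Type u₁} [Category.{v₁} X]

/-- The natural isomorphisms `φ` and `ψ` are composable: at every object, the target of `φ` is
the source of `ψ`. -/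
abbrev IsoMeets (h : IsFace i T S) {F F' G G' : X ⥤ C.Mor S} (φ : F ≅ F') (ψ : G ≅ G') : Prop :=
  ∀ x, C.MeetsMap h (φ.hom.app x) (ψ.hom.app x)

theorem opMap_comp_opMap (h : IsFace i T S) {x x' x'' y y' y'' : C.Mor S} {f : x ⟶ x'} {g : y ⟶ y'}
    {f' : x' ⟶ x''} {g' : y' ⟶ y''} (e : C.MeetsMap h f g) (e' : C.MeetsMap h f' g')
    (e'' : C.MeetsMap h (f ≫ f') (g ≫ g')) :
    C.opMap h f g e ≫ C.opMap h f' g' e' = C.opMap h (f ≫ f') (g ≫ g') e'' :=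
  ((C.comp h).map_comp (X := ⟨x, y, e.left⟩) (Y := ⟨x', y', e.right⟩) (Z := ⟨x'', y'', e'.right⟩)
    ⟨f, g, e⟩ ⟨f', g', e'⟩).symm

theorem meetsMap_id (h : IsFace i T S) {x y : C.Mor S} (e : C.Meets h x y) :
    C.MeetsMap h (𝟙 x) (𝟙 y) :=
  (SameArrow.map_id _ _).trans ((SameArrow.id e).trans (SameArrow.map_id _ _).symm)

theorem opMap_id (h : IsFace i T S) {x y : C.Mor S} (e : C.MeetsMap h (𝟙 x) (𝟙 y)) :
    C.opMap h (𝟙 x) (𝟙 y) e = 𝟙 (C.op h x y e.left) :=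
  (C.comp h).map_id ⟨x, y, e.left⟩

namespace IsoMeets

variable {h : IsFace i T S} {F F' F'' G G' G'' : X ⥤ C.Mor S}

theorem refl (e : C.FunctorMeets h F G) : IsoMeets h (Iso.refl F) (Iso.refl G) := fun x =>
  meetsMap_id h (e.obj x)

theorem trans {φ : F ≅ F'} {ψ : G ≅ G'} {φ' : F' ≅ F''} {ψ' : G' ≅ G''} (a : IsoMeets h φ ψ)
    (a' : IsoMeets h φ' ψ') : IsoMeets h (φ ≪≫ φ') (ψ ≪≫ ψ') := fun x => by
  simp only [Iso.trans_hom, NatTrans.comp_app, CubeFaces.MeetsMap, Functor.map_comp]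
  exact (a x).comp (a' x)

theorem symm {φ : F ≅ F'} {ψ : G ≅ G'} (a : IsoMeets h φ ψ) : IsoMeets h φ.symm ψ.symm := fun x =>
  SameArrow.inv (f := (C.tgt h).mapIso (φ.app x)) (g := (C.src h).mapIso (ψ.app x)) (a x)

/-- Composability of functors is inherited along composable isomorphisms. -/
theorem functorMeets {φ : F ≅ F'} {ψ : G ≅ G'} (a : IsoMeets h φ ψ) (e : C.FunctorMeets h F' G') :
    C.FunctorMeets h F G :=
  functor_eq (fun x => (a x).left) fun {x y} f => by
    have hF : F.map f = φ.hom.app x ≫ F'.map f ≫ φ.inv.app y := by simp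
    have hG : G.map f = ψ.hom.app x ≫ G'.map f ≫ ψ.inv.app y := by simp
    simp only [Functor.comp_map, hF, hG, Functor.map_comp]
    exact (a x).comp ((e.map f).comp (a.symm y))

end IsoMeets

section opIso

variable {h : IsFace i T S} {F F' F'' G G' G'' : X ⥤ C.Mor S}

theorem opIso_trans_opIso {φ : F ≅ F'} {ψ : G ≅ G'} {φ' : F' ≅ F''} {ψ' : G' ≅ G''}
    {e : C.FunctorMeets h F G} {e' : C.FunctorMeets h F' G'} {e'' : C.FunctorMeets h F'' G''}
    (a : IsoMeets h φ ψ) (a' : IsoMeets h φ' ψ') :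
    C.opIso h φ ψ e e' a ≪≫ C.opIso h φ' ψ' e' e'' a' =
      C.opIso h (φ ≪≫ φ') (ψ ≪≫ ψ') e e'' (a.trans a') := by
  ext x
  exact opMap_comp_opMap h _ _ _

theorem opIso_refl {e : C.FunctorMeets h F G} (a : IsoMeets h (Iso.refl F) (Iso.refl G)) :
    C.opIso h (Iso.refl F) (Iso.refl G) e e a = Iso.refl _ := by
  ext x
  exact opMap_id h _

theorem opIso_congr {φ φ' : F ≅ F'} {ψ ψ' : G ≅ G'} {e : C.FunctorMeets h F G}
    {e' : C.FunctorMeets h F' G'} {a : IsoMeets h φ ψ} (hφ : φ = φ') (hψ : ψ = ψ') :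
    C.opIso h φ ψ e e' a = C.opIso h φ' ψ' e e' (hφ ▸ hψ ▸ a) := by
  subst hφ hψ; rfl

theorem src_opIso {φ : F ≅ F'} {ψ : G ≅ G'} (e : C.FunctorMeets h F G)
    (e' : C.FunctorMeets h F' G') (a : IsoMeets h φ ψ) (x : X) :
    SameArrow ((C.src h).map ((C.opIso h φ ψ e e' a).hom.app x))
      ((C.src h).map (φ.hom.app x)) :=
  src_opMap h (a x)

theorem tgt_opIso {φ : F ≅ F'} {ψ : G ≅ G'} (e : C.FunctorMeets h F G)
    (e' : C.FunctorMeets h F' G') (a : IsoMeets h φ ψ) (x : X) :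
    SameArrow ((C.tgt h).map ((C.opIso h φ ψ e e' a).hom.app x))
      ((C.tgt h).map (ψ.hom.app x)) :=
  tgt_opMap h (a x)

theorem IsoMeets.opIso {hi : IsFace i T S} {hj : IsFace j T' S} (hij : i ≠ j)
    {A A' B B' D D' E E' : X ⥤ C.Mor S} {φ : A ≅ A'} {ψ : B ≅ B'} {φ' : D ≅ D'} {ψ' : E ≅ E'}
    (e₁ : C.FunctorMeets hi A B) (e₁' : C.FunctorMeets hi A' B')
    (e₂ : C.FunctorMeets hi D E) (e₂' : C.FunctorMeets hi D' E')
    (a : IsoMeets hi φ ψ) (a' : IsoMeets hi φ' ψ') (b : IsoMeets hj φ φ') (b' : IsoMeets hj ψ ψ') :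
    IsoMeets hj (C.opIso hi φ ψ e₁ e₁' a) (C.opIso hi φ' ψ' e₂ e₂' a') :=
  fun x => opMap_meets_opMap hij hi hj (a x) (a' x) (b x) (b' x)

end opIso

end CubeCompositions

namespace CubeConstraints

variable {n : ℕ} {C : CubeCompositions.{v, u} n} (K : CubeConstraints C) {i j k : Fin n}
  {T T' T'' S : Finset (Fin n)} {X : Type u₁} [Category.{v₁} X]

theorem assocFunctor_naturality {h : IsFace i T S} {F F' G G' H H' : X ⥤ C.Mor S}
    {φ : F ≅ F'} {ψ : G ≅ G'} {χ : H ≅ H'}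
    (e₁ : C.FunctorMeets h F G) (e₂ : C.FunctorMeets h G H) (e₁' : C.FunctorMeets h F' G')
    (e₂' : C.FunctorMeets h G' H') (a : IsoMeets h φ ψ) (b : IsoMeets h ψ χ)
    (c : IsoMeets h (C.opIso h φ ψ e₁ e₁' a) χ) (d : IsoMeets h φ (C.opIso h ψ χ e₂ e₂' b)) :
    C.opIso h (C.opIso h φ ψ e₁ e₁' a) χ (opFunctor_meets e₁ e₂) (opFunctor_meets e₁' e₂') c ≪≫
        K.assocFunctor h F' G' H' e₁' e₂' =
      K.assocFunctor h F G H e₁ e₂ ≪≫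
        C.opIso h φ (C.opIso h ψ χ e₂ e₂' b) (meets_opFunctor e₁ e₂) (meets_opFunctor e₁' e₂')
          d := by
  ext x
  exact K.assoc_naturality h (φ.hom.app x) (ψ.hom.app x) (χ.hom.app x) (a x) (b x)

theorem interFunctor_naturality (hij : i ≠ j) {hi : IsFace i T S} {hj : IsFace j T' S}
    {F G F' G' A B A' B' : X ⥤ C.Mor S} {φ : F ≅ A} {ψ : G ≅ B} {φ' : F' ≅ A'} {ψ' : G' ≅ B'}
    (e : C.FunctorMeets hi F G) (e' : C.FunctorMeets hi F' G')
    (eF : C.FunctorMeets hj F F') (eG : C.FunctorMeets hj G G')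
    (d : C.FunctorMeets hi A B) (d' : C.FunctorMeets hi A' B')
    (dA : C.FunctorMeets hj A A') (dB : C.FunctorMeets hj B B')
    (a : IsoMeets hi φ ψ) (a' : IsoMeets hi φ' ψ') (b : IsoMeets hj φ φ') (b' : IsoMeets hj ψ ψ')
    (c : IsoMeets hj (C.opIso hi φ ψ e d a) (C.opIso hi φ' ψ' e' d' a'))
    (c' : IsoMeets hi (C.opIso hj φ φ' eF dA b) (C.opIso hj ψ ψ' eG dB b')) :
    C.opIso hj (C.opIso hi φ ψ e d a) (C.opIso hi φ' ψ' e' d' a')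
          (opFunctor_meets_opFunctor hij e e' eF eG) (opFunctor_meets_opFunctor hij d d' dA dB) c ≪≫
        K.interFunctor hij hi hj A B A' B' d d' dA dB =
      K.interFunctor hij hi hj F G F' G' e e' eF eG ≪≫
        C.opIso hi (C.opIso hj φ φ' eF dA b) (C.opIso hj ψ ψ' eG dB b')
          (opFunctor_meets_opFunctor hij.symm eF eG e e')
          (opFunctor_meets_opFunctor hij.symm dA dB d d') c' := by
  ext x
  exact K.inter_naturality hij hi hj (φ.hom.app x) (ψ.hom.app x) (φ'.hom.app x) (ψ'.hom.app x)
    (a x) (a' x) (b x) (b' x)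

theorem interFunctor_symm (hij : i ≠ j) {hi : IsFace i T S} {hj : IsFace j T' S}
    {F G F' G' : X ⥤ C.Mor S} (e : C.FunctorMeets hi F G) (e' : C.FunctorMeets hi F' G')
    (eF : C.FunctorMeets hj F F') (eG : C.FunctorMeets hj G G') :
    K.interFunctor hij.symm hj hi F F' G G' eF eG e e' =
      (K.interFunctor hij hi hj F G F' G' e e' eF eG).symm := by
  ext x
  exact congrArg Iso.hom (K.inter_symm hij hi hj (F.obj x) (G.obj x) (F'.obj x) (G'.obj x)
    (e.obj x) (e'.obj x) (eF.obj x) (eG.obj x))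

theorem isoMeets_assocFunctor (hij : i ≠ j) {hi : IsFace i T S} {hj : IsFace j T' S}
    {F G H F' G' H' : X ⥤ C.Mor S} (e₁ : C.FunctorMeets hi F G) (e₂ : C.FunctorMeets hi G H)
    (e₁' : C.FunctorMeets hi F' G') (e₂' : C.FunctorMeets hi G' H')
    (eF : C.FunctorMeets hj F F') (eG : C.FunctorMeets hj G G') (eH : C.FunctorMeets hj H H') :
    IsoMeets hj (K.assocFunctor hi F G H e₁ e₂) (K.assocFunctor hi F' G' H' e₁' e₂') := fun x =>
  K.assoc_meets_assoc hij hi hj (e₁.obj x) (e₂.obj x) (e₁'.obj x) (e₂'.obj x)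
    (eF.obj x) (eG.obj x) (eH.obj x)

theorem isoMeets_interFunctor (hij : i ≠ j) (hik : i ≠ k) (hjk : j ≠ k)
    {hi : IsFace i T S} {hj : IsFace j T' S} {hk : IsFace k T'' S}
    {F G F' G' A B A' B' : X ⥤ C.Mor S}
    (e : C.FunctorMeets hi F G) (e' : C.FunctorMeets hi F' G')
    (eF : C.FunctorMeets hj F F') (eG : C.FunctorMeets hj G G')
    (d : C.FunctorMeets hi A B) (d' : C.FunctorMeets hi A' B')
    (dA : C.FunctorMeets hj A A') (dB : C.FunctorMeets hj B B')
    (f : C.FunctorMeets hk F A) (g : C.FunctorMeets hk G B)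
    (f' : C.FunctorMeets hk F' A') (g' : C.FunctorMeets hk G' B') :
    IsoMeets hk (K.interFunctor hij hi hj F G F' G' e e' eF eG)
      (K.interFunctor hij hi hj A B A' B' d d' dA dB) := fun x =>
  K.inter_meets_inter hij hik hjk hi hj hk (e.obj x) (e'.obj x) (eF.obj x) (eG.obj x)
    (d.obj x) (d'.obj x) (dA.obj x) (dB.obj x) (f.obj x) (g.obj x) (f'.obj x) (g'.obj x)

namespace Coherent

variable {K}

theorem pentagonFunctor (hK : K.Coherent) {h : IsFace i T S} {F G H I : X ⥤ C.Mor S}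
    (e₁ : C.FunctorMeets h F G) (e₂ : C.FunctorMeets h G H) (e₃ : C.FunctorMeets h H I)
    (a : IsoMeets h (K.assocFunctor h F G H e₁ e₂) (Iso.refl I))
    (b : IsoMeets h (Iso.refl F) (K.assocFunctor h G H I e₂ e₃)) :
    K.assocFunctor h (C.opFunctor h F G e₁) H I (opFunctor_meets e₁ e₂) e₃ ≪≫
        K.assocFunctor h F G (C.opFunctor h H I e₃) e₁ (meets_opFunctor e₂ e₃) =
      C.opIso h (K.assocFunctor h F G H e₁ e₂) (Iso.refl I)
          (opFunctor_meets (opFunctor_meets e₁ e₂) e₃)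
          (opFunctor_meets (meets_opFunctor e₁ e₂) (opFunctor_meets e₂ e₃)) a ≪≫
        K.assocFunctor h F (C.opFunctor h G H e₂) I (meets_opFunctor e₁ e₂)
          (opFunctor_meets e₂ e₃) ≪≫
        C.opIso h (Iso.refl F) (K.assocFunctor h G H I e₂ e₃)
          (meets_opFunctor (meets_opFunctor e₁ e₂) (opFunctor_meets e₂ e₃))
          (meets_opFunctor e₁ (meets_opFunctor e₂ e₃)) b := by
  ext x
  exact hK.pentagon h (F.obj x) (G.obj x) (H.obj x) (I.obj x) (e₁.obj x) (e₂.obj x) (e₃.obj x)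

/-- The axiom on one interchanger and the associator, for functors. -/
theorem hexagonFunctor (hK : K.Coherent) (hij : i ≠ j) {hi : IsFace i T S} {hj : IsFace j T' S}
    {F G H F' G' H' : X ⥤ C.Mor S} (e₁ : C.FunctorMeets hi F G) (e₂ : C.FunctorMeets hi G H)
    (e₁' : C.FunctorMeets hi F' G') (e₂' : C.FunctorMeets hi G' H')
    (eF : C.FunctorMeets hj F F') (eG : C.FunctorMeets hj G G') (eH : C.FunctorMeets hj H H')
    (a : IsoMeets hi (K.interFunctor hij hi hj F G F' G' e₁ e₁' eF eG)
      (Iso.refl (C.opFunctor hj H H' eH)))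
    (b : IsoMeets hj (K.assocFunctor hi F G H e₁ e₂) (K.assocFunctor hi F' G' H' e₁' e₂'))
    (c : IsoMeets hi (Iso.refl (C.opFunctor hj F F' eF))
      (K.interFunctor hij hi hj G H G' H' e₂ e₂' eG eH)) :
    K.interFunctor hij hi hj (C.opFunctor hi F G e₁) H (C.opFunctor hi F' G' e₁') H'
          (opFunctor_meets e₁ e₂) (opFunctor_meets e₁' e₂')
          (opFunctor_meets_opFunctor hij e₁ e₁' eF eG) eH ≪≫
        C.opIso hi (K.interFunctor hij hi hj F G F' G' e₁ e₁' eF eG) (Iso.refl _)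
          (opFunctor_meets_opFunctor hij.symm (opFunctor_meets_opFunctor hij e₁ e₁' eF eG) eH
            (opFunctor_meets e₁ e₂) (opFunctor_meets e₁' e₂'))
          (opFunctor_meets (opFunctor_meets_opFunctor hij.symm eF eG e₁ e₁')
            (opFunctor_meets_opFunctor hij.symm eG eH e₂ e₂')) a ≪≫
        K.assocFunctor hi (C.opFunctor hj F F' eF) (C.opFunctor hj G G' eG)
          (C.opFunctor hj H H' eH) (opFunctor_meets_opFunctor hij.symm eF eG e₁ e₁')
          (opFunctor_meets_opFunctor hij.symm eG eH e₂ e₂') =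
      C.opIso hj (K.assocFunctor hi F G H e₁ e₂) (K.assocFunctor hi F' G' H' e₁' e₂')
          (opFunctor_meets_opFunctor hij (opFunctor_meets e₁ e₂) (opFunctor_meets e₁' e₂')
            (opFunctor_meets_opFunctor hij e₁ e₁' eF eG) eH)
          (opFunctor_meets_opFunctor hij (meets_opFunctor e₁ e₂) (meets_opFunctor e₁' e₂') eF
            (opFunctor_meets_opFunctor hij e₂ e₂' eG eH)) b ≪≫
        K.interFunctor hij hi hj F (C.opFunctor hi G H e₂) F' (C.opFunctor hi G' H' e₂')
          (meets_opFunctor e₁ e₂) (meets_opFunctor e₁' e₂') eF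
          (opFunctor_meets_opFunctor hij e₂ e₂' eG eH) ≪≫
        C.opIso hi (Iso.refl _) (K.interFunctor hij hi hj G H G' H' e₂ e₂' eG eH)
          (opFunctor_meets_opFunctor hij.symm eF (opFunctor_meets_opFunctor hij e₂ e₂' eG eH)
            (meets_opFunctor e₁ e₂) (meets_opFunctor e₁' e₂'))
          (meets_opFunctor (opFunctor_meets_opFunctor hij.symm eF eG e₁ e₁')
            (opFunctor_meets_opFunctor hij.symm eG eH e₂ e₂')) c := by
  ext x
  exact hK.hexagon hij hi hj (F.obj x) (G.obj x) (H.obj x) (F'.obj x) (G'.obj x) (H'.obj x)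
    (e₁.obj x) (e₂.obj x) (e₁'.obj x) (e₂'.obj x) (eF.obj x) (eG.obj x) (eH.obj x)

/-- The axiom on three interchangers, for functors. -/
theorem hexagonFunctor' (hK : K.Coherent) (hij : i ≠ j) (hik : i ≠ k) (hjk : j ≠ k)
    {hi : IsFace i T S} {hj : IsFace j T' S} {hk : IsFace k T'' S}
    {F₀ G₀ F₁ G₁ F₂ G₂ F₃ G₃ : X ⥤ C.Mor S}
    (i₀ : C.FunctorMeets hi F₀ G₀) (i₁ : C.FunctorMeets hi F₁ G₁) (i₂ : C.FunctorMeets hi F₂ G₂)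
    (i₃ : C.FunctorMeets hi F₃ G₃)
    (jx : C.FunctorMeets hj F₀ F₁) (jy : C.FunctorMeets hj G₀ G₁) (jx' : C.FunctorMeets hj F₂ F₃)
    (jy' : C.FunctorMeets hj G₂ G₃)
    (kx : C.FunctorMeets hk F₀ F₂) (ky : C.FunctorMeets hk G₀ G₂) (kx' : C.FunctorMeets hk F₁ F₃)
    (ky' : C.FunctorMeets hk G₁ G₃)
    (a : IsoMeets hk (K.interFunctor hij hi hj F₀ G₀ F₁ G₁ i₀ i₁ jx jy)
      (K.interFunctor hij hi hj F₂ G₂ F₃ G₃ i₂ i₃ jx' jy'))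
    (b : IsoMeets hi (K.interFunctor hjk hj hk F₀ F₁ F₂ F₃ jx jx' kx kx')
      (K.interFunctor hjk hj hk G₀ G₁ G₂ G₃ jy jy' ky ky'))
    (c : IsoMeets hj (K.interFunctor hik hi hk F₀ G₀ F₂ G₂ i₀ i₂ kx ky)
      (K.interFunctor hik hi hk F₁ G₁ F₃ G₃ i₁ i₃ kx' ky')) :
    C.opIso hk (K.interFunctor hij hi hj F₀ G₀ F₁ G₁ i₀ i₁ jx jy)
          (K.interFunctor hij hi hj F₂ G₂ F₃ G₃ i₂ i₃ jx' jy')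
          (opFunctor_meets_opFunctor hjk (opFunctor_meets_opFunctor hij i₀ i₁ jx jy)
            (opFunctor_meets_opFunctor hij i₂ i₃ jx' jy')
            (opFunctor_meets_opFunctor hik i₀ i₂ kx ky)
            (opFunctor_meets_opFunctor hik i₁ i₃ kx' ky'))
          (opFunctor_meets_opFunctor hik (opFunctor_meets_opFunctor hij.symm jx jy i₀ i₁)
            (opFunctor_meets_opFunctor hij.symm jx' jy' i₂ i₃)
            (opFunctor_meets_opFunctor hjk jx jx' kx kx')
            (opFunctor_meets_opFunctor hjk jy jy' ky ky')) a ≪≫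
        K.interFunctor hik hi hk (C.opFunctor hj F₀ F₁ jx) (C.opFunctor hj G₀ G₁ jy)
          (C.opFunctor hj F₂ F₃ jx') (C.opFunctor hj G₂ G₃ jy')
          (opFunctor_meets_opFunctor hij.symm jx jy i₀ i₁)
          (opFunctor_meets_opFunctor hij.symm jx' jy' i₂ i₃)
          (opFunctor_meets_opFunctor hjk jx jx' kx kx')
          (opFunctor_meets_opFunctor hjk jy jy' ky ky') ≪≫
        C.opIso hi (K.interFunctor hjk hj hk F₀ F₁ F₂ F₃ jx jx' kx kx')
          (K.interFunctor hjk hj hk G₀ G₁ G₂ G₃ jy jy' ky ky')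
          (opFunctor_meets_opFunctor hik.symm (opFunctor_meets_opFunctor hjk jx jx' kx kx')
            (opFunctor_meets_opFunctor hjk jy jy' ky ky')
            (opFunctor_meets_opFunctor hij.symm jx jy i₀ i₁)
            (opFunctor_meets_opFunctor hij.symm jx' jy' i₂ i₃))
          (opFunctor_meets_opFunctor hij.symm (opFunctor_meets_opFunctor hjk.symm kx kx' jx jx')
            (opFunctor_meets_opFunctor hjk.symm ky ky' jy jy')
            (opFunctor_meets_opFunctor hik.symm kx ky i₀ i₂)
            (opFunctor_meets_opFunctor hik.symm kx' ky' i₁ i₃)) b =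
      K.interFunctor hjk hj hk (C.opFunctor hi F₀ G₀ i₀) (C.opFunctor hi F₁ G₁ i₁)
          (C.opFunctor hi F₂ G₂ i₂) (C.opFunctor hi F₃ G₃ i₃)
          (opFunctor_meets_opFunctor hij i₀ i₁ jx jy) (opFunctor_meets_opFunctor hij i₂ i₃ jx' jy')
          (opFunctor_meets_opFunctor hik i₀ i₂ kx ky)
          (opFunctor_meets_opFunctor hik i₁ i₃ kx' ky') ≪≫
        C.opIso hj (K.interFunctor hik hi hk F₀ G₀ F₂ G₂ i₀ i₂ kx ky)
          (K.interFunctor hik hi hk F₁ G₁ F₃ G₃ i₁ i₃ kx' ky')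
          (opFunctor_meets_opFunctor hjk.symm (opFunctor_meets_opFunctor hik i₀ i₂ kx ky)
            (opFunctor_meets_opFunctor hik i₁ i₃ kx' ky')
            (opFunctor_meets_opFunctor hij i₀ i₁ jx jy)
            (opFunctor_meets_opFunctor hij i₂ i₃ jx' jy'))
          (opFunctor_meets_opFunctor hij (opFunctor_meets_opFunctor hik.symm kx ky i₀ i₂)
            (opFunctor_meets_opFunctor hik.symm kx' ky' i₁ i₃)
            (opFunctor_meets_opFunctor hjk.symm kx kx' jx jx')
            (opFunctor_meets_opFunctor hjk.symm ky ky' jy jy')) c ≪≫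
        K.interFunctor hij hi hj (C.opFunctor hk F₀ F₂ kx) (C.opFunctor hk G₀ G₂ ky)
          (C.opFunctor hk F₁ F₃ kx') (C.opFunctor hk G₁ G₃ ky')
          (opFunctor_meets_opFunctor hik.symm kx ky i₀ i₂)
          (opFunctor_meets_opFunctor hik.symm kx' ky' i₁ i₃)
          (opFunctor_meets_opFunctor hjk.symm kx kx' jx jx')
          (opFunctor_meets_opFunctor hjk.symm ky ky' jy jy') := by
  ext x
  exact hK.hexagon' hij hik hjk hi hj hk (F₀.obj x) (G₀.obj x) (F₁.obj x) (G₁.obj x) (F₂.obj x)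
    (G₂.obj x) (F₃.obj x) (G₃.obj x) (i₀.obj x) (i₁.obj x) (i₂.obj x) (i₃.obj x) (jx.obj x)
    (jy.obj x) (jx'.obj x) (jy'.obj x) (kx.obj x) (ky.obj x) (kx'.obj x) (ky'.obj x)

end Coherent

end CubeConstraints

/-! ### Boxes and their cuts -/

/-- The box `[lo', hi')` lies next to the box `[lo, hi)` in the direction `i`, and the two boxes
have the whole face between them in common. -/
structure IsAdjacent {n : ℕ} {S : Finset (Fin n)} (i : S) (lo hi lo' hi' : S → ℕ) : Prop where
  wall : hi i = lo' i
  lo_eq : ∀ j, j ≠ i → lo j = lo' j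
  hi_eq : ∀ j, j ≠ i → hi j = hi' j

/-- The direction `i` is the first one in which the box `[lo, hi)` consists of several slices. -/
structure IsLead {n : ℕ} {S : Finset (Fin n)} (i : S) (lo hi : S → ℕ) : Prop where
  thick : lo i + 1 < hi i
  thin : ∀ j, j < i → hi j = lo j + 1

section Boxes

variable {n : ℕ} {S : Finset (Fin n)} {i j d : S} {m m' : ℕ}
  {lo hi hi₁ lo₂ s t s' t' lo' hi' : S → ℕ}

namespace IsCut

theorem isAdjacent (hc : IsCut i m lo hi₁ lo₂ hi) : IsAdjacent i lo hi₁ lo₂ hi := by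
  obtain ⟨_, _, rfl, rfl⟩ := hc
  exact ⟨by simp, fun j hj => by simp [hj], fun j hj => by simp [hj]⟩

/-- Two cuts of a box in different directions cut it into four boxes. -/
theorem cross (hc : IsCut j m lo hi₁ lo₂ hi) (hs : IsCut i m' lo s t hi) (hij : i ≠ j) :
    ∃ s₁ t₂, IsCut i m' lo s₁ t hi₁ ∧ IsCut i m' lo₂ s t₂ hi ∧ IsCut j m lo s₁ lo₂ s ∧
      IsCut j m t hi₁ t₂ hi := by
  obtain ⟨h₁, h₂, rfl, rfl⟩ := hc
  obtain ⟨h₃, h₄, rfl, rfl⟩ := hs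
  exact ⟨_, _, ⟨h₃, by simpa [hij] using h₄, rfl, rfl⟩,
    ⟨by simpa [hij] using h₃, h₄, rfl, rfl⟩,
    ⟨h₁, by simpa [hij.symm] using h₂, Function.update_comm hij.symm _ _ _, rfl⟩,
    ⟨by simpa [hij.symm] using h₁, h₂, rfl, Function.update_comm hij.symm _ _ _⟩⟩

/-- Two parallel cuts of a box cut it into three boxes. -/
theorem parallel (hc : IsCut j m lo hi₁ lo₂ hi) (hs : IsCut j m' lo s t hi) (hm : m' < m) :
    IsCut j m' lo s t hi₁ ∧ IsCut j m t hi₁ lo₂ hi := by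
  obtain ⟨h₁, h₂, rfl, rfl⟩ := hc
  obtain ⟨h₃, h₄, rfl, rfl⟩ := hs
  exact ⟨⟨h₃, by simpa using hm, by simp, rfl⟩, ⟨by simpa using hm, h₂, rfl, by simp⟩⟩

theorem of_lt (h : lo i < m) (h' : m < hi i) :
    IsCut i m lo (Function.update hi i m) (Function.update lo i m) hi :=
  ⟨h, h', rfl, rfl⟩

theorem unique (hc : IsCut i m lo hi₁ lo₂ hi) (hs : IsCut i m lo s t hi) : hi₁ = s ∧ lo₂ = t :=
  ⟨hc.left_eq.trans hs.left_eq.symm, hc.right_eq.trans hs.right_eq.symm⟩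

end IsCut

namespace IsLead

theorem unique (h : IsLead i lo hi) (h' : IsLead j lo hi) : i = j := by
  rcases lt_trichotomy i j with hij | hij | hij
  · have := h.thick; have := h'.thin i hij; omega
  · exact hij
  · have := h'.thick; have := h.thin j hij; omega

theorem not_block (h : IsLead i lo hi) (h' : ∀ i, hi i = lo i + 1) : False := by
  have := h.thick; have := h' i; omega

theorem le_of_isCut (h : IsLead i lo hi) (hc : IsCut j m lo hi₁ lo₂ hi) : i ≤ j := by
  by_contra hij
  have := h.thin j (not_le.mp hij); have := hc.lower; have := hc.upper
  omega

theorem isCut (h : IsLead i lo hi) :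
    IsCut i (lo i + 1) lo (Function.update hi i (lo i + 1)) (Function.update lo i (lo i + 1)) hi :=
  IsCut.of_lt (Nat.lt_succ_self _) h.thick

theorem left_of_ne (h : IsLead i lo hi) (hc : IsCut j m lo hi₁ lo₂ hi) (hij : i ≠ j) :
    IsLead i lo hi₁ := by
  obtain ⟨h₁, h₂, rfl, rfl⟩ := hc
  refine ⟨by simpa [hij] using h.thick, fun k hk => ?_⟩
  by_cases hkj : k = j
  · subst hkj; have := h.thin k hk; omega
  · simpa [hkj] using h.thin k hk

theorem right_of_ne (h : IsLead i lo hi) (hc : IsCut j m lo hi₁ lo₂ hi) (hij : i ≠ j) :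
    IsLead i lo₂ hi := by
  obtain ⟨h₁, h₂, rfl, rfl⟩ := hc
  refine ⟨by simpa [hij] using h.thick, fun k hk => ?_⟩
  by_cases hkj : k = j
  · subst hkj; have := h.thin k hk; omega
  · simpa [hkj] using h.thin k hk

theorem left_of_lt (h : IsLead i lo hi) (hc : IsCut i m lo hi₁ lo₂ hi) (hm : lo i + 1 < m) :
    IsLead i lo hi₁ := by
  obtain ⟨h₁, h₂, rfl, rfl⟩ := hc
  refine ⟨by simpa using hm, fun k hk => ?_⟩
  simpa [hk.ne] using h.thin k hk

theorem exists_of_lt (h : ∀ i, lo i < hi i) (h' : ¬∀ i, hi i = lo i + 1) : ∃ i, IsLead i lo hi := by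
  have hne : {i : S | hi i ≠ lo i + 1}.Nonempty := not_forall.mp h'
  obtain ⟨i, hi₀, hmin⟩ := wellFounded_lt.has_min _ hne
  refine ⟨i, ?_, fun j hj => ?_⟩
  · have := h i
    have : hi i ≠ lo i + 1 := hi₀
    omega
  · by_contra hj'
    exact hmin j hj' hj

end IsLead

namespace IsAdjacent

theorem left (ha : IsAdjacent i lo hi lo' hi') (hc : IsCut i m lo s t hi) :
    IsAdjacent i t hi lo' hi' := by
  obtain ⟨_, _, rfl, rfl⟩ := hc
  exact ⟨ha.wall, fun j hj => by simpa [hj] using ha.lo_eq j hj, ha.hi_eq⟩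

theorem right (ha : IsAdjacent i lo hi lo' hi') (hc : IsCut i m lo' s t hi') :
    IsAdjacent i lo hi lo' s := by
  obtain ⟨_, _, rfl, rfl⟩ := hc
  exact ⟨ha.wall, ha.lo_eq, fun j hj => by simpa [hj] using ha.hi_eq j hj⟩

theorem both (ha : IsAdjacent i lo hi lo' hi') (hc : IsCut j m lo s t hi)
    (hc' : IsCut j m lo' s' t' hi') (hij : j ≠ i) :
    IsAdjacent i lo s lo' s' ∧ IsAdjacent i t hi t' hi' := by
  obtain ⟨_, _, rfl, rfl⟩ := hc
  obtain ⟨_, _, rfl, rfl⟩ := hc'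
  refine ⟨⟨by simpa [hij.symm] using ha.wall, ha.lo_eq, fun k hk => ?_⟩,
    ⟨by simpa [hij.symm] using ha.wall, fun k hk => ?_, ha.hi_eq⟩⟩
  · by_cases hkj : k = j
    · subst hkj; simp
    · simpa [hkj] using ha.hi_eq k hk
  · by_cases hkj : k = j
    · subst hkj; simp
    · simpa [hkj] using ha.lo_eq k hk

theorem lead_eq (ha : IsAdjacent d lo hi lo' hi') (h : IsLead i lo hi) (h' : IsLead j lo' hi')
    (hi_ne : i ≠ d) (hj_ne : j ≠ d) : i = j := by
  rcases lt_trichotomy i j with hij | hij | hij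
  · have := h.thick; have := h'.thin i hij; have := ha.lo_eq i hi_ne; have := ha.hi_eq i hi_ne
    omega
  · exact hij
  · have := h'.thick; have := h.thin j hij; have := ha.lo_eq j hj_ne; have := ha.hi_eq j hj_ne
    omega

theorem not_block_left (ha : IsAdjacent d lo hi lo' hi') (h : ∀ i, hi i = lo i + 1)
    (h' : lo' i + 1 < hi' i) (hne : i ≠ d) : False := by
  have := h i; have := ha.lo_eq i hne; have := ha.hi_eq i hne
  omega

theorem not_block_right (ha : IsAdjacent d lo hi lo' hi') (h : ∀ i, hi' i = lo' i + 1)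
    (h' : lo i + 1 < hi i) (hne : i ≠ d) : False := by
  have := h i; have := ha.lo_eq i hne; have := ha.hi_eq i hne
  omega

end IsAdjacent

end Boxes

/-! ### Normal forms -/

/-- `IsNormal A F`: the bracketing `A` is the normal form of its box, and `F` is the functor that
it defines. The normal form splits off the first slice in the first direction in which the box has
several slices, and proceeds in the same way with the two parts. -/
inductive IsNormal {n : ℕ} {C : CubeCompositions.{v, u} n} {S : Finset (Fin n)} {p : S → ℕ} :
    ∀ {lo hi : S → ℕ}, Bracketing S lo hi → (Grid C.toCubeFaces S p ⥤ C.Mor S) → Prop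
  | block {lo hi : S → ℕ} (h : ∀ i, hi i = lo i + 1) (hlo : ∀ i, lo i < p i) :
      IsNormal (Bracketing.block lo hi h) (Grid.proj ⟨lo, hlo⟩)
  | cut {lo s t hi : S → ℕ} {i : S} {m : ℕ} (hl : IsLead i lo hi) (hm : m = lo i + 1)
      (hc : IsCut i m lo s t hi) {A : Bracketing S lo s} {B : Bracketing S t hi}
      {F G : Grid C.toCubeFaces S p ⥤ C.Mor S} (hA : IsNormal A F) (hB : IsNormal B G)
      (e : C.FunctorMeets (IsFace.erase i.2) F G) :
      IsNormal (Bracketing.cut i m hc A B) (C.opFunctor (IsFace.erase i.2) F G e)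

namespace IsNormal

variable {n : ℕ} {C : CubeCompositions.{v, u} n} {S : Finset (Fin n)} {p : S → ℕ}
  {lo hi lo' hi' : S → ℕ} {F F' G : Grid C.toCubeFaces S p ⥤ C.Mor S}

theorem unique {A A' : Bracketing S lo hi} (hA : IsNormal A F) (hA' : IsNormal A' F') :
    A = A' ∧ F = F' := by
  induction hA generalizing F' with
  | block h hlo =>
    cases hA' with
    | block h' hlo' => exact ⟨rfl, rfl⟩
    | cut hl' => exact (hl'.not_block h).elim
  | cut hl hm hc hA hB e ihA ihB =>
    cases hA' with
    | block h' hlo' => exact (hl.not_block h').elim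
    | cut hl' hm' hc' hA' hB' e' =>
      obtain rfl := hl.unique hl'
      subst hm hm'
      obtain ⟨rfl, rfl⟩ := hc.unique hc'
      obtain ⟨rfl, rfl⟩ := ihA hA'
      obtain ⟨rfl, rfl⟩ := ihB hB'
      exact ⟨rfl, rfl⟩

theorem functor_unique {A A' : Bracketing S lo hi} (hA : IsNormal A F) (hA' : IsNormal A' F') :
    F = F' :=
  (hA.unique hA').2

/-- Normal forms of adjacent boxes match along the common face. -/
theorem meets {d : S} {A : Bracketing S lo hi} {B : Bracketing S lo' hi'} (hA : IsNormal A F)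
    (hB : IsNormal B G) (ha : IsAdjacent d lo hi lo' hi') :
    C.FunctorMeets (IsFace.erase d.2) F G ∧ A.tgtShape d = B.srcShape d := by
  induction hA generalizing lo' hi' G with
  | @block lo hi h hlo =>
    induction hB with
    | @block lo' hi' h' hlo' =>
      refine ⟨?_, rfl⟩
      have hu : lo' = Function.update lo d (lo d + 1) := by
        funext k
        by_cases hk : k = d
        · subst hk; simpa [h] using ha.wall.symm
        · simpa [hk] using (ha.lo_eq k hk).symm
      exact functor_eq (fun x => x.meets d ⟨lo, hlo⟩ ⟨lo', hlo'⟩ hu)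
        fun f => f.meets d ⟨lo, hlo⟩ ⟨lo', hlo'⟩ hu
    | @cut _ _ _ _ i m hl hm hc A' B' F' G' hA hB e ihA ihB =>
      by_cases hid : i = d
      · subst hid
        obtain ⟨e₁, e₂⟩ := ihA (ha.right hc)
        exact ⟨meets_opFunctor e₁ e, by simpa [Bracketing.srcShape] using e₂⟩
      · exact (ha.not_block_left h hl.thick hid).elim
  | @cut lo s t hi i m hl hm hc A₁ A₂ F₁ F₂ hA₁ hA₂ e ih₁ ih₂ =>
    by_cases hid : i = d
    · subst hid
      obtain ⟨e₁, e₂⟩ := ih₂ hB (ha.left hc)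
      exact ⟨opFunctor_meets e e₁, by simpa [Bracketing.tgtShape] using e₂⟩
    · induction hB with
      | block h' hlo' => exact (ha.not_block_right h' hl.thick hid).elim
      | @cut _ _ _ _ i' m' hl' hm' hc' A' B' F' G' hA hB e' ihA ihB =>
        by_cases hid' : i' = d
        · subst hid'
          obtain ⟨e₁, e₂⟩ := ihA (ha.right hc')
          exact ⟨meets_opFunctor e₁ e', by simpa [Bracketing.srcShape] using e₂⟩
        · obtain rfl := ha.lead_eq hl hl' hid hid'
          obtain rfl : m = m' := by rw [hm, hm', ha.lo_eq i hid]
          obtain ⟨ha₁, ha₂⟩ := ha.both hc hc' hid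
          obtain ⟨e₁, e₁'⟩ := ih₁ hA ha₁
          obtain ⟨e₂, e₂'⟩ := ih₂ hB ha₂
          refine ⟨opFunctor_meets_opFunctor (fun h => hid (Subtype.ext h)) e e' e₁ e₂, ?_⟩
          simp [Bracketing.srcShape, Bracketing.tgtShape, hid, e₁', e₂']

theorem exists_of_lt (p : S → ℕ) (hlt : ∀ i, lo i < hi i) (hp : ∀ i, hi i ≤ p i) :
    ∃ (A : Bracketing S lo hi) (F : Grid C.toCubeFaces S p ⥤ C.Mor S), IsNormal A F := by
  induction hN : ∑ i, (hi i - lo i) using Nat.strong_induction_on generalizing lo hi with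
  | _ N ih =>
    by_cases h : ∀ i, hi i = lo i + 1
    · exact ⟨_, _, IsNormal.block h fun i => (hlt i).trans_le (hp i)⟩
    obtain ⟨i, hl⟩ := IsLead.exists_of_lt hlt h
    have hc := hl.isCut
    have ht := hl.thick
    obtain ⟨A, F, hA⟩ := ih _ (by
        rw [← hN]
        refine Finset.sum_lt_sum (fun k _ => ?_) ⟨i, Finset.mem_univ _, ?_⟩
        · by_cases hk : k = i
          · subst hk; simp; omega
          · simp [hk]
        · simp; omega) (lo := lo) (hi := Function.update hi i (lo i + 1))
      (fun k => by
        by_cases hk : k = i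
        · subst hk; simp
        · simpa [hk] using hlt k)
      (fun k => by
        by_cases hk : k = i
        · subst hk; have := hp k; simp; omega
        · simpa [hk] using hp k) rfl
    obtain ⟨B, G, hB⟩ := ih _ (by
        rw [← hN]
        refine Finset.sum_lt_sum (fun k _ => ?_) ⟨i, Finset.mem_univ _, ?_⟩
        · by_cases hk : k = i
          · subst hk; simp; omega
          · simp [hk]
        · simp; omega) (lo := Function.update lo i (lo i + 1)) (hi := hi)
      (fun k => by
        by_cases hk : k = i
        · subst hk; simpa using ht
        · simpa [hk] using hlt k) hp rfl
    exact ⟨_, _, IsNormal.cut hl rfl hc hA hB (hA.meets hB hc.isAdjacent).1⟩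

theorem cut_inv {A : Bracketing S lo hi} (hA : IsNormal A F) {i : S} (hl : IsLead i lo hi)
    {m : ℕ} (hm : m = lo i + 1) {s t : S → ℕ} (hc : IsCut i m lo s t hi) :
    ∃ (A₁ : Bracketing S lo s) (A₂ : Bracketing S t hi) (P R : Grid C.toCubeFaces S p ⥤ C.Mor S)
      (e : C.FunctorMeets (IsFace.erase i.2) P R), IsNormal A₁ P ∧ IsNormal A₂ R ∧
        A = Bracketing.cut i m hc A₁ A₂ ∧ F = C.opFunctor (IsFace.erase i.2) P R e := by
  cases hA with
  | block h _ => exact (hl.not_block h).elim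
  | cut hl' hm' hc' hA hB e =>
    obtain rfl := hl.unique hl'
    subst hm hm'
    obtain ⟨rfl, rfl⟩ := hc.unique hc'
    exact ⟨_, _, _, _, e, hA, hB, rfl, rfl⟩

end IsNormal

/-! ### Merging two normal forms -/

/-- `IsMerge K hc e μ`: if the box is cut by `hc` into two boxes with normal forms `F` and `G`,
then `μ : F ∘ⱼ G ≅ H` is the canonical isomorphism to the normal form `H` of the whole box. If the
cut splits off the first slice of the leading direction, then `F ∘ⱼ G` is normal. Any other cut
parallel to it is merged by moving the first slice `P` of `F` out of the composite with an
associator and merging the rest. If the leading direction is another one, then the first slices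
and the remaining parts are brought together by an interchanger and are merged separately. -/
inductive IsMerge {n : ℕ} {C : CubeCompositions.{v, u} n} (K : CubeConstraints C)
    {S : Finset (Fin n)} {p : S → ℕ} :
    ∀ {lo hi₁ lo₂ hi : S → ℕ} {j : S} {m : ℕ}, IsCut j m lo hi₁ lo₂ hi →
      ∀ {F G H : Grid C.toCubeFaces S p ⥤ C.Mor S} (e : C.FunctorMeets (IsFace.erase j.2) F G),
        (C.opFunctor (IsFace.erase j.2) F G e ≅ H) → Prop
  | first {lo hi₁ lo₂ hi : S → ℕ} {j : S} {m : ℕ} (hl : IsLead j lo hi) (hm : m = lo j + 1)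
      (hc : IsCut j m lo hi₁ lo₂ hi) {A : Bracketing S lo hi₁} {B : Bracketing S lo₂ hi}
      {F G : Grid C.toCubeFaces S p ⥤ C.Mor S} (hA : IsNormal A F) (hB : IsNormal B G)
      (e : C.FunctorMeets (IsFace.erase j.2) F G) : IsMerge K hc e (Iso.refl _)
  | assoc {lo hi₁ lo₂ hi s t : S → ℕ} {j : S} {m m₀ : ℕ} (hl : IsLead j lo hi)
      (hm₀ : m₀ = lo j + 1) (hlt : m₀ < m) (hc : IsCut j m lo hi₁ lo₂ hi)
      (hs : IsCut j m₀ lo s t hi) (hs' : IsCut j m₀ lo s t hi₁) (hr : IsCut j m t hi₁ lo₂ hi)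
      {A : Bracketing S lo s} {P R G R' : Grid C.toCubeFaces S p ⥤ C.Mor S} (hA : IsNormal A P)
      (e₁ : C.FunctorMeets (IsFace.erase j.2) P R) (e₂ : C.FunctorMeets (IsFace.erase j.2) R G)
      (e : C.FunctorMeets (IsFace.erase j.2) P R')
      {ρ : C.opFunctor (IsFace.erase j.2) R G e₂ ≅ R'} (hρ : IsMerge K hr e₂ ρ)
      (a : IsoMeets (IsFace.erase j.2) (Iso.refl P) ρ) :
      IsMerge K hc (opFunctor_meets e₁ e₂) (K.assocFunctor (IsFace.erase j.2) P R G e₁ e₂ ≪≫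
        C.opIso (IsFace.erase j.2) (Iso.refl P) ρ (meets_opFunctor e₁ e₂) e a)
  | inter {lo hi₁ lo₂ hi s t s₁ t₂ : S → ℕ} {i j : S} {m m₀ : ℕ} (hl : IsLead i lo hi)
      (hm₀ : m₀ = lo i + 1) (hij : (i : Fin n) ≠ j) (hc : IsCut j m lo hi₁ lo₂ hi)
      (hs : IsCut i m₀ lo s t hi) (hs₁ : IsCut i m₀ lo s₁ t hi₁) (hs₂ : IsCut i m₀ lo₂ s t₂ hi)
      (hP : IsCut j m lo s₁ lo₂ s) (hR : IsCut j m t hi₁ t₂ hi)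
      {P₁ P₂ P R₁ R₂ R : Grid C.toCubeFaces S p ⥤ C.Mor S}
      (e₁ : C.FunctorMeets (IsFace.erase i.2) P₁ R₁) (e₂ : C.FunctorMeets (IsFace.erase i.2) P₂ R₂)
      (eP : C.FunctorMeets (IsFace.erase j.2) P₁ P₂) (eR : C.FunctorMeets (IsFace.erase j.2) R₁ R₂)
      (e : C.FunctorMeets (IsFace.erase i.2) P R)
      {μ : C.opFunctor (IsFace.erase j.2) P₁ P₂ eP ≅ P}
      {ρ : C.opFunctor (IsFace.erase j.2) R₁ R₂ eR ≅ R}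
      (hμ : IsMerge K hP eP μ) (hρ : IsMerge K hR eR ρ)
      (a : IsoMeets (IsFace.erase i.2) μ ρ) :
      IsMerge K hc (opFunctor_meets_opFunctor hij e₁ e₂ eP eR)
        (K.interFunctor hij (IsFace.erase i.2) (IsFace.erase j.2) P₁ R₁ P₂ R₂ e₁ e₂ eP eR ≪≫
          C.opIso (IsFace.erase i.2) μ ρ (opFunctor_meets_opFunctor hij.symm eP eR e₁ e₂) e a)

namespace CubeConstraints

variable {n : ℕ} {C : CubeCompositions.{v, u} n} (K : CubeConstraints C) {i j : Fin n}
  {T T' S : Finset (Fin n)} {X : Type u₁} [Category.{v₁} X]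

theorem tgt_interFunctor_opIso (hij : i ≠ j) {hi : IsFace i T S} {hj : IsFace j T' S}
    {F G F' G' A B : X ⥤ C.Mor S} (e : C.FunctorMeets hi F G) (e' : C.FunctorMeets hi F' G')
    (eF : C.FunctorMeets hj F F') (eG : C.FunctorMeets hj G G')
    (φ : C.opFunctor hj F F' eF ≅ A) (ψ : C.opFunctor hj G G' eG ≅ B) (eA : C.FunctorMeets hi A B)
    (a : IsoMeets hi φ ψ) (x : X) :
    SameArrow ((C.tgt hi).map ((K.interFunctor hij hi hj F G F' G' e e' eF eG ≪≫
        C.opIso hi φ ψ (opFunctor_meets_opFunctor hij.symm eF eG e e') eA a).hom.app x))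
      ((C.tgt hi).map (ψ.hom.app x)) := by
  simp only [Iso.trans_hom, NatTrans.comp_app, Functor.map_comp]
  exact (K.tgt_inter_left hij hi hj (F.obj x) (G.obj x) (F'.obj x) (G'.obj x) (e.obj x) (e'.obj x)
    (eF.obj x) (eG.obj x)).id_comp (tgt_opIso _ eA a x)

theorem src_interFunctor_opIso (hij : i ≠ j) {hi : IsFace i T S} {hj : IsFace j T' S}
    {F G F' G' A B : X ⥤ C.Mor S} (e : C.FunctorMeets hi F G) (e' : C.FunctorMeets hi F' G')
    (eF : C.FunctorMeets hj F F') (eG : C.FunctorMeets hj G G')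
    (φ : C.opFunctor hj F F' eF ≅ A) (ψ : C.opFunctor hj G G' eG ≅ B) (eA : C.FunctorMeets hi A B)
    (a : IsoMeets hi φ ψ) (x : X) :
    SameArrow ((C.src hi).map ((K.interFunctor hij hi hj F G F' G' e e' eF eG ≪≫
        C.opIso hi φ ψ (opFunctor_meets_opFunctor hij.symm eF eG e e') eA a).hom.app x))
      ((C.src hi).map (φ.hom.app x)) := by
  simp only [Iso.trans_hom, NatTrans.comp_app, Functor.map_comp]
  exact (K.src_inter_left hij hi hj (F.obj x) (G.obj x) (F'.obj x) (G'.obj x) (e.obj x) (e'.obj x)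
    (eF.obj x) (eG.obj x)).id_comp (src_opIso _ eA a x)

end CubeConstraints

namespace IsMerge

variable {n : ℕ} {C : CubeCompositions.{v, u} n} {K : CubeConstraints C} {S : Finset (Fin n)}
  {p : S → ℕ} {lo hi₁ lo₂ hi lo' hi₁' lo₂' hi' : S → ℕ} {j : S} {m : ℕ}
  {F G H F' G' H' : Grid C.toCubeFaces S p ⥤ C.Mor S}

theorem isNormal {hc : IsCut j m lo hi₁ lo₂ hi} {e : C.FunctorMeets (IsFace.erase j.2) F G}
    {μ : C.opFunctor (IsFace.erase j.2) F G e ≅ H} (hμ : IsMerge K hc e μ) :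
    (∃ A : Bracketing S lo hi₁, IsNormal A F) ∧ (∃ B : Bracketing S lo₂ hi, IsNormal B G) ∧
      ∃ D : Bracketing S lo hi, IsNormal D H := by
  induction hμ with
  | first hl hm hc hA hB e => exact ⟨⟨_, hA⟩, ⟨_, hB⟩, ⟨_, hA.cut hl hm hc hB e⟩⟩
  | assoc hl hm₀ hlt hc hs hs' hr hA e₁ e₂ e hρ a ih =>
    obtain ⟨⟨B, hB⟩, hG, ⟨D, hD⟩⟩ := ih
    exact ⟨⟨_, hA.cut (hl.left_of_lt hc (hm₀ ▸ hlt)) hm₀ hs' hB e₁⟩, hG,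
      ⟨_, hA.cut hl hm₀ hs hD e⟩⟩
  | inter hl hm₀ hij hc hs hs₁ hs₂ hP hR e₁ e₂ eP eR e hμ hρ a ihμ ihρ =>
    obtain ⟨⟨A₁, hA₁⟩, ⟨A₂, hA₂⟩, ⟨A, hA⟩⟩ := ihμ
    obtain ⟨⟨B₁, hB₁⟩, ⟨B₂, hB₂⟩, ⟨B, hB⟩⟩ := ihρ
    have hij' : _ ≠ _ := fun h => hij (congrArg Subtype.val h)
    refine ⟨⟨_, hA₁.cut (hl.left_of_ne hc hij') hm₀ hs₁ hB₁ e₁⟩,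
      ⟨_, hA₂.cut (hl.right_of_ne hc hij') ?_ hs₂ hB₂ e₂⟩, ⟨_, hA.cut hl hm₀ hs hB e⟩⟩
    rw [hm₀, hc.right_eq]; simp [hij']

/-- Along the direction of the cut, merging leaves the source alone. -/
theorem src_app {hc : IsCut j m lo hi₁ lo₂ hi} {e : C.FunctorMeets (IsFace.erase j.2) F G}
    {μ : C.opFunctor (IsFace.erase j.2) F G e ≅ H} (hμ : IsMerge K hc e μ)
    (x : Grid C.toCubeFaces S p) :
    SameArrow ((C.src (IsFace.erase j.2)).map (μ.hom.app x))
      (𝟙 ((C.src (IsFace.erase j.2)).obj (F.obj x))) := by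
  induction hμ with
  | first hl hm hc hA hB e => exact (SameArrow.map_id _ _).trans (SameArrow.id (src_op _ _))
  | assoc hl hm₀ hlt hc hs hs' hr hA e₁ e₂ e hρ a ih =>
    simp only [Iso.trans_hom, NatTrans.comp_app, Functor.map_comp]
    have h := (K.src_assoc _ _ _ _ (e₁.obj x) (e₂.obj x)).comp_id
      ((src_opIso (meets_opFunctor e₁ e₂) e a x).trans (SameArrow.map_id _ _))
    exact h.trans (SameArrow.id (src_op _ (e₁.obj x)).symm)
  | inter hl hm₀ hij hc hs hs₁ hs₂ hP hR e₁ e₂ eP eR e hμ hρ a ihμ ihρ =>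
    simp only [Iso.trans_hom, NatTrans.comp_app, Functor.map_comp]
    -- The source of `μ ∘ᵢ ρ` is the composite of the sources, which are identities by induction.
    obtain ⟨U, hi', hj'⟩ := IsFace.exists_common hij (IsFace.erase (Subtype.property _))
      (IsFace.erase (Subtype.property _))
    have e' := src_meets (IsFace.erase (Subtype.property _)) (IsFace.erase (Subtype.property _))
      hi' hj' (e₁.obj x)
    have h := (src_opMap_ne _ _ hi' hj' (a x)).trans
      ((opMap_congr hi' ihμ ihρ _ (meetsMap_id hi' e')).trans
        ((SameArrow.of_eq (opMap_id hi' _)).trans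
          (SameArrow.id (src_op_ne _ _ hi' hj' (e₁.obj x)).symm)))
    exact (K.src_inter hij _ _ _ _ _ _ (e₁.obj x) (e₂.obj x) (eP.obj x) (eR.obj x)).comp_id h

/-- Along the direction of the cut, merging leaves the target alone. -/
theorem tgt_app {hc : IsCut j m lo hi₁ lo₂ hi} {e : C.FunctorMeets (IsFace.erase j.2) F G}
    {μ : C.opFunctor (IsFace.erase j.2) F G e ≅ H} (hμ : IsMerge K hc e μ)
    (x : Grid C.toCubeFaces S p) :
    SameArrow ((C.tgt (IsFace.erase j.2)).map (μ.hom.app x))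
      (𝟙 ((C.tgt (IsFace.erase j.2)).obj (G.obj x))) := by
  induction hμ with
  | first hl hm hc hA hB e => exact (SameArrow.map_id _ _).trans (SameArrow.id (tgt_op _ _))
  | assoc hl hm₀ hlt hc hs hs' hr hA e₁ e₂ e hρ a ih =>
    simp only [Iso.trans_hom, NatTrans.comp_app, Functor.map_comp]
    exact (K.tgt_assoc _ _ _ _ (e₁.obj x) (e₂.obj x)).comp_id
      ((tgt_opIso (meets_opFunctor e₁ e₂) e a x).trans ih)
  | inter hl hm₀ hij hc hs hs₁ hs₂ hP hR e₁ e₂ eP eR e hμ hρ a ihμ ihρ =>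
    simp only [Iso.trans_hom, NatTrans.comp_app, Functor.map_comp]
    obtain ⟨U, hi', hj'⟩ := IsFace.exists_common hij (IsFace.erase (Subtype.property _))
      (IsFace.erase (Subtype.property _))
    have e' := tgt_meets (IsFace.erase (Subtype.property _)) (IsFace.erase (Subtype.property _))
      hi' hj' (e₂.obj x)
    have h := (tgt_opMap_ne _ _ hi' hj' (a x)).trans
      ((opMap_congr hi' ihμ ihρ _ (meetsMap_id hi' e')).trans
        ((SameArrow.of_eq (opMap_id hi' _)).trans
          (SameArrow.id (tgt_op_ne _ _ hi' hj' (e₂.obj x)).symm)))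
    exact (K.tgt_inter hij _ _ _ _ _ _ (e₁.obj x) (e₂.obj x) (eP.obj x) (eR.obj x)).comp_id h

theorem refl_isoMeets {hc : IsCut j m lo hi₁ lo₂ hi} {e : C.FunctorMeets (IsFace.erase j.2) F G}
    {μ : C.opFunctor (IsFace.erase j.2) F G e ≅ H} (hμ : IsMerge K hc e μ)
    (e' : C.FunctorMeets (IsFace.erase j.2) H' F) :
    IsoMeets (IsFace.erase j.2) (Iso.refl H') μ := fun x =>
  (SameArrow.map_id _ _).trans ((SameArrow.id (e'.obj x)).trans (hμ.src_app x).symm)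

theorem isoMeets_refl {hc : IsCut j m lo hi₁ lo₂ hi} {e : C.FunctorMeets (IsFace.erase j.2) F G}
    {μ : C.opFunctor (IsFace.erase j.2) F G e ≅ H} (hμ : IsMerge K hc e μ)
    (e' : C.FunctorMeets (IsFace.erase j.2) G H') :
    IsoMeets (IsFace.erase j.2) μ (Iso.refl H') := fun x =>
  (hμ.tgt_app x).trans ((SameArrow.id (e'.obj x)).trans (SameArrow.map_id _ _).symm)

/-- In adjacent boxes, the isomorphisms that merge along the same transverse hyperplane agree on
the common face. -/
theorem isoMeets {d j' : S} {m' : ℕ} {hc : IsCut j m lo hi₁ lo₂ hi}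
    {hc' : IsCut j' m' lo' hi₁' lo₂' hi'} {e : C.FunctorMeets (IsFace.erase j.2) F G}
    {e' : C.FunctorMeets (IsFace.erase j'.2) F' G'}
    {μ : C.opFunctor (IsFace.erase j.2) F G e ≅ H}
    {μ' : C.opFunctor (IsFace.erase j'.2) F' G' e' ≅ H'}
    (hμ : IsMerge K hc e μ) (hμ' : IsMerge K hc' e' μ') (ha : IsAdjacent d lo hi lo' hi')
    (hj : j = j') (hm : m = m') (hjd : j ≠ d) : IsoMeets (IsFace.erase d.2) μ μ' := by
  induction hμ generalizing j' m' lo' hi₁' lo₂' hi' F' G' H' with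
  | @first lo hi₁ lo₂ hi j m hl hm₀ hc A B F G hA hB e =>
    have hne : (j : Fin n) ≠ d := fun h => hjd (Subtype.ext h)
    induction hμ' with
    | first hl' hm' hc' hA' hB' e' =>
      subst hj hm
      obtain ⟨ha₁, ha₂⟩ := ha.both hc hc' hjd
      exact IsoMeets.refl (opFunctor_meets_opFunctor hne e e' (hA.meets hA' ha₁).1
        (hB.meets hB' ha₂).1)
    | assoc hl' hm₀' hlt' hc' hs hs' hr hA e₁ e₂ e hρ a ih =>
      subst hj hm
      have := ha.lo_eq _ hjd
      omega
    | @inter _ _ _ _ _ _ _ _ i' _ _ _ hl' hm₀' hij hc' hs' hs₁' hs₂' hP' hR'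
        _ _ _ _ _ _ e₁ e₂ eP eR e _ _ hμ hρ a ihμ ihρ =>
      by_cases hid : i' = d
      · subst hid
        exact fun x => (ihμ (ha.right hs') hj hm x).trans
          (K.src_interFunctor_opIso hij e₁ e₂ eP eR _ _ e a x).symm
      · subst hj
        exact (hij (congrArg Subtype.val (ha.lead_eq hl hl' hjd hid)).symm).elim
  | @assoc lo hi₁ lo₂ hi s t j m m₀ hl hm₀ hlt hc hs hs' hr A P R G R' hA e₁ e₂ e ρ hρ a ih =>
    have hne : (j : Fin n) ≠ d := fun h => hjd (Subtype.ext h)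
    induction hμ' with
    | first hl' hm' hc' hA' hB' e' =>
      subst hj hm
      have := ha.lo_eq _ hjd
      omega
    | @assoc _ _ _ _ _ _ _ _ m₀' hl' hm₀' hlt' hc' ks ks' kr _ _ _ _ _ kA k₁ k₂ k _ hρ' a' _ =>
      subst hj hm
      obtain rfl : m₀ = m₀' := by rw [hm₀, hm₀', ha.lo_eq _ hjd]
      obtain ⟨ha₁, ha₂⟩ := ha.both hs ks hjd
      obtain ⟨⟨_, h₁⟩, ⟨_, h₂⟩, ⟨_, h₃⟩⟩ := hρ.isNormal
      obtain ⟨⟨_, h₁'⟩, ⟨_, h₂'⟩, ⟨_, h₃'⟩⟩ := hρ'.isNormal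
      obtain ⟨hb₁, hb₂⟩ := ha₂.both hr kr hjd
      have f := (hA.meets kA ha₁).1
      have g := (h₁.meets h₁' hb₁).1
      exact (K.isoMeets_assocFunctor hne e₁ e₂ k₁ k₂ f g (h₂.meets h₂' hb₂).1).trans
        (IsoMeets.opIso hne _ _ _ _ a a' (IsoMeets.refl f) (ih hρ' ha₂ rfl rfl hjd))
    | @inter _ _ _ _ _ _ _ _ i' _ _ _ hl' hm₀' hij hc' hs' hs₁' hs₂' hP' hR'
        _ _ _ _ _ _ e₁ e₂ eP eR e _ _ hμ hρ a ihμ ihρ =>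
      by_cases hid : i' = d
      · subst hid
        exact fun x => (ihμ (ha.right hs') hj hm x).trans
          (K.src_interFunctor_opIso hij e₁ e₂ eP eR _ _ e a x).symm
      · subst hj
        exact (hij (congrArg Subtype.val (ha.lead_eq hl hl' hjd hid)).symm).elim
  | @inter lo hi₁ lo₂ hi s t s₁ t₂ i j m m₀ hl hm₀ hij hc hs hs₁ hs₂ hP hR P₁ P₂ P R₁ R₂ R
      e₁ e₂ eP eR e μ ρ hμ hρ a ihμ ihρ =>
    by_cases hid : i = d
    -- The first slice is parallel to the common face, which is a face of the remaining part.
    · subst hid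
      exact fun x => (K.tgt_interFunctor_opIso hij e₁ e₂ eP eR _ _ e a x).trans
        (ihρ hμ' (ha.left hs) hj hm hjd x)
    have hne : (i : Fin n) ≠ d := fun h => hid (Subtype.ext h)
    have hne' : (j : Fin n) ≠ d := fun h => hjd (Subtype.ext h)
    induction hμ' with
    | first hl' hm' hc' hA' hB' e' =>
      subst hj
      exact (hij (congrArg Subtype.val (ha.lead_eq hl hl' hid hjd))).elim
    | assoc hl' =>
      subst hj
      exact (hij (congrArg Subtype.val (ha.lead_eq hl hl' hid hjd))).elim
    | @inter _ _ _ _ _ _ _ _ i' _ _ m₀' hl' hm₀' hij' hc' ks ks₁ ks₂ kP kR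
        _ _ _ _ _ _ k₁ k₂ kP' kR' k _ _ hμ' hρ' a' ihμ' ihρ' =>
      by_cases hid' : i' = d
      -- On the other side, the common face is a face of the first slice.
      · subst hid'
        exact fun x => (ihμ' (ha.right ks) hj hm x).trans
          (K.src_interFunctor_opIso hij' k₁ k₂ kP' kR' _ _ k a' x).symm
      · subst hj hm
        obtain rfl := ha.lead_eq hl hl' hid hid'
        obtain rfl : m₀ = m₀' := by rw [hm₀, hm₀', ha.lo_eq _ hid]
        obtain ⟨ha₁, ha₂⟩ := ha.both hs ks hid
        obtain ⟨⟨_, h₁⟩, ⟨_, h₂⟩, _⟩ := hμ.isNormal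
        obtain ⟨⟨_, h₁'⟩, ⟨_, h₂'⟩, _⟩ := hμ'.isNormal
        obtain ⟨⟨_, l₁⟩, ⟨_, l₂⟩, _⟩ := hρ.isNormal
        obtain ⟨⟨_, l₁'⟩, ⟨_, l₂'⟩, _⟩ := hρ'.isNormal
        obtain ⟨hb₁, hb₂⟩ := ha₁.both hP kP hjd
        obtain ⟨hd₁, hd₂⟩ := ha₂.both hR kR hjd
        exact (K.isoMeets_interFunctor hij hne hne' e₁ e₂ eP eR k₁ k₂ kP' kR'
          (h₁.meets h₁' hb₁).1 (l₁.meets l₁' hd₁).1 (h₂.meets h₂' hb₂).1 (l₂.meets l₂' hd₂).1).trans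
          (IsoMeets.opIso hne _ _ _ _ a a' (ihμ hμ' ha₁ rfl rfl hjd) (ihρ hρ' ha₂ rfl rfl hjd))

end IsMerge

/-! ### Pasting the coherence axioms -/

theorem CategoryTheory.Iso.trans_trans_eq_of_eq {D : Type u} [Category.{v} D] {a b b' c d : D}
    {f : a ≅ b} {g : b ≅ c} {f' : a ≅ b'} {g' : b' ≅ c} (w : f ≪≫ g = f' ≪≫ g') (k : c ≅ d) :
    f ≪≫ g ≪≫ k = f' ≪≫ g' ≪≫ k := by
  rw [← Iso.trans_assoc, w, Iso.trans_assoc]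

/-- If a hexagon commutes, then so does the hexagon in which two opposite pairs of consecutive
edges are inverted. -/
theorem CategoryTheory.Iso.symm_trans_symm_trans_eq {D : Type u} [Category.{v} D]
    {a b c d e f : D} {A : a ≅ b} {B : b ≅ c} {x : c ≅ d} {y : a ≅ e} {A' : e ≅ f} {B' : f ≅ d}
    (w : A ≪≫ B ≪≫ x = y ≪≫ A' ≪≫ B') :
    B.symm ≪≫ A.symm ≪≫ y = x ≪≫ B'.symm ≪≫ A'.symm := by
  have w' := congrArg Iso.hom w
  simp only [Iso.trans_hom] at w'
  ext
  simp only [Iso.trans_hom, Iso.symm_hom, Iso.inv_comp_eq]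
  rw [← cancel_mono A'.hom, ← cancel_mono B'.hom]
  simpa using w'.symm

namespace CubeCompositions

variable {n : ℕ} {C : CubeCompositions.{v, u} n} {i j k : Fin n} {T T' T'' S : Finset (Fin n)}
  {X : Type u₁} [Category.{v₁} X] {h : IsFace i T S} {F F' F'' G G' G'' : X ⥤ C.Mor S}

theorem opIso_trans {φ : F ≅ F'} {ψ : G ≅ G'} {φ' : F' ≅ F''} {ψ' : G' ≅ G''}
    {e : C.FunctorMeets h F G} (e' : C.FunctorMeets h F' G') {e'' : C.FunctorMeets h F'' G''}
    (a : IsoMeets h φ ψ) (a' : IsoMeets h φ' ψ') (b : IsoMeets h (φ ≪≫ φ') (ψ ≪≫ ψ')) :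
    C.opIso h (φ ≪≫ φ') (ψ ≪≫ ψ') e e'' b = C.opIso h φ ψ e e' a ≪≫ C.opIso h φ' ψ' e' e'' a' :=
  (opIso_trans_opIso a a').symm

theorem opIso_trans_left {φ : F ≅ F'} {φ' : F' ≅ F''} {ψ : G ≅ G'}
    {e : C.FunctorMeets h F G} (e' : C.FunctorMeets h F' G') {e'' : C.FunctorMeets h F'' G'}
    (a : IsoMeets h φ ψ) (a' : IsoMeets h φ' (Iso.refl G')) (b : IsoMeets h (φ ≪≫ φ') ψ) :
    C.opIso h (φ ≪≫ φ') ψ e e'' b =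
      C.opIso h φ ψ e e' a ≪≫ C.opIso h φ' (Iso.refl G') e' e'' a' := by
  rw [opIso_trans_opIso a a']; exact opIso_congr rfl (Iso.trans_refl _).symm

theorem opIso_trans_right {φ : F ≅ F'} {ψ : G ≅ G'} {ψ' : G' ≅ G''}
    {e : C.FunctorMeets h F G} (e' : C.FunctorMeets h F' G') {e'' : C.FunctorMeets h F' G''}
    (a : IsoMeets h φ ψ) (a' : IsoMeets h (Iso.refl F') ψ') (b : IsoMeets h φ (ψ ≪≫ ψ')) :
    C.opIso h φ (ψ ≪≫ ψ') e e'' b =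
      C.opIso h φ ψ e e' a ≪≫ C.opIso h (Iso.refl F') ψ' e' e'' a' := by
  rw [opIso_trans_opIso a a']; exact opIso_congr (Iso.trans_refl _).symm rfl

theorem opIso_trans_refl {φ : F ≅ F'} {φ' : F' ≅ F''}
    {e : C.FunctorMeets h F G} (e' : C.FunctorMeets h F' G) {e'' : C.FunctorMeets h F'' G}
    (a : IsoMeets h φ (Iso.refl G)) (a' : IsoMeets h φ' (Iso.refl G))
    (b : IsoMeets h (φ ≪≫ φ') (Iso.refl G)) :
    C.opIso h (φ ≪≫ φ') (Iso.refl G) e e'' b =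
      C.opIso h φ (Iso.refl G) e e' a ≪≫ C.opIso h φ' (Iso.refl G) e' e'' a' := by
  rw [opIso_trans_opIso a a']; exact opIso_congr rfl (Iso.refl_trans _).symm

theorem opIso_refl_trans {ψ : G ≅ G'} {ψ' : G' ≅ G''}
    {e : C.FunctorMeets h F G} (e' : C.FunctorMeets h F G') {e'' : C.FunctorMeets h F G''}
    (a : IsoMeets h (Iso.refl F) ψ) (a' : IsoMeets h (Iso.refl F) ψ')
    (b : IsoMeets h (Iso.refl F) (ψ ≪≫ ψ')) :
    C.opIso h (Iso.refl F) (ψ ≪≫ ψ') e e'' b =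
      C.opIso h (Iso.refl F) ψ e e' a ≪≫ C.opIso h (Iso.refl F) ψ' e' e'' a' := by
  rw [opIso_trans_opIso a a']; exact opIso_congr (Iso.refl_trans _).symm rfl

theorem opIso_symm {φ : F ≅ F'} {ψ : G ≅ G'} {e : C.FunctorMeets h F G}
    {e' : C.FunctorMeets h F' G'} (a : IsoMeets h φ ψ) :
    (C.opIso h φ ψ e e' a).symm = C.opIso h φ.symm ψ.symm e' e a.symm := by
  ext x; rfl

theorem IsoMeets.refl_trans {ψ : G ≅ G'} {ψ' : G' ≅ G''} (a : IsoMeets h (Iso.refl F) ψ)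
    (a' : IsoMeets h (Iso.refl F) ψ') : IsoMeets h (Iso.refl F) (ψ ≪≫ ψ') := by
  have b := a.trans a'
  rwa [Iso.refl_trans] at b

theorem IsoMeets.opIso_left {H H' : X ⥤ C.Mor S} {φ : F ≅ F'} {ψ : G ≅ G'} {χ : H ≅ H'}
    {e : C.FunctorMeets h F G} {e' : C.FunctorMeets h F' G'} (a : IsoMeets h φ ψ)
    (b : IsoMeets h ψ χ) : IsoMeets h (C.opIso h φ ψ e e' a) χ := fun x =>
  (tgt_opIso e e' a x).trans (b x)

theorem IsoMeets.opIso_right {H H' : X ⥤ C.Mor S} {φ : F ≅ F'} {ψ : G ≅ G'} {χ : H ≅ H'}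
    {e : C.FunctorMeets h F G} {e' : C.FunctorMeets h F' G'} (a : IsoMeets h φ ψ)
    (b : IsoMeets h χ φ) : IsoMeets h χ (C.opIso h φ ψ e e' a) := fun x =>
  SameArrow.trans (b x) (src_opIso e e' a x).symm

end CubeCompositions

namespace CubeConstraints

variable {n : ℕ} {C : CubeCompositions.{v, u} n} (K : CubeConstraints C) {i j k : Fin n}
  {T T' T'' S : Finset (Fin n)} {X : Type u₁} [Category.{v₁} X]

theorem assocFunctor_isoMeets_refl {h : IsFace i T S} {F G H I : X ⥤ C.Mor S}
    (e₁ : C.FunctorMeets h F G) (e₂ : C.FunctorMeets h G H) (e₃ : C.FunctorMeets h H I) :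
    IsoMeets h (K.assocFunctor h F G H e₁ e₂) (Iso.refl I) := fun x =>
  K.assoc_meets_id h (e₁.obj x) (e₂.obj x) (e₃.obj x)

theorem refl_isoMeets_assocFunctor {h : IsFace i T S} {F G H I : X ⥤ C.Mor S}
    (e₁ : C.FunctorMeets h F G) (e₂ : C.FunctorMeets h G H) (e₃ : C.FunctorMeets h H I) :
    IsoMeets h (Iso.refl F) (K.assocFunctor h G H I e₂ e₃) := fun x =>
  K.id_meets_assoc h (e₁.obj x) (e₂.obj x) (e₃.obj x)

theorem interFunctor_isoMeets_refl (hij : i ≠ j) {hi : IsFace i T S} {hj : IsFace j T' S}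
    {F G F' G' H : X ⥤ C.Mor S} (e : C.FunctorMeets hi F G) (e' : C.FunctorMeets hi F' G')
    (eF : C.FunctorMeets hj F F') (eG : C.FunctorMeets hj G G')
    (eH : C.FunctorMeets hi (C.opFunctor hj G G' eG) H) :
    IsoMeets hi (K.interFunctor hij hi hj F G F' G' e e' eF eG) (Iso.refl H) := fun x =>
  K.inter_meets_id hij hi hj (e.obj x) (e'.obj x) (eF.obj x) (eG.obj x) (eH.obj x)

theorem refl_isoMeets_interFunctor (hij : i ≠ j) {hi : IsFace i T S} {hj : IsFace j T' S}
    {F G F' G' H : X ⥤ C.Mor S} (e : C.FunctorMeets hi F G) (e' : C.FunctorMeets hi F' G')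
    (eF : C.FunctorMeets hj F F') (eG : C.FunctorMeets hj G G')
    (eH : C.FunctorMeets hi H (C.opFunctor hj F F' eF)) :
    IsoMeets hi (Iso.refl H) (K.interFunctor hij hi hj F G F' G' e e' eF eG) := fun x =>
  K.id_meets_inter hij hi hj (e.obj x) (e'.obj x) (eF.obj x) (eG.obj x) (eH.obj x)

theorem interFunctor_isoMeets_refl' (hij : i ≠ j) {hi : IsFace i T S} {hj : IsFace j T' S}
    {F G F' G' H : X ⥤ C.Mor S} (e : C.FunctorMeets hi F G) (e' : C.FunctorMeets hi F' G')
    (eF : C.FunctorMeets hj F F') (eG : C.FunctorMeets hj G G')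
    (eH : C.FunctorMeets hj (C.opFunctor hi F' G' e') H) :
    IsoMeets hj (K.interFunctor hij hi hj F G F' G' e e' eF eG) (Iso.refl H) := by
  rw [K.interFunctor_symm hij.symm eF eG e e']
  exact (K.interFunctor_isoMeets_refl hij.symm eF eG e e' eH).symm

theorem refl_isoMeets_interFunctor' (hij : i ≠ j) {hi : IsFace i T S} {hj : IsFace j T' S}
    {F G F' G' H : X ⥤ C.Mor S} (e : C.FunctorMeets hi F G) (e' : C.FunctorMeets hi F' G')
    (eF : C.FunctorMeets hj F F') (eG : C.FunctorMeets hj G G')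
    (eH : C.FunctorMeets hj H (C.opFunctor hi F G e)) :
    IsoMeets hj (Iso.refl H) (K.interFunctor hij hi hj F G F' G' e e' eF eG) := by
  rw [K.interFunctor_symm hij.symm eF eG e e']
  exact (K.refl_isoMeets_interFunctor hij.symm eF eG e e' eH).symm

namespace Coherent

variable {K}

/-- The hexagon for one interchanger and the associator, solved for the inverse interchangers. -/
theorem hexagonFunctor_symm (hK : K.Coherent) (hij : i ≠ j) {hi : IsFace i T S}
    {hj : IsFace j T' S} {F G H F' G' H' : X ⥤ C.Mor S}
    (e₁ : C.FunctorMeets hi F G) (e₂ : C.FunctorMeets hi G H)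
    (e₁' : C.FunctorMeets hi F' G') (e₂' : C.FunctorMeets hi G' H')
    (eF : C.FunctorMeets hj F F') (eG : C.FunctorMeets hj G G') (eH : C.FunctorMeets hj H H')
    (a : IsoMeets hi (K.interFunctor hij.symm hj hi F F' G G' eF eG e₁ e₁')
      (Iso.refl (C.opFunctor hj H H' eH)))
    (b : IsoMeets hj (K.assocFunctor hi F G H e₁ e₂) (K.assocFunctor hi F' G' H' e₁' e₂'))
    (c : IsoMeets hi (Iso.refl (C.opFunctor hj F F' eF))
      (K.interFunctor hij.symm hj hi G G' H H' eG eH e₂ e₂')) :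
    C.opIso hi (K.interFunctor hij.symm hj hi F F' G G' eF eG e₁ e₁') (Iso.refl _)
          (opFunctor_meets (opFunctor_meets_opFunctor hij.symm eF eG e₁ e₁')
            (opFunctor_meets_opFunctor hij.symm eG eH e₂ e₂'))
          (opFunctor_meets_opFunctor hij.symm (opFunctor_meets_opFunctor hij e₁ e₁' eF eG) eH
            (opFunctor_meets e₁ e₂) (opFunctor_meets e₁' e₂')) a ≪≫
        K.interFunctor hij.symm hj hi (C.opFunctor hi F G e₁) (C.opFunctor hi F' G' e₁') H H'
          (opFunctor_meets_opFunctor hij e₁ e₁' eF eG) eH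
          (opFunctor_meets e₁ e₂) (opFunctor_meets e₁' e₂') ≪≫
        C.opIso hj (K.assocFunctor hi F G H e₁ e₂) (K.assocFunctor hi F' G' H' e₁' e₂')
          (opFunctor_meets_opFunctor hij (opFunctor_meets e₁ e₂) (opFunctor_meets e₁' e₂')
            (opFunctor_meets_opFunctor hij e₁ e₁' eF eG) eH)
          (opFunctor_meets_opFunctor hij (meets_opFunctor e₁ e₂) (meets_opFunctor e₁' e₂') eF
            (opFunctor_meets_opFunctor hij e₂ e₂' eG eH)) b =
      K.assocFunctor hi (C.opFunctor hj F F' eF) (C.opFunctor hj G G' eG)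
          (C.opFunctor hj H H' eH) (opFunctor_meets_opFunctor hij.symm eF eG e₁ e₁')
          (opFunctor_meets_opFunctor hij.symm eG eH e₂ e₂') ≪≫
        C.opIso hi (Iso.refl _) (K.interFunctor hij.symm hj hi G G' H H' eG eH e₂ e₂')
          (meets_opFunctor (opFunctor_meets_opFunctor hij.symm eF eG e₁ e₁')
            (opFunctor_meets_opFunctor hij.symm eG eH e₂ e₂'))
          (opFunctor_meets_opFunctor hij.symm eF (opFunctor_meets_opFunctor hij e₂ e₂' eG eH)
            (meets_opFunctor e₁ e₂) (meets_opFunctor e₁' e₂')) c ≪≫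
        K.interFunctor hij.symm hj hi F F' (C.opFunctor hi G H e₂) (C.opFunctor hi G' H' e₂') eF
          (opFunctor_meets_opFunctor hij e₂ e₂' eG eH)
          (meets_opFunctor e₁ e₂) (meets_opFunctor e₁' e₂') := by
  have w := Iso.symm_trans_symm_trans_eq (hK.hexagonFunctor hij e₁ e₂ e₁' e₂' eF eG eH
    (K.interFunctor_isoMeets_refl hij e₁ e₁' eF eG
      (opFunctor_meets_opFunctor hij.symm eG eH e₂ e₂')) b
    (K.refl_isoMeets_interFunctor hij e₂ e₂' eG eH
      (opFunctor_meets_opFunctor hij.symm eF eG e₁ e₁')))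
  simp only [opIso_symm, ← K.interFunctor_symm, Iso.refl_symm] at w
  exact w

/-- The pentagon turns the compatibility of merging `F`, `G`, `H` with the associator into that of
merging `P ∘ F`, `G`, `H`. -/
theorem assoc_merge_assoc (hK : K.Coherent) {h : IsFace i T S} {P F G H FG GH R : X ⥤ C.Mor S}
    (eP : C.FunctorMeets h P F) (e₁ : C.FunctorMeets h F G) (e₂ : C.FunctorMeets h G H)
    (eFG : C.FunctorMeets h P FG) (e₁₂ : C.FunctorMeets h FG H) (e₂₁ : C.FunctorMeets h F GH)
    (eR : C.FunctorMeets h P R)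
    (ρ₁ : C.opFunctor h F G e₁ ≅ FG) (ρ₁₂ : C.opFunctor h FG H e₁₂ ≅ R)
    (μ₂ : C.opFunctor h G H e₂ ≅ GH) (ρ₂₁ : C.opFunctor h F GH e₂₁ ≅ R)
    (a₁ : IsoMeets h (Iso.refl P) ρ₁) (a₁' : IsoMeets h ρ₁ (Iso.refl H))
    (a₁₂ : IsoMeets h (Iso.refl P) ρ₁₂) (a₂ : IsoMeets h (Iso.refl F) μ₂)
    (a₂₁ : IsoMeets h (Iso.refl P) ρ₂₁)
    (ih : C.opIso h ρ₁ (Iso.refl H) (opFunctor_meets e₁ e₂) e₁₂ a₁' ≪≫ ρ₁₂ =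
      K.assocFunctor h F G H e₁ e₂ ≪≫
        C.opIso h (Iso.refl F) μ₂ (meets_opFunctor e₁ e₂) e₂₁ a₂ ≪≫ ρ₂₁)
    (b : IsoMeets h (K.assocFunctor h P F G eP e₁ ≪≫
      C.opIso h (Iso.refl P) ρ₁ (meets_opFunctor eP e₁) eFG a₁) (Iso.refl H))
    (b' : IsoMeets h (Iso.refl (C.opFunctor h P F eP)) μ₂) :
    C.opIso h (K.assocFunctor h P F G eP e₁ ≪≫
          C.opIso h (Iso.refl P) ρ₁ (meets_opFunctor eP e₁) eFG a₁) (Iso.refl H)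
          (opFunctor_meets (opFunctor_meets eP e₁) e₂) (opFunctor_meets eFG e₁₂) b ≪≫
        (K.assocFunctor h P FG H eFG e₁₂ ≪≫
          C.opIso h (Iso.refl P) ρ₁₂ (meets_opFunctor eFG e₁₂) eR a₁₂) =
      K.assocFunctor h (C.opFunctor h P F eP) G H (opFunctor_meets eP e₁) e₂ ≪≫
        C.opIso h (Iso.refl _) μ₂ (meets_opFunctor (opFunctor_meets eP e₁) e₂)
          (opFunctor_meets eP e₂₁) b' ≪≫
        (K.assocFunctor h P F GH eP e₂₁ ≪≫
          C.opIso h (Iso.refl P) ρ₂₁ (meets_opFunctor eP e₂₁) eR a₂₁) := by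
  have b₁ := K.assocFunctor_isoMeets_refl eP e₁ e₂
  have b₂ := IsoMeets.opIso_left (e := meets_opFunctor eP e₁) (e' := eFG) a₁ a₁'
  have c₁ := IsoMeets.opIso_right (e := opFunctor_meets e₁ e₂) (e' := e₁₂) a₁' a₁
  have c₂ := K.refl_isoMeets_assocFunctor eP e₁ e₂
  have c₃ := IsoMeets.opIso_right (e := meets_opFunctor e₁ e₂) (e' := e₂₁) a₂ (IsoMeets.refl eP)
  have c₄ := IsoMeets.opIso_left (e := eP) (e' := eP) (IsoMeets.refl eP) a₂
  have d : C.opIso h (Iso.refl _) μ₂ (meets_opFunctor (opFunctor_meets eP e₁) e₂)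
      (opFunctor_meets eP e₂₁) b' = C.opIso h (C.opIso h (Iso.refl P) (Iso.refl F) eP eP
        (IsoMeets.refl eP)) μ₂ (meets_opFunctor (opFunctor_meets eP e₁) e₂)
          (opFunctor_meets eP e₂₁) c₄ := opIso_congr (opIso_refl _).symm rfl
  have f := meets_opFunctor (meets_opFunctor eP e₁) (opFunctor_meets e₁ e₂)
  -- `q` is the assumption `ih` composed with the identity of `P`.
  have q := opIso_congr (e := f) (e' := eR) (a := c₁.refl_trans a₁₂) rfl ih
  rw [opIso_refl_trans (meets_opFunctor eFG e₁₂) c₁ a₁₂,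
    opIso_refl_trans (meets_opFunctor eP (meets_opFunctor e₁ e₂)) c₂ (c₃.refl_trans a₂₁),
    opIso_refl_trans (meets_opFunctor eP e₂₁) c₃ a₂₁] at q
  rw [d, opIso_trans_refl (opFunctor_meets (meets_opFunctor eP e₁) (opFunctor_meets e₁ e₂)) b₁ b₂,
    Iso.trans_assoc,
    Iso.trans_trans_eq_of_eq (K.assocFunctor_naturality (meets_opFunctor eP e₁)
      (opFunctor_meets e₁ e₂) eFG e₁₂ a₁ a₁' b₂ c₁),
    Iso.trans_trans_eq_of_eq (K.assocFunctor_naturality eP (meets_opFunctor e₁ e₂) eP e₂₁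
      (IsoMeets.refl eP) a₂ c₄ c₃), q]
  have p := hK.pentagonFunctor eP e₁ e₂ b₁ c₂
  rw [← Iso.trans_assoc (K.assocFunctor ..) (K.assocFunctor ..), p]
  simp only [Iso.trans_assoc]

/-- The hexagon for an interchanger and the associator reduces the compatibility of merging along
the direction `i` with the associator to the two parts of a transverse cut. -/
theorem assoc_merge_inter (hK : K.Coherent) {l : Fin n} (hli : l ≠ i) {hl : IsFace l T' S}
    {hi : IsFace i T S} {P₁ P₂ P₃ P₁₂ P₂₃ P R₁ R₂ R₃ R₁₂ R₂₃ R : X ⥤ C.Mor S}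
    (e₁ : C.FunctorMeets hl P₁ R₁) (e₂ : C.FunctorMeets hl P₂ R₂) (e₃ : C.FunctorMeets hl P₃ R₃)
    (e₁₂ : C.FunctorMeets hl P₁₂ R₁₂) (e₂₃ : C.FunctorMeets hl P₂₃ R₂₃)
    (e : C.FunctorMeets hl P R)
    (p₁ : C.FunctorMeets hi P₁ P₂) (p₂ : C.FunctorMeets hi P₂ P₃)
    (p₁₂ : C.FunctorMeets hi P₁₂ P₃) (p₂₃ : C.FunctorMeets hi P₁ P₂₃)
    (r₁ : C.FunctorMeets hi R₁ R₂) (r₂ : C.FunctorMeets hi R₂ R₃)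
    (r₁₂ : C.FunctorMeets hi R₁₂ R₃) (r₂₃ : C.FunctorMeets hi R₁ R₂₃)
    (π₁ : C.opFunctor hi P₁ P₂ p₁ ≅ P₁₂) (π₂ : C.opFunctor hi P₂ P₃ p₂ ≅ P₂₃)
    (π₁₂ : C.opFunctor hi P₁₂ P₃ p₁₂ ≅ P) (π₂₃ : C.opFunctor hi P₁ P₂₃ p₂₃ ≅ P)
    (ρ₁ : C.opFunctor hi R₁ R₂ r₁ ≅ R₁₂) (ρ₂ : C.opFunctor hi R₂ R₃ r₂ ≅ R₂₃)
    (ρ₁₂ : C.opFunctor hi R₁₂ R₃ r₁₂ ≅ R) (ρ₂₃ : C.opFunctor hi R₁ R₂₃ r₂₃ ≅ R)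
    (a₁ : IsoMeets hl π₁ ρ₁) (a₂ : IsoMeets hl π₂ ρ₂) (a₁₂ : IsoMeets hl π₁₂ ρ₁₂)
    (a₂₃ : IsoMeets hl π₂₃ ρ₂₃)
    (x₁ : IsoMeets hi π₁ (Iso.refl P₃)) (y₁ : IsoMeets hi ρ₁ (Iso.refl R₃))
    (x₂ : IsoMeets hi (Iso.refl P₁) π₂) (y₂ : IsoMeets hi (Iso.refl R₁) ρ₂)
    (ihP : C.opIso hi π₁ (Iso.refl P₃) (opFunctor_meets p₁ p₂) p₁₂ x₁ ≪≫ π₁₂ =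
      K.assocFunctor hi P₁ P₂ P₃ p₁ p₂ ≪≫
        C.opIso hi (Iso.refl P₁) π₂ (meets_opFunctor p₁ p₂) p₂₃ x₂ ≪≫ π₂₃)
    (ihR : C.opIso hi ρ₁ (Iso.refl R₃) (opFunctor_meets r₁ r₂) r₁₂ y₁ ≪≫ ρ₁₂ =
      K.assocFunctor hi R₁ R₂ R₃ r₁ r₂ ≪≫
        C.opIso hi (Iso.refl R₁) ρ₂ (meets_opFunctor r₁ r₂) r₂₃ y₂ ≪≫ ρ₂₃)
    (b : IsoMeets hi (K.interFunctor hli hl hi P₁ R₁ P₂ R₂ e₁ e₂ p₁ r₁ ≪≫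
      C.opIso hl π₁ ρ₁ (opFunctor_meets_opFunctor hli.symm p₁ r₁ e₁ e₂) e₁₂ a₁)
      (Iso.refl (C.opFunctor hl P₃ R₃ e₃)))
    (b' : IsoMeets hi (Iso.refl (C.opFunctor hl P₁ R₁ e₁))
      (K.interFunctor hli hl hi P₂ R₂ P₃ R₃ e₂ e₃ p₂ r₂ ≪≫
      C.opIso hl π₂ ρ₂ (opFunctor_meets_opFunctor hli.symm p₂ r₂ e₂ e₃) e₂₃ a₂)) :
    C.opIso hi (K.interFunctor hli hl hi P₁ R₁ P₂ R₂ e₁ e₂ p₁ r₁ ≪≫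
          C.opIso hl π₁ ρ₁ (opFunctor_meets_opFunctor hli.symm p₁ r₁ e₁ e₂) e₁₂ a₁)
          (Iso.refl _) (opFunctor_meets (opFunctor_meets_opFunctor hli e₁ e₂ p₁ r₁)
            (opFunctor_meets_opFunctor hli e₂ e₃ p₂ r₂))
          (opFunctor_meets_opFunctor hli e₁₂ e₃ p₁₂ r₁₂) b ≪≫
        (K.interFunctor hli hl hi P₁₂ R₁₂ P₃ R₃ e₁₂ e₃ p₁₂ r₁₂ ≪≫
          C.opIso hl π₁₂ ρ₁₂ (opFunctor_meets_opFunctor hli.symm p₁₂ r₁₂ e₁₂ e₃) e a₁₂) =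
      K.assocFunctor hi (C.opFunctor hl P₁ R₁ e₁) (C.opFunctor hl P₂ R₂ e₂)
          (C.opFunctor hl P₃ R₃ e₃) (opFunctor_meets_opFunctor hli e₁ e₂ p₁ r₁)
          (opFunctor_meets_opFunctor hli e₂ e₃ p₂ r₂) ≪≫
        C.opIso hi (Iso.refl _) (K.interFunctor hli hl hi P₂ R₂ P₃ R₃ e₂ e₃ p₂ r₂ ≪≫
            C.opIso hl π₂ ρ₂ (opFunctor_meets_opFunctor hli.symm p₂ r₂ e₂ e₃) e₂₃ a₂)
          (meets_opFunctor (opFunctor_meets_opFunctor hli e₁ e₂ p₁ r₁)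
            (opFunctor_meets_opFunctor hli e₂ e₃ p₂ r₂))
          (opFunctor_meets_opFunctor hli e₁ e₂₃ p₂₃ r₂₃) b' ≪≫
        (K.interFunctor hli hl hi P₁ R₁ P₂₃ R₂₃ e₁ e₂₃ p₂₃ r₂₃ ≪≫
          C.opIso hl π₂₃ ρ₂₃ (opFunctor_meets_opFunctor hli.symm p₂₃ r₂₃ e₁ e₂₃) e a₂₃) := by
  have f₁ := opFunctor_meets_opFunctor hli.symm p₁ r₁ e₁ e₂
  have f₂ := opFunctor_meets_opFunctor hli.symm p₂ r₂ e₂ e₃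
  have g₁ := opFunctor_meets_opFunctor hli e₁ e₂ p₁ r₁
  have g₂ := opFunctor_meets_opFunctor hli e₂ e₃ p₂ r₂
  have b₁ := K.interFunctor_isoMeets_refl' hli e₁ e₂ p₁ r₁ g₂
  have b₁' := K.refl_isoMeets_interFunctor' hli e₂ e₃ p₂ r₂ g₁
  have b₂ := IsoMeets.opIso hli f₁ e₁₂ e₃ e₃ a₁ (IsoMeets.refl e₃) x₁ y₁
  have b₂' := IsoMeets.opIso hli e₁ e₁ f₂ e₂₃ (IsoMeets.refl e₁) a₂ x₂ y₂
  have b₃ : IsoMeets hi (C.opIso hl π₁ ρ₁ f₁ e₁₂ a₁) (Iso.refl (C.opFunctor hl P₃ R₃ e₃)) := by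
    rwa [opIso_refl] at b₂
  have b₃' : IsoMeets hi (Iso.refl (C.opFunctor hl P₁ R₁ e₁)) (C.opIso hl π₂ ρ₂ f₂ e₂₃ a₂) := by
    rwa [opIso_refl] at b₂'
  have c₁ := IsoMeets.opIso hli.symm (opFunctor_meets p₁ p₂) p₁₂ (opFunctor_meets r₁ r₂) r₁₂ x₁ y₁
    a₁ (IsoMeets.refl e₃)
  have c₂ := K.isoMeets_assocFunctor hli.symm p₁ p₂ r₁ r₂ e₁ e₂ e₃
  have c₃ := IsoMeets.opIso hli.symm (meets_opFunctor p₁ p₂) p₂₃ (meets_opFunctor r₁ r₂) r₂₃ x₂ y₂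
    (IsoMeets.refl e₁) a₂
  have k₁ := opFunctor_meets_opFunctor hli.symm (opFunctor_meets p₁ p₂) (opFunctor_meets r₁ r₂)
    f₁ e₃
  have k₂ := opFunctor_meets_opFunctor hli.symm (meets_opFunctor p₁ p₂) (meets_opFunctor r₁ r₂)
    e₁ f₂
  -- `q` is the composite of the assumptions for the two parts.
  have q := opIso_congr (e := k₁) (e' := e) (a := c₁.trans a₁₂) ihP ihR
  rw [opIso_trans (opFunctor_meets_opFunctor hli.symm p₁₂ r₁₂ e₁₂ e₃) c₁ a₁₂,
    opIso_trans k₂ c₂ (c₃.trans a₂₃),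
    opIso_trans (opFunctor_meets_opFunctor hli.symm p₂₃ r₂₃ e₁ e₂₃) c₃ a₂₃] at q
  have m₁ := opFunctor_meets_opFunctor hli f₁ e₃ (opFunctor_meets p₁ p₂) (opFunctor_meets r₁ r₂)
  have m₂ := opFunctor_meets_opFunctor hli e₁ f₂ (meets_opFunctor p₁ p₂) (meets_opFunctor r₁ r₂)
  have d₁ := opIso_congr (e := m₁) (e' := opFunctor_meets_opFunctor hli e₁₂ e₃ p₁₂ r₁₂)
    (a := b₂) rfl (opIso_refl _)
  have d₂ := opIso_congr (e := m₂) (e' := opFunctor_meets_opFunctor hli e₁ e₂₃ p₂₃ r₂₃)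
    (a := b₂') (opIso_refl _) rfl
  rw [opIso_trans_refl m₁ b₁ b₃, opIso_refl_trans m₂ b₁' b₃', ← d₁, ← d₂]
  simp only [Iso.trans_assoc]
  rw [Iso.trans_trans_eq_of_eq (K.interFunctor_naturality hli f₁ e₃ (opFunctor_meets p₁ p₂)
      (opFunctor_meets r₁ r₂) e₁₂ e₃ p₁₂ r₁₂ a₁ (IsoMeets.refl e₃) x₁ y₁ b₂ c₁),
    Iso.trans_trans_eq_of_eq (K.interFunctor_naturality hli e₁ f₂ (meets_opFunctor p₁ p₂)
      (meets_opFunctor r₁ r₂) e₁ e₂₃ p₂₃ r₂₃ (IsoMeets.refl e₁) a₂ x₂ y₂ b₂' c₃), q]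
  have w := congrArg (· ≪≫ C.opIso hl _ _ k₂ (opFunctor_meets_opFunctor hli.symm p₂₃ r₂₃ e₁ e₂₃)
    c₃ ≪≫ C.opIso hl _ _ _ e a₂₃)
    (hK.hexagonFunctor_symm hli.symm p₁ p₂ r₁ r₂ e₁ e₂ e₃ b₁ c₂ b₁')
  simpa only [Iso.trans_assoc] using w

end Coherent

end CubeConstraints

namespace CubeConstraints.Coherent

variable {n : ℕ} {C : CubeCompositions.{v, u} n} {K : CubeConstraints C} {i j k : Fin n}
  {T T' S : Finset (Fin n)} {X : Type u₁} [Category.{v₁} X]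

/-- The hexagon for an interchanger and the associator turns the compatibility of merging `F`, `G`,
`F'`, `G'` with the interchanger into that of merging `P₁ ∘ᵢ F`, `G`, `P₂ ∘ᵢ F'`, `G'`. -/
theorem inter_merge_assoc (hK : K.Coherent) (hij : i ≠ j) {hi : IsFace i T S}
    {hj : IsFace j T' S} {P₁ P₂ P F G F' G' FG FG' FF' GG' R : X ⥤ C.Mor S}
    (u₁ : C.FunctorMeets hi P₁ F) (u₂ : C.FunctorMeets hi P₂ F') (e : C.FunctorMeets hi F G)
    (e' : C.FunctorMeets hi F' G') (v₁ : C.FunctorMeets hi P₁ FG) (v₂ : C.FunctorMeets hi P₂ FG')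
    (w : C.FunctorMeets hi FF' GG') (z₁ : C.FunctorMeets hi P FF') (z : C.FunctorMeets hi P R)
    (s : C.FunctorMeets hj P₁ P₂) (eF : C.FunctorMeets hj F F') (eG : C.FunctorMeets hj G G')
    (eFG : C.FunctorMeets hj FG FG')
    (μ : C.opFunctor hi F G e ≅ FG) (μ' : C.opFunctor hi F' G' e' ≅ FG')
    (π : C.opFunctor hj P₁ P₂ s ≅ P) (κ : C.opFunctor hj F F' eF ≅ FF')
    (κ' : C.opFunctor hj G G' eG ≅ GG') (ν : C.opFunctor hj FG FG' eFG ≅ R)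
    (ξ : C.opFunctor hi FF' GG' w ≅ R)
    (a₁ : IsoMeets hi (Iso.refl P₁) μ) (a₂ : IsoMeets hi (Iso.refl P₂) μ')
    (a₃ : IsoMeets hi π κ) (a₄ : IsoMeets hi π ν) (a₅ : IsoMeets hi κ κ')
    (a₆ : IsoMeets hi (Iso.refl P) ξ) (b : IsoMeets hj μ μ')
    (ih : C.opIso hj μ μ' (opFunctor_meets_opFunctor hij e e' eF eG) eFG b ≪≫ ν =
      K.interFunctor hij hi hj F G F' G' e e' eF eG ≪≫
        C.opIso hi κ κ' (opFunctor_meets_opFunctor hij.symm eF eG e e') w a₅ ≪≫ ξ)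
    (c : IsoMeets hj (K.assocFunctor hi P₁ F G u₁ e ≪≫ C.opIso hi (Iso.refl P₁) μ
      (meets_opFunctor u₁ e) v₁ a₁)
      (K.assocFunctor hi P₂ F' G' u₂ e' ≪≫
      C.opIso hi (Iso.refl P₂) μ' (meets_opFunctor u₂ e') v₂ a₂))
    (c' : IsoMeets hi (K.interFunctor hij hi hj P₁ F P₂ F' u₁ u₂ s eF ≪≫
      C.opIso hi π κ (opFunctor_meets_opFunctor hij.symm s eF u₁ u₂) z₁ a₃) κ') :
    C.opIso hj
      (K.assocFunctor hi P₁ F G u₁ e ≪≫ C.opIso hi (Iso.refl P₁) μ (meets_opFunctor u₁ e) v₁ a₁)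
      (K.assocFunctor hi P₂ F' G' u₂ e' ≪≫
      C.opIso hi (Iso.refl P₂) μ' (meets_opFunctor u₂ e') v₂ a₂)
      (opFunctor_meets_opFunctor hij (opFunctor_meets u₁ e) (opFunctor_meets u₂ e')
        (opFunctor_meets_opFunctor hij u₁ u₂ s eF) eG)
      (opFunctor_meets_opFunctor hij v₁ v₂ s eFG) c ≪≫
        (K.interFunctor hij hi hj P₁ FG P₂ FG' v₁ v₂ s eFG ≪≫
          C.opIso hi π ν (opFunctor_meets_opFunctor hij.symm s eFG v₁ v₂) z a₄) =
      K.interFunctor hij hi hj (C.opFunctor hi P₁ F u₁) G (C.opFunctor hi P₂ F' u₂) G'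
        (opFunctor_meets u₁ e) (opFunctor_meets u₂ e') (opFunctor_meets_opFunctor hij u₁ u₂ s eF)
          eG ≪≫
        C.opIso hi (K.interFunctor hij hi hj P₁ F P₂ F' u₁ u₂ s eF ≪≫
      C.opIso hi π κ (opFunctor_meets_opFunctor hij.symm s eF u₁ u₂) z₁ a₃) κ'
          (opFunctor_meets_opFunctor hij.symm (opFunctor_meets_opFunctor hij u₁ u₂ s eF) eG
            (opFunctor_meets u₁ e) (opFunctor_meets u₂ e')) (opFunctor_meets z₁ w) c' ≪≫
        (K.assocFunctor hi P FF' GG' z₁ w ≪≫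
          C.opIso hi (Iso.refl P) ξ (meets_opFunctor z₁ w) z a₆) := by
  have f := opFunctor_meets_opFunctor hij e e' eF eG
  have g := opFunctor_meets_opFunctor hij.symm eF eG e e'
  have gP := opFunctor_meets_opFunctor hij.symm s eF u₁ u₂
  have s₁ := opFunctor_meets_opFunctor hij (meets_opFunctor u₁ e) (meets_opFunctor u₂ e') s f
  have b₁ := K.isoMeets_assocFunctor hij u₁ e u₂ e' s eF eG
  have b₂ := IsoMeets.opIso hij (meets_opFunctor u₁ e) v₁ (meets_opFunctor u₂ e') v₂ a₁ a₂
    (IsoMeets.refl s) b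
  have sμ := opFunctor_meets_opFunctor hij.symm s f (meets_opFunctor u₁ e) (meets_opFunctor u₂ e')
  have sν := opFunctor_meets_opFunctor hij.symm s eFG v₁ v₂
  have b₃ := IsoMeets.opIso hij.symm s s f eFG (IsoMeets.refl s) b a₁ a₂
  have b₄ := K.refl_isoMeets_interFunctor hij e e' eF eG gP
  have b₅ := IsoMeets.opIso_right (e := g) (e' := w) a₅ a₃
  have b₆ := K.interFunctor_isoMeets_refl hij u₁ u₂ s eF g
  have b₇ := IsoMeets.opIso_left (e := gP) (e' := z₁) a₃ a₅
  -- `q` is the assumption `ih` composed with the merge `π` of the first slices.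
  have q := opIso_congr (e := sμ) (e' := z) (a := b₃.trans a₄)
    (show C.opIso hj (Iso.refl P₁) (Iso.refl P₂) s s (IsoMeets.refl s) ≪≫ π =
      Iso.refl _ ≪≫ π ≪≫ Iso.refl _ by rw [opIso_refl]; simp) ih
  rw [opIso_trans sν b₃ a₄, opIso_trans (meets_opFunctor gP g) b₄ (b₅.trans a₆),
    opIso_trans (meets_opFunctor z₁ w) b₅ a₆] at q
  have d := opIso_congr
    (e := (opFunctor_meets_opFunctor hij.symm (opFunctor_meets_opFunctor hij u₁ u₂ s eF) eG
      (opFunctor_meets u₁ e) (opFunctor_meets u₂ e'))) (e' := opFunctor_meets z₁ w)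
    (a := c') rfl (Iso.refl_trans κ').symm
  rw [opIso_trans s₁ b₁ b₂, d, opIso_trans (opFunctor_meets gP g) b₆ b₇]
  simp only [Iso.trans_assoc]
  rw [Iso.trans_trans_eq_of_eq (K.interFunctor_naturality hij (meets_opFunctor u₁ e)
      (meets_opFunctor u₂ e') s f v₁ v₂ s eFG a₁ a₂ (IsoMeets.refl s) b b₂ b₃), q,
    Iso.trans_trans_eq_of_eq (K.assocFunctor_naturality gP g z₁ w a₃ a₅ b₇ b₅)]
  have hex := congrArg (· ≪≫ C.opIso hi _ _ (meets_opFunctor gP g) (meets_opFunctor z₁ w) b₅ ≪≫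
    C.opIso hi _ _ _ z a₆) (hK.hexagonFunctor hij u₁ e u₂ e' s eF eG b₆ b₁ b₄)
  simpa only [Iso.trans_assoc] using hex.symm

/-- The hexagon for three interchangers reduces the compatibility of merging along the directions
`i` and `j` with the interchanger to the two parts of a cut in a third direction. -/
theorem inter_merge_inter (hK : K.Coherent) {l : Fin n} {T'' : Finset (Fin n)} (hli : l ≠ i)
    (hlj : l ≠ j) (hij : i ≠ j) {hl : IsFace l T'' S} {hi : IsFace i T S} {hj : IsFace j T' S}
    {P₁ P₂ P₃ P₄ P₁₂ P₃₄ P₁₃ P₂₄ P R₁ R₂ R₃ R₄ R₁₂ R₃₄ R₁₃ R₂₄ R : X ⥤ C.Mor S}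
    (e₁ : C.FunctorMeets hl P₁ R₁) (e₂ : C.FunctorMeets hl P₂ R₂) (e₃ : C.FunctorMeets hl P₃ R₃)
    (e₄ : C.FunctorMeets hl P₄ R₄) (e₁₂ : C.FunctorMeets hl P₁₂ R₁₂)
    (e₃₄ : C.FunctorMeets hl P₃₄ R₃₄) (e₁₃ : C.FunctorMeets hl P₁₃ R₁₃)
    (e₂₄ : C.FunctorMeets hl P₂₄ R₂₄) (e : C.FunctorMeets hl P R)
    (p₁₂ : C.FunctorMeets hi P₁ P₂) (p₃₄ : C.FunctorMeets hi P₃ P₄)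
    (p : C.FunctorMeets hi P₁₃ P₂₄) (q₁₃ : C.FunctorMeets hj P₁ P₃)
    (q₂₄ : C.FunctorMeets hj P₂ P₄) (q : C.FunctorMeets hj P₁₂ P₃₄)
    (μ₁₂ : C.opFunctor hi P₁ P₂ p₁₂ ≅ P₁₂) (μ₃₄ : C.opFunctor hi P₃ P₄ p₃₄ ≅ P₃₄)
    (ν : C.opFunctor hj P₁₂ P₃₄ q ≅ P) (κ₁₃ : C.opFunctor hj P₁ P₃ q₁₃ ≅ P₁₃)
    (κ₂₄ : C.opFunctor hj P₂ P₄ q₂₄ ≅ P₂₄) (ξ : C.opFunctor hi P₁₃ P₂₄ p ≅ P)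
    (r₁₂ : C.FunctorMeets hi R₁ R₂) (r₃₄ : C.FunctorMeets hi R₃ R₄)
    (r : C.FunctorMeets hi R₁₃ R₂₄) (s₁₃ : C.FunctorMeets hj R₁ R₃)
    (s₂₄ : C.FunctorMeets hj R₂ R₄) (s : C.FunctorMeets hj R₁₂ R₃₄)
    (ρ₁₂ : C.opFunctor hi R₁ R₂ r₁₂ ≅ R₁₂) (ρ₃₄ : C.opFunctor hi R₃ R₄ r₃₄ ≅ R₃₄)
    (τ : C.opFunctor hj R₁₂ R₃₄ s ≅ R) (σ₁₃ : C.opFunctor hj R₁ R₃ s₁₃ ≅ R₁₃)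
    (σ₂₄ : C.opFunctor hj R₂ R₄ s₂₄ ≅ R₂₄) (θ : C.opFunctor hi R₁₃ R₂₄ r ≅ R)
    (a₁₂ : IsoMeets hl μ₁₂ ρ₁₂) (a₃₄ : IsoMeets hl μ₃₄ ρ₃₄) (a₁₃ : IsoMeets hl κ₁₃ σ₁₃)
    (a₂₄ : IsoMeets hl κ₂₄ σ₂₄) (a : IsoMeets hl ν τ) (a' : IsoMeets hl ξ θ)
    (bP : IsoMeets hj μ₁₂ μ₃₄) (bR : IsoMeets hj ρ₁₂ ρ₃₄) (dP : IsoMeets hi κ₁₃ κ₂₄)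
    (dR : IsoMeets hi σ₁₃ σ₂₄)
    (ihP : C.opIso hj μ₁₂ μ₃₄ (opFunctor_meets_opFunctor hij p₁₂ p₃₄ q₁₃ q₂₄) q bP ≪≫ ν =
      K.interFunctor hij hi hj P₁ P₂ P₃ P₄ p₁₂ p₃₄ q₁₃ q₂₄ ≪≫
        C.opIso hi κ₁₃ κ₂₄ (opFunctor_meets_opFunctor hij.symm q₁₃ q₂₄ p₁₂ p₃₄) p dP ≪≫ ξ)
    (ihR : C.opIso hj ρ₁₂ ρ₃₄ (opFunctor_meets_opFunctor hij r₁₂ r₃₄ s₁₃ s₂₄) s bR ≪≫ τ =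
      K.interFunctor hij hi hj R₁ R₂ R₃ R₄ r₁₂ r₃₄ s₁₃ s₂₄ ≪≫
        C.opIso hi σ₁₃ σ₂₄ (opFunctor_meets_opFunctor hij.symm s₁₃ s₂₄ r₁₂ r₃₄) r dR ≪≫ θ)
    (c : IsoMeets hj (K.interFunctor hli hl hi P₁ R₁ P₂ R₂ e₁ e₂ p₁₂ r₁₂ ≪≫
      C.opIso hl μ₁₂ ρ₁₂ (opFunctor_meets_opFunctor hli.symm p₁₂ r₁₂ e₁ e₂) e₁₂ a₁₂)
      (K.interFunctor hli hl hi P₃ R₃ P₄ R₄ e₃ e₄ p₃₄ r₃₄ ≪≫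
      C.opIso hl μ₃₄ ρ₃₄ (opFunctor_meets_opFunctor hli.symm p₃₄ r₃₄ e₃ e₄) e₃₄ a₃₄))
    (c' : IsoMeets hi (K.interFunctor hlj hl hj P₁ R₁ P₃ R₃ e₁ e₃ q₁₃ s₁₃ ≪≫
      C.opIso hl κ₁₃ σ₁₃ (opFunctor_meets_opFunctor hlj.symm q₁₃ s₁₃ e₁ e₃) e₁₃ a₁₃)
      (K.interFunctor hlj hl hj P₂ R₂ P₄ R₄ e₂ e₄ q₂₄ s₂₄ ≪≫
      C.opIso hl κ₂₄ σ₂₄ (opFunctor_meets_opFunctor hlj.symm q₂₄ s₂₄ e₂ e₄) e₂₄ a₂₄)) :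
    C.opIso hj (K.interFunctor hli hl hi P₁ R₁ P₂ R₂ e₁ e₂ p₁₂ r₁₂ ≪≫
      C.opIso hl μ₁₂ ρ₁₂ (opFunctor_meets_opFunctor hli.symm p₁₂ r₁₂ e₁ e₂) e₁₂ a₁₂)
      (K.interFunctor hli hl hi P₃ R₃ P₄ R₄ e₃ e₄ p₃₄ r₃₄ ≪≫
      C.opIso hl μ₃₄ ρ₃₄ (opFunctor_meets_opFunctor hli.symm p₃₄ r₃₄ e₃ e₄) e₃₄ a₃₄)
      (opFunctor_meets_opFunctor hij (opFunctor_meets_opFunctor hli e₁ e₂ p₁₂ r₁₂)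
        (opFunctor_meets_opFunctor hli e₃ e₄ p₃₄ r₃₄) (opFunctor_meets_opFunctor hlj e₁ e₃ q₁₃ s₁₃)
          (opFunctor_meets_opFunctor hlj e₂ e₄ q₂₄ s₂₄))
      (opFunctor_meets_opFunctor hlj e₁₂ e₃₄ q s) c ≪≫
        (K.interFunctor hlj hl hj P₁₂ R₁₂ P₃₄ R₃₄ e₁₂ e₃₄ q s ≪≫
          C.opIso hl ν τ (opFunctor_meets_opFunctor hlj.symm q s e₁₂ e₃₄) e a) =
      K.interFunctor hij hi hj (C.opFunctor hl P₁ R₁ e₁) (C.opFunctor hl P₂ R₂ e₂)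
          (C.opFunctor hl P₃ R₃ e₃) (C.opFunctor hl P₄ R₄ e₄)
          (opFunctor_meets_opFunctor hli e₁ e₂ p₁₂ r₁₂)
            (opFunctor_meets_opFunctor hli e₃ e₄ p₃₄ r₃₄)
          (opFunctor_meets_opFunctor hlj e₁ e₃ q₁₃ s₁₃)
            (opFunctor_meets_opFunctor hlj e₂ e₄ q₂₄ s₂₄) ≪≫
        C.opIso hi (K.interFunctor hlj hl hj P₁ R₁ P₃ R₃ e₁ e₃ q₁₃ s₁₃ ≪≫
      C.opIso hl κ₁₃ σ₁₃ (opFunctor_meets_opFunctor hlj.symm q₁₃ s₁₃ e₁ e₃) e₁₃ a₁₃)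
          (K.interFunctor hlj hl hj P₂ R₂ P₄ R₄ e₂ e₄ q₂₄ s₂₄ ≪≫
      C.opIso hl κ₂₄ σ₂₄ (opFunctor_meets_opFunctor hlj.symm q₂₄ s₂₄ e₂ e₄) e₂₄ a₂₄)
          (opFunctor_meets_opFunctor hij.symm (opFunctor_meets_opFunctor hlj e₁ e₃ q₁₃ s₁₃)
            (opFunctor_meets_opFunctor hlj e₂ e₄ q₂₄ s₂₄)
              (opFunctor_meets_opFunctor hli e₁ e₂ p₁₂ r₁₂)
                (opFunctor_meets_opFunctor hli e₃ e₄ p₃₄ r₃₄))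
          (opFunctor_meets_opFunctor hli e₁₃ e₂₄ p r) c' ≪≫
        (K.interFunctor hli hl hi P₁₃ R₁₃ P₂₄ R₂₄ e₁₃ e₂₄ p r ≪≫
          C.opIso hl ξ θ (opFunctor_meets_opFunctor hli.symm p r e₁₃ e₂₄) e a') := by
  have f₁₂ := opFunctor_meets_opFunctor hli.symm p₁₂ r₁₂ e₁ e₂
  have f₃₄ := opFunctor_meets_opFunctor hli.symm p₃₄ r₃₄ e₃ e₄
  have f₁₃ := opFunctor_meets_opFunctor hlj.symm q₁₃ s₁₃ e₁ e₃
  have f₂₄ := opFunctor_meets_opFunctor hlj.symm q₂₄ s₂₄ e₂ e₄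
  have gP := opFunctor_meets_opFunctor hij p₁₂ p₃₄ q₁₃ q₂₄
  have gR := opFunctor_meets_opFunctor hij r₁₂ r₃₄ s₁₃ s₂₄
  have kP := opFunctor_meets_opFunctor hij.symm q₁₃ q₂₄ p₁₂ p₃₄
  have kR := opFunctor_meets_opFunctor hij.symm s₁₃ s₂₄ r₁₂ r₃₄
  have b₁ := K.isoMeets_interFunctor hli hlj hij e₁ e₂ p₁₂ r₁₂ e₃ e₄ p₃₄ r₃₄ q₁₃ s₁₃ q₂₄ s₂₄
  have b₂ := IsoMeets.opIso hlj f₁₂ e₁₂ f₃₄ e₃₄ a₁₂ a₃₄ bP bR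
  have b₃ := K.isoMeets_interFunctor hlj hli hij.symm e₁ e₃ q₁₃ s₁₃ e₂ e₄ q₂₄ s₂₄ p₁₂ r₁₂ p₃₄ r₃₄
  have b₄ := IsoMeets.opIso hli f₁₃ e₁₃ f₂₄ e₂₄ a₁₃ a₂₄ dP dR
  have c₁ := IsoMeets.opIso hlj.symm gP q gR s bP bR a₁₂ a₃₄
  have c₂ := K.isoMeets_interFunctor hij hli.symm hlj.symm p₁₂ p₃₄ q₁₃ q₂₄ r₁₂ r₃₄ s₁₃ s₂₄
    e₁ e₂ e₃ e₄
  have c₃ := IsoMeets.opIso hli.symm kP p kR r dP dR a₁₃ a₂₄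
  have h₁ := opFunctor_meets_opFunctor hlj.symm gP gR f₁₂ f₃₄
  have h₂ := opFunctor_meets_opFunctor hli.symm kP kR f₁₃ f₂₄
  -- `y` is the composite of the assumptions for the two parts.
  have y := opIso_congr (e := h₁) (e' := e) (a := c₁.trans a) ihP ihR
  rw [opIso_trans (opFunctor_meets_opFunctor hlj.symm q s e₁₂ e₃₄) c₁ a, opIso_trans h₂ c₂
    (c₃.trans a'),
    opIso_trans (opFunctor_meets_opFunctor hli.symm p r e₁₃ e₂₄) c₃ a'] at y
  rw [opIso_trans (opFunctor_meets_opFunctor hlj f₁₂ f₃₄ gP gR) b₁ b₂,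
    opIso_trans (opFunctor_meets_opFunctor hli f₁₃ f₂₄ kP kR) b₃ b₄]
  simp only [Iso.trans_assoc]
  rw [Iso.trans_trans_eq_of_eq (K.interFunctor_naturality hlj f₁₂ f₃₄ gP gR e₁₂ e₃₄ q s
      a₁₂ a₃₄ bP bR b₂ c₁), y,
    Iso.trans_trans_eq_of_eq (K.interFunctor_naturality hli f₁₃ f₂₄ kP kR e₁₃ e₂₄ p r
      a₁₃ a₂₄ dP dR b₄ c₃)]
  have hex := congrArg (· ≪≫ C.opIso hl _ _ h₂ (opFunctor_meets_opFunctor hli.symm p r e₁₃ e₂₄) c₃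
    ≪≫
    C.opIso hl _ _ _ e a') (hK.hexagonFunctor' hli hlj hij e₁ e₂ e₃ e₄ p₁₂ r₁₂ p₃₄ r₃₄
      q₁₃ s₁₃ q₂₄ s₂₄ b₁ c₂ b₃)
  simpa only [Iso.trans_assoc] using hex

end CubeConstraints.Coherent

/-! ### Compatibility of merging with associators and interchangers -/

namespace IsMerge

variable {n : ℕ} {C : CubeCompositions.{v, u} n} {K : CubeConstraints C} {S : Finset (Fin n)}
  {p : S → ℕ} {lo hi₁ lo₂ hi s t s₁ t₂ : S → ℕ} {i j : S} {m m₀ : ℕ}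
  {F G H : Grid C.toCubeFaces S p ⥤ C.Mor S}

/-- A cut that splits off the first slice of the leading direction is merged with the identity. -/
theorem eq_of_first {hc : IsCut j m lo hi₁ lo₂ hi} {e : C.FunctorMeets (IsFace.erase j.2) F G}
    {μ : C.opFunctor (IsFace.erase j.2) F G e ≅ H} (hμ : IsMerge K hc e μ) (hl : IsLead j lo hi)
    (hm : m = lo j + 1) :
    ∃ hH : C.opFunctor (IsFace.erase j.2) F G e = H, μ = eqToIso hH := by
  cases hμ with
  | first => exact ⟨rfl, rfl⟩
  | assoc => omega
  | inter hl' _ hij => exact (hij (congrArg Subtype.val (hl'.unique hl))).elim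

/-- Inversion of a merge along a later cut parallel to the first slice. The functors `F` and `H` are
variables subject to equations, so that case analysis on the merge applies. -/
theorem assoc_inv_aux {hc : IsCut j m lo hi₁ lo₂ hi} {e : C.FunctorMeets (IsFace.erase j.2) F G}
    {μ : C.opFunctor (IsFace.erase j.2) F G e ≅ H} (hμ : IsMerge K hc e μ) (hl : IsLead j lo hi)
    (hm₀ : m₀ = lo j + 1) (hlt : m₀ < m) (hs : IsCut j m₀ lo s t hi)
    (hr : IsCut j m t hi₁ lo₂ hi) {A : Bracketing S lo s} {B : Bracketing S t hi₁}
    {D : Bracketing S t hi} {P R R' : Grid C.toCubeFaces S p ⥤ C.Mor S} (hA : IsNormal A P)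
    (hB : IsNormal B R) (hD : IsNormal D R') (e₁ : C.FunctorMeets (IsFace.erase j.2) P R)
    (e' : C.FunctorMeets (IsFace.erase j.2) P R')
    (hF : F = C.opFunctor (IsFace.erase j.2) P R e₁)
    (hH : H = C.opFunctor (IsFace.erase j.2) P R' e') :
    ∃ (e₂ : C.FunctorMeets (IsFace.erase j.2) R G)
      (ρ : C.opFunctor (IsFace.erase j.2) R G e₂ ≅ R') (_ : IsMerge K hr e₂ ρ)
      (a : IsoMeets (IsFace.erase j.2) (Iso.refl P) ρ),
      HEq μ (K.assocFunctor (IsFace.erase j.2) P R G e₁ e₂ ≪≫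
        C.opIso (IsFace.erase j.2) (Iso.refl P) ρ (meets_opFunctor e₁ e₂) e' a) := by
  cases hμ with
  | first => omega
  | assoc hl' hm₀' _ _ ks _ kr hA' k₁ k₂ k hρ a =>
    obtain rfl := hm₀.trans hm₀'.symm
    obtain ⟨rfl, rfl⟩ := hs.unique ks
    obtain ⟨⟨_, h₁⟩, _, ⟨_, h₂⟩⟩ := hρ.isNormal
    obtain rfl := hA.functor_unique hA'
    obtain rfl := hB.functor_unique h₁
    obtain rfl := hD.functor_unique h₂
    exact ⟨_, _, hρ, a, HEq.rfl⟩
  | inter hl' _ hij => exact (hij (congrArg Subtype.val (hl'.unique hl))).elim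

/-- A cut parallel to the leading direction, but not the first one, is merged with an associator. -/
theorem eq_of_assoc {P R R' : Grid C.toCubeFaces S p ⥤ C.Mor S} {hc : IsCut j m lo hi₁ lo₂ hi}
    {e₁ : C.FunctorMeets (IsFace.erase j.2) P R} {e' : C.FunctorMeets (IsFace.erase j.2) P R'}
    {e : C.FunctorMeets (IsFace.erase j.2) (C.opFunctor (IsFace.erase j.2) P R e₁) G}
    {μ : C.opFunctor (IsFace.erase j.2) (C.opFunctor (IsFace.erase j.2) P R e₁) G e ≅
      C.opFunctor (IsFace.erase j.2) P R' e'}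
    (hμ : IsMerge K hc e μ) (hl : IsLead j lo hi) (hm₀ : m₀ = lo j + 1) (hlt : m₀ < m)
    (hs : IsCut j m₀ lo s t hi) {A : Bracketing S lo s} {B : Bracketing S t hi₁}
    {D : Bracketing S t hi} (hA : IsNormal A P) (hB : IsNormal B R) (hD : IsNormal D R') :
    ∃ (e₂ : C.FunctorMeets (IsFace.erase j.2) R G)
      (ρ : C.opFunctor (IsFace.erase j.2) R G e₂ ≅ R')
      (_ : IsMerge K (hc.parallel hs hlt).2 e₂ ρ)
      (a : IsoMeets (IsFace.erase j.2) (Iso.refl P) ρ),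
      μ = K.assocFunctor (IsFace.erase j.2) P R G e₁ e₂ ≪≫
        C.opIso (IsFace.erase j.2) (Iso.refl P) ρ (meets_opFunctor e₁ e₂) e' a := by
  obtain ⟨e₂, ρ, hρ, a, h⟩ := hμ.assoc_inv_aux hl hm₀ hlt hs (hc.parallel hs hlt).2 hA hB hD e₁ e'
    rfl rfl
  exact ⟨e₂, ρ, hρ, a, eq_of_heq h⟩

/-- Inversion of a merge along a cut transverse to the first slice. The functors `F`, `G`, `H` are
variables subject to equations, so that case analysis on the merge applies. -/
theorem inter_inv_aux {hc : IsCut j m lo hi₁ lo₂ hi} {e : C.FunctorMeets (IsFace.erase j.2) F G}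
    {μ : C.opFunctor (IsFace.erase j.2) F G e ≅ H} (hμ : IsMerge K hc e μ) (hl : IsLead i lo hi)
    (hm₀ : m₀ = lo i + 1) (hij : (i : Fin n) ≠ j) (hs : IsCut i m₀ lo s t hi)
    (hs₁ : IsCut i m₀ lo s₁ t hi₁) (hs₂ : IsCut i m₀ lo₂ s t₂ hi)
    (hP : IsCut j m lo s₁ lo₂ s) (hR : IsCut j m t hi₁ t₂ hi)
    {A₁ : Bracketing S lo s₁} {A₂ : Bracketing S lo₂ s} {A : Bracketing S lo s}
    {B₁ : Bracketing S t hi₁} {B₂ : Bracketing S t₂ hi} {B : Bracketing S t hi}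
    {P₁ P₂ P R₁ R₂ R : Grid C.toCubeFaces S p ⥤ C.Mor S}
    (hA₁ : IsNormal A₁ P₁) (hA₂ : IsNormal A₂ P₂) (hA : IsNormal A P)
    (hB₁ : IsNormal B₁ R₁) (hB₂ : IsNormal B₂ R₂) (hB : IsNormal B R)
    (e₁ : C.FunctorMeets (IsFace.erase i.2) P₁ R₁) (e₂ : C.FunctorMeets (IsFace.erase i.2) P₂ R₂)
    (e₀ : C.FunctorMeets (IsFace.erase i.2) P R)
    (hF : F = C.opFunctor (IsFace.erase i.2) P₁ R₁ e₁)
    (hG : G = C.opFunctor (IsFace.erase i.2) P₂ R₂ e₂)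
    (hH : H = C.opFunctor (IsFace.erase i.2) P R e₀) :
    ∃ (eP : C.FunctorMeets (IsFace.erase j.2) P₁ P₂) (eR : C.FunctorMeets (IsFace.erase j.2) R₁ R₂)
      (π : C.opFunctor (IsFace.erase j.2) P₁ P₂ eP ≅ P)
      (ρ : C.opFunctor (IsFace.erase j.2) R₁ R₂ eR ≅ R)
      (_ : IsMerge K hP eP π) (_ : IsMerge K hR eR ρ) (a : IsoMeets (IsFace.erase i.2) π ρ),
      HEq μ (K.interFunctor hij (IsFace.erase i.2) (IsFace.erase j.2) P₁ R₁ P₂ R₂ e₁ e₂ eP eR ≪≫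
        C.opIso (IsFace.erase i.2) π ρ (opFunctor_meets_opFunctor hij.symm eP eR e₁ e₂) e₀ a) := by
  cases hμ with
  | first hl' => exact (hij (congrArg Subtype.val (hl.unique hl'))).elim
  | assoc hl' => exact (hij (congrArg Subtype.val (hl.unique hl'))).elim
  | inter hl' hm₀' hij' _ ks ks₁ ks₂ kP kR k₁ k₂ kP' kR' k hπ hρ a =>
    obtain rfl := hl.unique hl'
    obtain rfl := hm₀.trans hm₀'.symm
    obtain ⟨rfl, rfl⟩ := hs.unique ks
    obtain ⟨rfl, -⟩ := hs₁.unique ks₁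
    obtain ⟨-, rfl⟩ := hs₂.unique ks₂
    obtain ⟨⟨_, h₁⟩, ⟨_, h₂⟩, ⟨_, h₃⟩⟩ := hπ.isNormal
    obtain ⟨⟨_, l₁⟩, ⟨_, l₂⟩, ⟨_, l₃⟩⟩ := hρ.isNormal
    obtain rfl := hA₁.functor_unique h₁
    obtain rfl := hA₂.functor_unique h₂
    obtain rfl := hA.functor_unique h₃
    obtain rfl := hB₁.functor_unique l₁
    obtain rfl := hB₂.functor_unique l₂
    obtain rfl := hB.functor_unique l₃
    exact ⟨_, _, _, _, hπ, hρ, a, HEq.rfl⟩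

/-- A cut transverse to the leading direction is merged with an interchanger. -/
theorem eq_of_inter {P₁ P₂ P R₁ R₂ R : Grid C.toCubeFaces S p ⥤ C.Mor S}
    {hc : IsCut j m lo hi₁ lo₂ hi}
    {e₁ : C.FunctorMeets (IsFace.erase i.2) P₁ R₁} {e₂ : C.FunctorMeets (IsFace.erase i.2) P₂ R₂}
    {e₀ : C.FunctorMeets (IsFace.erase i.2) P R}
    {e : C.FunctorMeets (IsFace.erase j.2) (C.opFunctor (IsFace.erase i.2) P₁ R₁ e₁)
      (C.opFunctor (IsFace.erase i.2) P₂ R₂ e₂)}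
    {μ : C.opFunctor (IsFace.erase j.2) (C.opFunctor (IsFace.erase i.2) P₁ R₁ e₁)
      (C.opFunctor (IsFace.erase i.2) P₂ R₂ e₂) e ≅ C.opFunctor (IsFace.erase i.2) P R e₀}
    (hμ : IsMerge K hc e μ) (hl : IsLead i lo hi)
    (hm₀ : m₀ = lo i + 1) (hij : (i : Fin n) ≠ j) (hs : IsCut i m₀ lo s t hi)
    (hs₁ : IsCut i m₀ lo s₁ t hi₁) (hs₂ : IsCut i m₀ lo₂ s t₂ hi)
    (hP : IsCut j m lo s₁ lo₂ s) (hR : IsCut j m t hi₁ t₂ hi)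
    {A₁ : Bracketing S lo s₁} {A₂ : Bracketing S lo₂ s} {A : Bracketing S lo s}
    {B₁ : Bracketing S t hi₁} {B₂ : Bracketing S t₂ hi} {B : Bracketing S t hi}
    (hA₁ : IsNormal A₁ P₁) (hA₂ : IsNormal A₂ P₂) (hA : IsNormal A P)
    (hB₁ : IsNormal B₁ R₁) (hB₂ : IsNormal B₂ R₂) (hB : IsNormal B R) :
    ∃ (eP : C.FunctorMeets (IsFace.erase j.2) P₁ P₂) (eR : C.FunctorMeets (IsFace.erase j.2) R₁ R₂)
      (π : C.opFunctor (IsFace.erase j.2) P₁ P₂ eP ≅ P)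
      (ρ : C.opFunctor (IsFace.erase j.2) R₁ R₂ eR ≅ R)
      (_ : IsMerge K hP eP π) (_ : IsMerge K hR eR ρ) (a : IsoMeets (IsFace.erase i.2) π ρ),
      μ = K.interFunctor hij (IsFace.erase i.2) (IsFace.erase j.2) P₁ R₁ P₂ R₂ e₁ e₂ eP eR ≪≫
        C.opIso (IsFace.erase i.2) π ρ (opFunctor_meets_opFunctor hij.symm eP eR e₁ e₂) e₀ a := by
  obtain ⟨eP, eR, π, ρ, hπ, hρ, a, h⟩ := hμ.inter_inv_aux hl hm₀ hij hs hs₁ hs₂ hP hR hA₁ hA₂ hA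
    hB₁ hB₂ hB e₁ e₂ e₀ rfl rfl rfl
  exact ⟨eP, eR, π, ρ, hπ, hρ, a, eq_of_heq h⟩

theorem unique {hc : IsCut j m lo hi₁ lo₂ hi} {e : C.FunctorMeets (IsFace.erase j.2) F G}
    {μ μ' : C.opFunctor (IsFace.erase j.2) F G e ≅ H} (hμ : IsMerge K hc e μ)
    (hμ' : IsMerge K hc e μ') : μ = μ' := by
  induction hμ with
  | first hl hm hc hA hB e =>
    obtain ⟨_, rfl⟩ := hμ'.eq_of_first hl hm
    rfl
  | assoc hl hm₀ hlt hc hs hs' hr hA e₁ e₂ e hρ a ih =>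
    obtain ⟨⟨_, h₁⟩, _, ⟨_, h₂⟩⟩ := hρ.isNormal
    obtain ⟨_, ρ', hρ', _, rfl⟩ := hμ'.eq_of_assoc hl hm₀ hlt hs hA h₁ h₂
    obtain rfl := ih hρ'
    rfl
  | inter hl hm₀ hij hc hs hs₁ hs₂ hP hR e₁ e₂ eP eR e hπ hρ a ihπ ihρ =>
    obtain ⟨⟨_, h₁⟩, ⟨_, h₂⟩, ⟨_, h₃⟩⟩ := hπ.isNormal
    obtain ⟨⟨_, l₁⟩, ⟨_, l₂⟩, ⟨_, l₃⟩⟩ := hρ.isNormal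
    obtain ⟨_, _, π', ρ', hπ', hρ', _, rfl⟩ :=
      hμ'.eq_of_inter hl hm₀ hij hs hs₁ hs₂ hP hR h₁ h₂ h₃ l₁ l₂ l₃
    obtain rfl := ihπ hπ'
    obtain rfl := ihρ hρ'
    rfl

end IsMerge

section

variable {n : ℕ} {C : CubeCompositions.{v, u} n} {K : CubeConstraints C} {S : Finset (Fin n)}
  {p : S → ℕ}

theorem IsCut.lower_apply_of_ne {i j : S} {m : ℕ} {lo hi₁ lo₂ hi : S → ℕ}
    (hc : IsCut j m lo hi₁ lo₂ hi) (hij : i ≠ j) : lo₂ i = lo i := by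
  rw [hc.right_eq]; simp [hij]

/-- The normal forms of the two parts of a box can be merged. By uniqueness of normal forms it does
not matter which hyperplane cuts the box. -/
theorem IsNormal.exists_isMerge (K : CubeConstraints C) {lo hi hi₁ lo₂ : S → ℕ} {j : S} {m : ℕ}
    {F G H : Grid C.toCubeFaces S p ⥤ C.Mor S} {D : Bracketing S lo hi} (hD : IsNormal D H)
    (hc : IsCut j m lo hi₁ lo₂ hi)
    {A : Bracketing S lo hi₁} {B : Bracketing S lo₂ hi} (hA : IsNormal A F) (hB : IsNormal B G)
    (e : C.FunctorMeets (IsFace.erase j.2) F G) :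
    ∃ μ : C.opFunctor (IsFace.erase j.2) F G e ≅ H, IsMerge K hc e μ := by
  induction hD generalizing j m hi₁ lo₂ F G with
  | block h hlo =>
    have := h j; have := hc.lower; have := hc.upper
    omega
  | @cut lo s t hi i m₀ hl hm₀ hs D₁ D₂ P R hP hR e' ihP ihR =>
    by_cases hij : i = j
    · subst hij
      by_cases hm : m = lo i + 1
      · obtain rfl := hm₀.trans hm.symm
        obtain ⟨rfl, rfl⟩ := hc.unique hs
        obtain rfl := hP.functor_unique hA
        obtain rfl := hR.functor_unique hB
        exact ⟨_, IsMerge.first hl hm hc hA hB e⟩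
      · have hlt : m₀ < m := by have := hc.lower; omega
        obtain ⟨ks, kr⟩ := hc.parallel hs hlt
        obtain ⟨A₁, A₂, P', R', e₁, h₁, h₂, rfl, rfl⟩ :=
          hA.cut_inv (hl.left_of_lt hc (hm₀ ▸ hlt)) hm₀ ks
        obtain rfl := hP.functor_unique h₁
        have e₂ := (h₂.meets hB kr.isAdjacent).1
        obtain ⟨ρ, hρ⟩ := ihR kr h₂ hB e₂
        exact ⟨_, IsMerge.assoc hl hm₀ hlt hc hs ks kr hP e₁ e₂ e' hρ (hρ.refl_isoMeets e₁)⟩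
    · have hij' : (i : Fin n) ≠ j := fun h => hij (Subtype.ext h)
      obtain ⟨s₁, t₂, hs₁, hs₂, hcP, hcR⟩ := hc.cross hs hij
      obtain ⟨A₁, A₂, P₁, R₁, e₁, h₁, l₁, rfl, rfl⟩ := hA.cut_inv (hl.left_of_ne hc hij) hm₀ hs₁
      obtain ⟨B₁, B₂, P₂, R₂, e₂, h₂, l₂, rfl, rfl⟩ := hB.cut_inv (hl.right_of_ne hc hij)
        (by rw [hm₀, hc.lower_apply_of_ne hij]) hs₂
      have eP := (h₁.meets h₂ hcP.isAdjacent).1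
      have eR := (l₁.meets l₂ hcR.isAdjacent).1
      obtain ⟨π, hπ⟩ := ihP hcP h₁ h₂ eP
      obtain ⟨ρ, hρ⟩ := ihR hcR l₁ l₂ eR
      exact ⟨_, IsMerge.inter hl hm₀ hij' hc hs hs₁ hs₂ hcP hcR e₁ e₂ eP eR e' hπ hρ
        (hπ.isoMeets hρ hs.isAdjacent rfl rfl (Ne.symm hij))⟩

/-- Merging three normal forms along parallel cuts is compatible with the associator. -/
theorem IsNormal.assoc_square (hK : K.Coherent) {a b c d f g : S → ℕ} {i : S} {m m' : ℕ}
    {D : Bracketing S a g} {F G H FG GH N : Grid C.toCubeFaces S p ⥤ C.Mor S}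
    (hD : IsNormal D N)
    {h₁ : IsCut i m a b c d} {h₁₂ : IsCut i m' a d f g}
    {h₂ : IsCut i m' c d f g} {h₂₁ : IsCut i m a b c g}
    {e₁ : C.FunctorMeets (IsFace.erase i.2) F G} {e₂ : C.FunctorMeets (IsFace.erase i.2) G H}
    {e₁₂ : C.FunctorMeets (IsFace.erase i.2) FG H} {e₂₁ : C.FunctorMeets (IsFace.erase i.2) F GH}
    {μ₁ : C.opFunctor (IsFace.erase i.2) F G e₁ ≅ FG}
    {μ₁₂ : C.opFunctor (IsFace.erase i.2) FG H e₁₂ ≅ N}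
    {μ₂ : C.opFunctor (IsFace.erase i.2) G H e₂ ≅ GH}
    {μ₂₁ : C.opFunctor (IsFace.erase i.2) F GH e₂₁ ≅ N}
    (hμ₁ : IsMerge K h₁ e₁ μ₁) (hμ₁₂ : IsMerge K h₁₂ e₁₂ μ₁₂) (hμ₂ : IsMerge K h₂ e₂ μ₂)
    (hμ₂₁ : IsMerge K h₂₁ e₂₁ μ₂₁)
    (a₁ : IsoMeets (IsFace.erase i.2) μ₁ (Iso.refl H))
    (a₂ : IsoMeets (IsFace.erase i.2) (Iso.refl F) μ₂) :
    C.opIso (IsFace.erase i.2) μ₁ (Iso.refl H) (opFunctor_meets e₁ e₂) e₁₂ a₁ ≪≫ μ₁₂ =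
      K.assocFunctor (IsFace.erase i.2) F G H e₁ e₂ ≪≫
        C.opIso (IsFace.erase i.2) (Iso.refl F) μ₂ (meets_opFunctor e₁ e₂) e₂₁ a₂ ≪≫ μ₂₁ := by
  induction hD generalizing i m m' b c d f F G H FG GH with
  | block h hlo =>
    have := h i; have := h₁₂.lower; have := h₁₂.upper
    omega
  | @cut a s t g l m₀ hl hm₀ hs D₁ D₂ P R hP hR e ihP ihR =>
    obtain ⟨⟨_, nF⟩, ⟨_, nG⟩, ⟨_, nFG⟩⟩ := hμ₁.isNormal
    obtain ⟨-, ⟨_, nH⟩, ⟨_, nGH⟩⟩ := hμ₂.isNormal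
    have hmm : m < m' := by have := h₁.upper; rw [h₁₂.left_eq] at this; simpa using this
    by_cases hli : l = i
    · subst hli
      have hld : IsLead l a d := hl.left_of_lt h₁₂ (by have := h₁.lower; omega)
      by_cases hm : m = a l + 1
      -- The cut at `m` splits off the first slice: `μ₁` and `μ₂₁` are identities, and `μ₁₂` is by
      -- definition the associator followed by `μ₂`.
      · obtain rfl := hm₀.trans hm.symm
        obtain ⟨rfl, rfl⟩ := h₂₁.unique hs
        obtain ⟨rfl, rfl⟩ := hμ₁.eq_of_first hld hm
        obtain rfl := nF.functor_unique hP
        obtain rfl := nGH.functor_unique hR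
        obtain ⟨_, rfl⟩ := hμ₂₁.eq_of_first hl hm
        obtain ⟨_, ρ, hρ, _, rfl⟩ := hμ₁₂.eq_of_assoc hl hm hmm h₂₁ nF nG nGH
        obtain rfl := hρ.unique hμ₂
        simp only [eqToIso_refl, Iso.trans_refl]
        rw [opIso_refl, Iso.refl_trans]
      -- The first slice is a proper part of the first box; the pentagon moves it out.
      · have hlt : m₀ < m := by have := h₁.lower; omega
        obtain ⟨ks, kr⟩ := h₁₂.parallel hs (hlt.trans hmm)
        obtain ⟨ks', kr'⟩ := h₂₁.parallel hs hlt
        obtain ⟨_, _, P', F', eP, nP', nF', rfl, rfl⟩ :=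
          nF.cut_inv (hl.left_of_lt h₂₁ (hm₀ ▸ hlt)) hm₀ ks'
        obtain rfl := hP.functor_unique nP'
        obtain ⟨_, _, P', FG', eFG, nP', nFG', rfl, rfl⟩ := nFG.cut_inv hld hm₀ ks
        obtain rfl := hP.functor_unique nP'
        obtain ⟨e₁', ρ₁, hρ₁, b₁, rfl⟩ := hμ₁.eq_of_assoc hld hm₀ hlt ks hP nF' nFG'
        obtain ⟨e₁₂', ρ₁₂, hρ₁₂, b₁₂, rfl⟩ :=
          hμ₁₂.eq_of_assoc hl hm₀ (hlt.trans hmm) hs hP nFG' hR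
        obtain ⟨e₂₁', ρ₂₁, hρ₂₁, b₂₁, rfl⟩ := hμ₂₁.eq_of_assoc hl hm₀ hlt hs hP nF' hR
        exact hK.assoc_merge_assoc eP e₁' e₂ eFG e₁₂' e₂₁' e ρ₁ ρ₁₂ μ₂ ρ₂₁ b₁
          (hρ₁.isoMeets_refl e₂) b₁₂ (hμ₂.refl_isoMeets e₁') b₂₁ (ihR hρ₁ hρ₁₂ hμ₂ hρ₂₁ _ _) a₁ a₂
    -- The first slice is transverse to both cuts, and each of the three boxes is cut in two by it.
    · have hli' : (l : Fin n) ≠ i := fun h => hli (Subtype.ext h)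
      obtain ⟨s₁, t₂, hs₁, hs₂, hcP, hcR⟩ := h₂₁.cross hs hli
      obtain ⟨s₁₂, t₃, hs₁₂, hs₃, hcP', hcR'⟩ := h₁₂.cross hs hli
      obtain ⟨s', t', hs₁', ks₂, kcP, kcR⟩ := h₁.cross hs₁₂ hli
      obtain ⟨rfl, -⟩ := hs₁.unique hs₁'
      obtain ⟨s'', t'', ks₂', ks₃, kcP', kcR'⟩ := h₂.cross hs₂ hli
      obtain ⟨rfl, rfl⟩ := ks₂.unique ks₂'
      obtain ⟨-, rfl⟩ := hs₃.unique ks₃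
      have hc₀ : m₀ = c l + 1 := by rw [hm₀, h₁.lower_apply_of_ne hli]
      have hf₀ : m₀ = f l + 1 := by rw [hm₀, h₁₂.lower_apply_of_ne hli]
      have l₁₂ := hl.left_of_ne h₁₂ hli
      have l₂₃ := hl.right_of_ne h₂₁ hli
      obtain ⟨_, _, P₁, R₁, e₁', p₁, r₁, rfl, rfl⟩ :=
        nF.cut_inv (hl.left_of_ne h₂₁ hli) hm₀ hs₁
      obtain ⟨_, _, P₂, R₂, e₂', p₂, r₂, rfl, rfl⟩ :=
        nG.cut_inv (l₁₂.right_of_ne h₁ hli) hc₀ ks₂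
      obtain ⟨_, _, P₃, R₃, e₃', p₃, r₃, rfl, rfl⟩ :=
        nH.cut_inv (hl.right_of_ne h₁₂ hli) hf₀ hs₃
      obtain ⟨_, _, P₁₂, R₁₂, e₁₂', p₁₂, r₁₂, rfl, rfl⟩ := nFG.cut_inv l₁₂ hm₀ hs₁₂
      obtain ⟨_, _, P₂₃, R₂₃, e₂₃', p₂₃, r₂₃, rfl, rfl⟩ := nGH.cut_inv l₂₃ hc₀ hs₂
      obtain ⟨eP₁, eR₁, π₁, ρ₁, hπ₁, hρ₁, b₁, rfl⟩ :=
        hμ₁.eq_of_inter l₁₂ hm₀ hli' hs₁₂ hs₁ ks₂ kcP kcR p₁ p₂ p₁₂ r₁ r₂ r₁₂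
      obtain ⟨eP₂, eR₂, π₂, ρ₂, hπ₂, hρ₂, b₂, rfl⟩ :=
        hμ₂.eq_of_inter l₂₃ hc₀ hli' hs₂ ks₂ hs₃ kcP' kcR' p₂ p₃ p₂₃ r₂ r₃ r₂₃
      obtain ⟨eP₁₂, eR₁₂, π₁₂, ρ₁₂, hπ₁₂, hρ₁₂, b₁₂, rfl⟩ :=
        hμ₁₂.eq_of_inter hl hm₀ hli' hs hs₁₂ hs₃ hcP' hcR' p₁₂ p₃ hP r₁₂ r₃ hR
      obtain ⟨eP₂₃, eR₂₃, π₂₃, ρ₂₃, hπ₂₃, hρ₂₃, b₂₃, rfl⟩ :=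
        hμ₂₁.eq_of_inter hl hm₀ hli' hs hs₁ hs₂ hcP hcR p₁ p₂₃ hP r₁ r₂₃ hR
      exact hK.assoc_merge_inter hli' e₁' e₂' e₃' e₁₂' e₂₃' e eP₁ eP₂ eP₁₂ eP₂₃ eR₁ eR₂ eR₁₂ eR₂₃
        π₁ π₂ π₁₂ π₂₃ ρ₁ ρ₂ ρ₁₂ ρ₂₃ b₁ b₂ b₁₂ b₂₃ (hπ₁.isoMeets_refl eP₂) (hρ₁.isoMeets_refl eR₂)
        (hπ₂.refl_isoMeets eP₁) (hρ₂.refl_isoMeets eR₁) (ihP hπ₁ hπ₁₂ hπ₂ hπ₂₃ _ _)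
        (ihR hρ₁ hρ₁₂ hρ₂ hρ₂₃ _ _) a₁ a₂

/-- Merging four normal forms along two crossing cuts is compatible with the interchanger from the
smaller to the larger direction. The leading direction of the box is then different from the larger
direction `j`, which leaves two cases instead of three. -/
theorem IsNormal.inter_square_of_lt (hK : K.Coherent) {a b c d a' b' c' d' : S → ℕ} {i j : S}
    {m m' : ℕ} {D : Bracketing S a d'}
    {F G F' G' FG FG' FF' GG' N : Grid C.toCubeFaces S p ⥤ C.Mor S} (hD : IsNormal D N)
    (hlt : i < j) (hij : (i : Fin n) ≠ j)
    {h₁ : IsCut i m a b c d} {h₁' : IsCut i m a' b' c' d'} {h₂ : IsCut j m' a d a' d'}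
    {k₁ : IsCut j m' a b a' b'} {k₁' : IsCut j m' c d c' d'} {k₂ : IsCut i m a b' c d'}
    {e : C.FunctorMeets (IsFace.erase i.2) F G} {e' : C.FunctorMeets (IsFace.erase i.2) F' G'}
    {eF : C.FunctorMeets (IsFace.erase j.2) F F'} {eG : C.FunctorMeets (IsFace.erase j.2) G G'}
    {f : C.FunctorMeets (IsFace.erase j.2) FG FG'} {g : C.FunctorMeets (IsFace.erase i.2) FF' GG'}
    {μ : C.opFunctor (IsFace.erase i.2) F G e ≅ FG}
    {μ' : C.opFunctor (IsFace.erase i.2) F' G' e' ≅ FG'}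
    {ν : C.opFunctor (IsFace.erase j.2) FG FG' f ≅ N}
    {κ : C.opFunctor (IsFace.erase j.2) F F' eF ≅ FF'}
    {κ' : C.opFunctor (IsFace.erase j.2) G G' eG ≅ GG'}
    {ξ : C.opFunctor (IsFace.erase i.2) FF' GG' g ≅ N}
    (hμ : IsMerge K h₁ e μ) (hμ' : IsMerge K h₁' e' μ') (hν : IsMerge K h₂ f ν)
    (hκ : IsMerge K k₁ eF κ) (hκ' : IsMerge K k₁' eG κ') (hξ : IsMerge K k₂ g ξ)
    (x : IsoMeets (IsFace.erase j.2) μ μ') (y : IsoMeets (IsFace.erase i.2) κ κ') :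
    C.opIso (IsFace.erase j.2) μ μ' (opFunctor_meets_opFunctor hij e e' eF eG) f x ≪≫ ν =
      K.interFunctor hij (IsFace.erase i.2) (IsFace.erase j.2) F G F' G' e e' eF eG ≪≫
        C.opIso (IsFace.erase i.2) κ κ' (opFunctor_meets_opFunctor hij.symm eF eG e e') g y ≪≫
          ξ := by
  induction hD generalizing i j m m' b c d a' b' c' F G F' G' FG FG' FF' GG' with
  | block h hlo =>
    have := h i; have := k₂.lower; have := k₂.upper
    omega
  | @cut a s t d' l m₀ hl hm₀ hs D₁ D₂ P R hP hR z ihP ihR =>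
    obtain ⟨⟨_, nF⟩, ⟨_, nG⟩, ⟨_, nFG⟩⟩ := hμ.isNormal
    obtain ⟨⟨_, nF'⟩, ⟨_, nG'⟩, ⟨_, nFG'⟩⟩ := hμ'.isNormal
    obtain ⟨⟨_, nFF'⟩, ⟨_, nGG'⟩, -⟩ := hξ.isNormal
    have hlj : l ≠ j := ((hl.le_of_isCut k₂).trans_lt hlt).ne
    have lad := hl.left_of_ne h₂ hlj
    have lad' := hl.right_of_ne h₂ hlj
    have ha₀ : m₀ = a' l + 1 := by rw [hm₀, h₂.lower_apply_of_ne hlj]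
    by_cases hli : l = i
    · subst hli
      by_cases hm : m = a l + 1
      -- The cut at `m` splits off the first slice: `μ`, `μ'` and `ξ` are identities, and `ν` is by
      -- definition the interchanger followed by `κ` and `κ'`.
      · obtain rfl := hm₀.trans hm.symm
        obtain ⟨rfl, rfl⟩ := k₂.unique hs
        obtain ⟨rfl, rfl⟩ := hμ.eq_of_first lad hm
        obtain ⟨rfl, rfl⟩ := hμ'.eq_of_first lad' ha₀
        obtain rfl := nFF'.functor_unique hP
        obtain rfl := nGG'.functor_unique hR
        obtain ⟨_, rfl⟩ := hξ.eq_of_first hl hm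
        obtain ⟨_, _, π, ρ, hπ, hρ, _, rfl⟩ :=
          hν.eq_of_inter hl hm hij k₂ h₁ h₁' k₁ k₁' nF nF' nFF' nG nG' nGG'
        obtain rfl := hπ.unique hκ
        obtain rfl := hρ.unique hκ'
        simp only [eqToIso_refl, Iso.trans_refl]
        rw [opIso_refl, Iso.refl_trans]
      -- The first slice is a proper part of the boxes of `F` and `F'`.
      · have hlt' : m₀ < m := by have := k₂.lower; omega
        obtain ⟨ks₂, kr₂⟩ := k₂.parallel hs hlt'
        obtain ⟨s₁, t₂, hs₁, hs₂, hcP, hcR⟩ := h₂.cross hs hlj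
        obtain ⟨kb, kr₁⟩ := h₁.parallel hs₁ hlt'
        obtain ⟨kb', kr₁'⟩ := h₁'.parallel hs₂ hlt'
        obtain ⟨s₁', t₂', j₁, j₂, kcP, kcR⟩ := k₁.cross ks₂ hlj
        obtain ⟨rfl, -⟩ := j₁.unique kb
        obtain ⟨-, rfl⟩ := j₂.unique kb'
        have lab' := hl.left_of_lt k₂ (hm₀ ▸ hlt')
        obtain ⟨_, _, P₁, F₀, u₁, nP₁, nF₀, rfl, rfl⟩ :=
          nF.cut_inv (lab'.left_of_ne k₁ hlj) hm₀ kb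
        obtain ⟨_, _, P₂, F₀', u₂, nP₂, nF₀', rfl, rfl⟩ :=
          nF'.cut_inv (lab'.right_of_ne k₁ hlj) ha₀ kb'
        obtain ⟨_, _, P₁', FG₀, v₁, nP₁', nFG₀, rfl, rfl⟩ := nFG.cut_inv lad hm₀ hs₁
        obtain rfl := nP₁.functor_unique nP₁'
        obtain ⟨_, _, P₂', FG₀', v₂, nP₂', nFG₀', rfl, rfl⟩ := nFG'.cut_inv lad' ha₀ hs₂
        obtain rfl := nP₂.functor_unique nP₂'
        obtain ⟨_, _, P', FF₀, z₁, nP', nFF₀, rfl, rfl⟩ := nFF'.cut_inv lab' hm₀ ks₂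
        obtain rfl := hP.functor_unique nP'
        obtain ⟨e₀, μ₀, hμ₀, a₁, rfl⟩ := hμ.eq_of_assoc lad hm₀ hlt' hs₁ nP₁ nF₀ nFG₀
        obtain ⟨e₀', μ₀', hμ₀', a₂, rfl⟩ := hμ'.eq_of_assoc lad' ha₀ hlt' hs₂ nP₂ nF₀' nFG₀'
        obtain ⟨w, ξ₀, hξ₀, a₆, rfl⟩ := hξ.eq_of_assoc hl hm₀ hlt' hs hP nFF₀ hR
        obtain ⟨sP, eF₀, π, κ₀, hπ, hκ₀, a₃, rfl⟩ :=
          hκ.eq_of_inter lab' hm₀ hij ks₂ kb kb' kcP kcR nP₁ nP₂ hP nF₀ nF₀' nFF₀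
        obtain ⟨_, eFG, π', ν₀, hπ', hν₀, a₄, rfl⟩ :=
          hν.eq_of_inter hl hm₀ hij hs hs₁ hs₂ hcP hcR nP₁ nP₂ hP nFG₀ nFG₀' hR
        obtain rfl := hπ.unique hπ'
        exact hK.inter_merge_assoc hij u₁ u₂ e₀ e₀' v₁ v₂ w z₁ z sP eF₀ eG eFG μ₀ μ₀' π κ₀ κ' ν₀ ξ₀
          a₁ a₂ a₃ a₄ (hκ₀.isoMeets hκ' kr₂.isAdjacent rfl rfl hlj.symm) a₆
          (hμ₀.isoMeets hμ₀' hcR.isAdjacent rfl rfl hlj)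
          (ihR hlt hij hμ₀ hμ₀' hν₀ hκ₀ hκ' hξ₀ _ _) x y
    -- The first slice lies in a third direction, and each of the four boxes is cut in two by it.
    · have hli' : (l : Fin n) ≠ i := fun h => hli (Subtype.ext h)
      have hlj' : (l : Fin n) ≠ j := fun h => hlj (Subtype.ext h)
      obtain ⟨sb', tc, A₁, A₂, PA, RA⟩ := k₂.cross hs hli
      obtain ⟨sd, ta', B₁, B₂, PB, RB⟩ := h₂.cross hs hlj
      obtain ⟨sb, ta'', C₁, C₂, PC, RC⟩ := k₁.cross A₁ hlj
      obtain ⟨sd', tc', D₁, D₂, PD, RD⟩ := k₁'.cross A₂ hlj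
      obtain ⟨sb₀, tc₀, E₁, E₂, PE, RE⟩ := h₁.cross B₁ hli
      obtain ⟨sb₁, tc₁, F₁, F₂, PF, RF⟩ := h₁'.cross B₂ hli
      obtain ⟨rfl, rfl⟩ := F₁.unique C₂
      obtain ⟨rfl, -⟩ := E₁.unique C₁
      obtain ⟨rfl, rfl⟩ := E₂.unique D₁
      obtain ⟨-, rfl⟩ := F₂.unique D₂
      have hc₀ : m₀ = c l + 1 := by rw [hm₀, k₂.lower_apply_of_ne hli]
      have hc₀' : m₀ = c' l + 1 := by rw [hc₀, k₁'.lower_apply_of_ne hlj]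
      have lab' := hl.left_of_ne k₂ hli
      have lcd' := hl.right_of_ne k₂ hli
      obtain ⟨_, _, P₁, R₁, e₁, p₁, r₁, rfl, rfl⟩ := nF.cut_inv (lab'.left_of_ne k₁ hlj) hm₀ C₁
      obtain ⟨_, _, P₂, R₂, e₂, p₂, r₂, rfl, rfl⟩ := nG.cut_inv (lcd'.left_of_ne k₁' hlj) hc₀ D₁
      obtain ⟨_, _, P₃, R₃, e₃, p₃, r₃, rfl, rfl⟩ := nF'.cut_inv (lab'.right_of_ne k₁ hlj) ha₀ C₂
      obtain ⟨_, _, P₄, R₄, e₄, p₄, r₄, rfl, rfl⟩ :=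
        nG'.cut_inv (lcd'.right_of_ne k₁' hlj) hc₀' D₂
      obtain ⟨_, _, P₁₂, R₁₂, e₁₂, p₁₂, r₁₂, rfl, rfl⟩ := nFG.cut_inv lad hm₀ B₁
      obtain ⟨_, _, P₃₄, R₃₄, e₃₄, p₃₄, r₃₄, rfl, rfl⟩ := nFG'.cut_inv lad' ha₀ B₂
      obtain ⟨_, _, P₁₃, R₁₃, e₁₃, p₁₃, r₁₃, rfl, rfl⟩ := nFF'.cut_inv lab' hm₀ A₁
      obtain ⟨_, _, P₂₄, R₂₄, e₂₄, p₂₄, r₂₄, rfl, rfl⟩ := nGG'.cut_inv lcd' hc₀ A₂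
      obtain ⟨u₁, v₁, μP, μR, hμP, hμR, b₁, rfl⟩ :=
        hμ.eq_of_inter lad hm₀ hli' B₁ C₁ D₁ PE RE p₁ p₂ p₁₂ r₁ r₂ r₁₂
      obtain ⟨u₂, v₂, μP', μR', hμP', hμR', b₂, rfl⟩ :=
        hμ'.eq_of_inter lad' ha₀ hli' B₂ C₂ D₂ PF RF p₃ p₄ p₃₄ r₃ r₄ r₃₄
      obtain ⟨u₃, v₃, νP, νR, hνP, hνR, b₃, rfl⟩ :=
        hν.eq_of_inter hl hm₀ hlj' hs B₁ B₂ PB RB p₁₂ p₃₄ hP r₁₂ r₃₄ hR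
      obtain ⟨u₄, v₄, κP, κR, hκP, hκR, b₄, rfl⟩ :=
        hκ.eq_of_inter lab' hm₀ hlj' A₁ C₁ C₂ PC RC p₁ p₃ p₁₃ r₁ r₃ r₁₃
      obtain ⟨u₅, v₅, κP', κR', hκP', hκR', b₅, rfl⟩ :=
        hκ'.eq_of_inter lcd' hc₀ hlj' A₂ D₁ D₂ PD RD p₂ p₄ p₂₄ r₂ r₄ r₂₄
      obtain ⟨u₆, v₆, ξP, ξR, hξP, hξR, b₆, rfl⟩ :=
        hξ.eq_of_inter hl hm₀ hli' hs A₁ A₂ PA RA p₁₃ p₂₄ hP r₁₃ r₂₄ hR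
      have hji := hlt.ne'
      exact hK.inter_merge_inter hli' hlj' hij e₁ e₂ e₃ e₄ e₁₂ e₃₄ e₁₃ e₂₄ z u₁ u₂ u₆ u₄ u₅ u₃
        μP μP' νP κP κP' ξP v₁ v₂ v₆ v₄ v₅ v₃ μR μR' νR κR κR' ξR b₁ b₂ b₄ b₅ b₃ b₆
        (hμP.isoMeets hμP' PB.isAdjacent rfl rfl hlt.ne)
        (hμR.isoMeets hμR' RB.isAdjacent rfl rfl hlt.ne)
        (hκP.isoMeets hκP' PA.isAdjacent rfl rfl hji)
        (hκR.isoMeets hκR' RA.isAdjacent rfl rfl hji)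
        (ihP hlt hij hμP hμP' hνP hκP hκP' hξP _ _) (ihR hlt hij hμR hμR' hνR hκR hκR' hξR _ _) x y

/-- Merging four normal forms along two crossing cuts is compatible with the interchanger. -/
theorem IsNormal.inter_square (hK : K.Coherent) {a b c d a' b' c' d' : S → ℕ} {i j : S}
    {m m' : ℕ} {D : Bracketing S a d'}
    {F G F' G' FG FG' FF' GG' N : Grid C.toCubeFaces S p ⥤ C.Mor S} (hD : IsNormal D N)
    (hij : (i : Fin n) ≠ j)
    {h₁ : IsCut i m a b c d} {h₁' : IsCut i m a' b' c' d'} {h₂ : IsCut j m' a d a' d'}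
    {k₁ : IsCut j m' a b a' b'} {k₁' : IsCut j m' c d c' d'} {k₂ : IsCut i m a b' c d'}
    {e : C.FunctorMeets (IsFace.erase i.2) F G} {e' : C.FunctorMeets (IsFace.erase i.2) F' G'}
    {eF : C.FunctorMeets (IsFace.erase j.2) F F'} {eG : C.FunctorMeets (IsFace.erase j.2) G G'}
    {f : C.FunctorMeets (IsFace.erase j.2) FG FG'} {g : C.FunctorMeets (IsFace.erase i.2) FF' GG'}
    {μ : C.opFunctor (IsFace.erase i.2) F G e ≅ FG}
    {μ' : C.opFunctor (IsFace.erase i.2) F' G' e' ≅ FG'}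
    {ν : C.opFunctor (IsFace.erase j.2) FG FG' f ≅ N}
    {κ : C.opFunctor (IsFace.erase j.2) F F' eF ≅ FF'}
    {κ' : C.opFunctor (IsFace.erase j.2) G G' eG ≅ GG'}
    {ξ : C.opFunctor (IsFace.erase i.2) FF' GG' g ≅ N}
    (hμ : IsMerge K h₁ e μ) (hμ' : IsMerge K h₁' e' μ') (hν : IsMerge K h₂ f ν)
    (hκ : IsMerge K k₁ eF κ) (hκ' : IsMerge K k₁' eG κ') (hξ : IsMerge K k₂ g ξ)
    (x : IsoMeets (IsFace.erase j.2) μ μ') (y : IsoMeets (IsFace.erase i.2) κ κ') :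
    C.opIso (IsFace.erase j.2) μ μ' (opFunctor_meets_opFunctor hij e e' eF eG) f x ≪≫ ν =
      K.interFunctor hij (IsFace.erase i.2) (IsFace.erase j.2) F G F' G' e e' eF eG ≪≫
        C.opIso (IsFace.erase i.2) κ κ' (opFunctor_meets_opFunctor hij.symm eF eG e e') g y ≪≫
          ξ := by
  rcases lt_trichotomy i j with hlt | rfl | hlt
  · exact hD.inter_square_of_lt hK hlt hij hμ hμ' hν hκ hκ' hξ x y
  · exact (hij rfl).elim
  -- The interchanger in the other order is the inverse.
  · have w := hD.inter_square_of_lt hK hlt hij.symm hκ hκ' hξ hμ hμ' hν y x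
    rw [w, K.interFunctor_symm hij e e' eF eG, Iso.self_symm_id_assoc]

end

/-! ### Canonical isomorphisms to normal forms -/

/-- `IsCanonical K A φ`: the bracketing `A` defines the source of `φ`, and `φ` is the canonical
isomorphism from it to the normal form of the box of `A`. It is obtained by taking the two parts of
`A` to their normal forms and merging these. -/
inductive IsCanonical {n : ℕ} {C : CubeCompositions.{v, u} n} (K : CubeConstraints C)
    {S : Finset (Fin n)} {p : S → ℕ} :
    ∀ {lo hi : S → ℕ}, Bracketing S lo hi →
      ∀ {F N : Grid C.toCubeFaces S p ⥤ C.Mor S}, (F ≅ N) → Prop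
  | block {lo hi : S → ℕ} (h : ∀ i, hi i = lo i + 1) (hlo : ∀ i, lo i < p i) :
      IsCanonical K (Bracketing.block lo hi h) (Iso.refl (Grid.proj ⟨lo, hlo⟩))
  | cut {lo hi₁ lo₂ hi : S → ℕ} {i : S} {m : ℕ} (hc : IsCut i m lo hi₁ lo₂ hi)
      {A : Bracketing S lo hi₁} {B : Bracketing S lo₂ hi}
      {F G F' G' N : Grid C.toCubeFaces S p ⥤ C.Mor S} {φ : F ≅ F'} {ψ : G ≅ G'}
      (hA : IsCanonical K A φ) (hB : IsCanonical K B ψ) (a : IsoMeets (IsFace.erase i.2) φ ψ)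
      (e : C.FunctorMeets (IsFace.erase i.2) F G) (e' : C.FunctorMeets (IsFace.erase i.2) F' G')
      {μ : C.opFunctor (IsFace.erase i.2) F' G' e' ≅ N} (hμ : IsMerge K hc e' μ) :
      IsCanonical K (Bracketing.cut i m hc A B) (C.opIso (IsFace.erase i.2) φ ψ e e' a ≪≫ μ)

section

variable {n : ℕ} {C : CubeCompositions.{v, u} n} {K : CubeConstraints C} {S : Finset (Fin n)}
  {p : S → ℕ} {lo hi₁ lo₂ hi lo' hi' : S → ℕ} {i : S} {m : ℕ}
  {F G F' G' H N N' : Grid C.toCubeFaces S p ⥤ C.Mor S}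

namespace IsMerge

/-- The canonical isomorphism of `A ∘ᵢ B` restricts on the source in the direction `i` to that of
`A`. -/
theorem src_opIso_trans {hc : IsCut i m lo hi₁ lo₂ hi}
    {e' : C.FunctorMeets (IsFace.erase i.2) F' G'}
    {μ : C.opFunctor (IsFace.erase i.2) F' G' e' ≅ N} (hμ : IsMerge K hc e' μ) {φ : F ≅ F'}
    {ψ : G ≅ G'} (e : C.FunctorMeets (IsFace.erase i.2) F G)
    (a : IsoMeets (IsFace.erase i.2) φ ψ) (x : Grid C.toCubeFaces S p) :
    SameArrow ((C.src (IsFace.erase i.2)).map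
        ((C.opIso (IsFace.erase i.2) φ ψ e e' a ≪≫ μ).hom.app x))
      ((C.src (IsFace.erase i.2)).map (φ.hom.app x)) := by
  simp only [Iso.trans_hom, NatTrans.comp_app, Functor.map_comp]
  exact (src_opIso e e' a x).comp_id (hμ.src_app x)

/-- The canonical isomorphism of `A ∘ᵢ B` restricts on the target in the direction `i` to that of
`B`. -/
theorem tgt_opIso_trans {hc : IsCut i m lo hi₁ lo₂ hi}
    {e' : C.FunctorMeets (IsFace.erase i.2) F' G'}
    {μ : C.opFunctor (IsFace.erase i.2) F' G' e' ≅ N} (hμ : IsMerge K hc e' μ) {φ : F ≅ F'}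
    {ψ : G ≅ G'} (e : C.FunctorMeets (IsFace.erase i.2) F G)
    (a : IsoMeets (IsFace.erase i.2) φ ψ) (x : Grid C.toCubeFaces S p) :
    SameArrow ((C.tgt (IsFace.erase i.2)).map
        ((C.opIso (IsFace.erase i.2) φ ψ e e' a ≪≫ μ).hom.app x))
      ((C.tgt (IsFace.erase i.2)).map (ψ.hom.app x)) := by
  simp only [Iso.trans_hom, NatTrans.comp_app, Functor.map_comp]
  exact (tgt_opIso e e' a x).comp_id (hμ.tgt_app x)

end IsMerge

theorem IsNormal.lo_lt_hi {A : Bracketing S lo hi} (hA : IsNormal A F) (k : S) : lo k < hi k := by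
  induction hA with
  | block h _ => have := h k; omega
  | @cut _ _ _ _ i _ _ _ hc _ _ _ _ _ _ _ ihA ihB =>
    by_cases hk : k = i
    · subst hk; exact hc.lower.trans hc.upper
    · rw [hc.left_eq] at ihA; simpa [hk] using ihA

theorem IsNormal.hi_le {A : Bracketing S lo hi} (hA : IsNormal A F) (k : S) : hi k ≤ p k := by
  induction hA with
  | block h hlo => have := h k; have := hlo k; omega
  | cut _ _ _ _ _ _ _ ihB => exact ihB

namespace IsCanonical

theorem isNormal {A : Bracketing S lo hi} {φ : F ≅ N} (hφ : IsCanonical K A φ) :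
    ∃ B : Bracketing S lo hi, IsNormal B N := by
  cases hφ with
  | block h hlo => exact ⟨_, IsNormal.block h hlo⟩
  | cut hc hA hB a e e' hμ => exact hμ.isNormal.2.2

theorem unique {A : Bracketing S lo hi} {φ : F ≅ N} {φ' : F' ≅ N'} (hφ : IsCanonical K A φ)
    (hφ' : IsCanonical K A φ') : F = F' ∧ N = N' ∧ HEq φ φ' := by
  induction hφ generalizing F' N' with
  | block h hlo => cases hφ' with | block => exact ⟨rfl, rfl, HEq.rfl⟩
  | cut hc hA hB a e e' hμ ihA ihB =>
    cases hφ' with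
    | cut _ hA' hB' a' k k' hμ' =>
      obtain ⟨rfl, rfl, h⟩ := ihA hA'
      obtain rfl := eq_of_heq h
      obtain ⟨rfl, rfl, h⟩ := ihB hB'
      obtain rfl := eq_of_heq h
      obtain ⟨-, -, ⟨_, hN⟩⟩ := hμ.isNormal
      obtain ⟨-, -, ⟨_, hN'⟩⟩ := hμ'.isNormal
      obtain rfl := hN.functor_unique hN'
      obtain rfl := hμ.unique hμ'
      exact ⟨rfl, rfl, HEq.rfl⟩

theorem exists_pieces {hc : IsCut i m lo hi₁ lo₂ hi} {A : Bracketing S lo hi₁}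
    {B : Bracketing S lo₂ hi} {χ : H ≅ N} (hχ : IsCanonical K (Bracketing.cut i m hc A B) χ) :
    ∃ (F F' G G' : Grid C.toCubeFaces S p ⥤ C.Mor S) (φ : F ≅ F') (ψ : G ≅ G'),
      IsCanonical K A φ ∧ IsCanonical K B ψ ∧ IsoMeets (IsFace.erase i.2) φ ψ := by
  cases hχ with
  | cut _ hA hB a => exact ⟨_, _, _, _, _, _, hA, hB, a⟩

/-- If a composite of two bracketings is defined, then their canonical isomorphisms are
composable. -/
theorem agree {hc : IsCut i m lo hi₁ lo₂ hi} {A : Bracketing S lo hi₁} {B : Bracketing S lo₂ hi}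
    {χ : H ≅ N} (hχ : IsCanonical K (Bracketing.cut i m hc A B) χ) {φ : F ≅ F'} {ψ : G ≅ G'}
    (hφ : IsCanonical K A φ) (hψ : IsCanonical K B ψ) : IsoMeets (IsFace.erase i.2) φ ψ := by
  obtain ⟨_, _, _, _, _, _, hφ', hψ', a⟩ := hχ.exists_pieces
  obtain ⟨rfl, rfl, h⟩ := hφ.unique hφ'
  obtain rfl := eq_of_heq h
  obtain ⟨rfl, rfl, h⟩ := hψ.unique hψ'
  obtain rfl := eq_of_heq h
  exact a

/-- The canonical isomorphisms of two bracketings whose formal faces match are composable. -/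
theorem isoMeets {d : S} {A : Bracketing S lo hi} {B : Bracketing S lo' hi'} {φ : F ≅ F'}
    {ψ : G ≅ G'} (hφ : IsCanonical K A φ) (hψ : IsCanonical K B ψ)
    (ha : IsAdjacent d lo hi lo' hi') (hs : A.tgtShape d = B.srcShape d) :
    IsoMeets (IsFace.erase d.2) φ ψ := by
  induction hφ generalizing lo' hi' G G' with
  | block h hlo =>
    induction hψ with
    | block h' hlo' =>
      exact IsoMeets.refl ((IsNormal.block h hlo).meets (IsNormal.block h' hlo') ha).1
    | @cut _ _ _ _ i' _ hc' _ _ _ _ _ _ _ _ _ hA hB a e e' _ hμ ihA ihB =>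
      by_cases hid : i' = d
      · subst hid
        exact fun x => SameArrow.trans
          (ihA (ha.right hc') (by simpa [Bracketing.srcShape] using hs) x)
          (hμ.src_opIso_trans e a x).symm
      · simp [Bracketing.srcShape, Bracketing.tgtShape, hid] at hs
  | @cut _ _ _ _ i _ hc _ _ _ _ _ _ _ _ _ hA hB a e e' _ hμ ihA ihB =>
    by_cases hid : i = d
    · subst hid
      exact fun x => (hμ.tgt_opIso_trans e a x).trans
        (ihB hψ (ha.left hc) (by simpa [Bracketing.tgtShape] using hs) x)
    · have hne : (i : Fin n) ≠ d := fun h => hid (Subtype.ext h)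
      induction hψ with
      | block h' hlo' => simp [Bracketing.srcShape, Bracketing.tgtShape, hid] at hs
      | @cut _ _ _ _ i' _ hc' _ _ _ _ _ _ _ _ _ hA' hB' a' k k' _ hμ' ihA' ihB' =>
        by_cases hid' : i' = d
        · subst hid'
          exact fun x => SameArrow.trans
            (ihA' (ha.right hc') (by simpa [Bracketing.srcShape] using hs) x)
            (hμ'.src_opIso_trans k a' x).symm
        · simp only [Bracketing.srcShape, Bracketing.tgtShape, hid, hid', if_false,
            FaceShape.cut.injEq] at hs
          obtain ⟨rfl, rfl, hsA, hsB⟩ := hs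
          obtain ⟨ha₁, ha₂⟩ := ha.both hc hc' hid
          exact (IsoMeets.opIso hne _ _ _ _ a a' (ihA hA' ha₁ hsA) (ihB hB' ha₂ hsB)).trans
            (hμ.isoMeets hμ' ha rfl rfl hid)

theorem exists_isMerge {A : Bracketing S lo hi₁} {B : Bracketing S lo₂ hi} {φ : F ≅ F'}
    {ψ : G ≅ G'} (hc : IsCut i m lo hi₁ lo₂ hi) (hφ : IsCanonical K A φ)
    (hψ : IsCanonical K B ψ) :
    ∃ (D : Bracketing S lo hi) (N : Grid C.toCubeFaces S p ⥤ C.Mor S)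
      (e' : C.FunctorMeets (IsFace.erase i.2) F' G')
      (μ : C.opFunctor (IsFace.erase i.2) F' G' e' ≅ N), IsNormal D N ∧ IsMerge K hc e' μ := by
  obtain ⟨_, nF⟩ := hφ.isNormal
  obtain ⟨_, nG⟩ := hψ.isNormal
  have e' := (nF.meets nG hc.isAdjacent).1
  have hlt : ∀ k, lo k < hi k := fun k => by
    by_cases hk : k = i
    · subst hk; exact hc.lower.trans hc.upper
    · have := nF.lo_lt_hi k
      rw [hc.left_eq] at this
      simpa [hk] using this
  obtain ⟨D, N, hD⟩ := IsNormal.exists_of_lt (C := C) p hlt nG.hi_le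
  obtain ⟨μ, hμ⟩ := hD.exists_isMerge K hc nF nG e'
  exact ⟨D, N, e', μ, hD, hμ⟩

/-- If the canonical isomorphisms of two bracketings are composable, then the composite bracketing
has a canonical isomorphism. -/
theorem exists_cut {A : Bracketing S lo hi₁} {B : Bracketing S lo₂ hi} {φ : F ≅ F'}
    {ψ : G ≅ G'} (hc : IsCut i m lo hi₁ lo₂ hi) (hφ : IsCanonical K A φ)
    (hψ : IsCanonical K B ψ) (a : IsoMeets (IsFace.erase i.2) φ ψ)
    (e : C.FunctorMeets (IsFace.erase i.2) F G) :
    ∃ (N : Grid C.toCubeFaces S p ⥤ C.Mor S) (χ : C.opFunctor (IsFace.erase i.2) F G e ≅ N),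
      IsCanonical K (Bracketing.cut i m hc A B) χ := by
  obtain ⟨_, N, e', μ, -, hμ⟩ := hφ.exists_isMerge hc hψ
  exact ⟨N, _, hφ.cut hc hψ a e e' hμ⟩

/-- A matching bracketing is defined: the canonical isomorphisms of its parts agree on the common
face, hence so do the functors. -/
theorem exists_of_matching (K : CubeConstraints C) {A : Bracketing S lo hi} (hA : A.Matching)
    (hp : ∀ k, hi k ≤ p k) :
    ∃ (F N : Grid C.toCubeFaces S p ⥤ C.Mor S) (φ : F ≅ N), IsCanonical K A φ := by
  induction A with
  | block lo hi h => exact ⟨_, _, _, .block h fun k => by have := h k; have := hp k; omega⟩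
  | cut i m hc A B ihA ihB =>
    obtain ⟨hA₁, hA₂, hs⟩ := hA
    obtain ⟨F, F', φ, hφ⟩ := ihA hA₁ fun k => by
      rw [hc.left_eq]
      by_cases hk : k = i
      · subst hk; simpa using hc.upper.le.trans (hp k)
      · simpa [hk] using hp k
    obtain ⟨G, G', ψ, hψ⟩ := ihB hA₂ hp
    obtain ⟨_, nF⟩ := hφ.isNormal
    obtain ⟨_, nG⟩ := hψ.isNormal
    have a := hφ.isoMeets hψ hc.isAdjacent hs
    have e := a.functorMeets (nF.meets nG hc.isAdjacent).1
    obtain ⟨N, χ, hχ⟩ := hφ.exists_cut hc hψ a e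
    exact ⟨_, N, χ, hχ⟩

end IsCanonical

/-! ### Canonical isomorphisms are built from associators and interchangers -/

/-- A composite with matching formal faces is defined. -/
theorem Realizes.cut_of_shape {hc : IsCut i m lo hi₁ lo₂ hi} {A : Bracketing S lo hi₁}
    {B : Bracketing S lo₂ hi} (hA : Realizes K A F) (hB : Realizes K B G)
    (hs : A.tgtShape i = B.srcShape i) (e : C.FunctorMeets (IsFace.erase i.2) F G) :
    Realizes K (Bracketing.cut i m hc A B) (C.opFunctor (IsFace.erase i.2) F G e) :=
  .cut hc (.refl hA) (.refl hB) hs (IsoMeets.refl e) e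

theorem IsNormal.realizes (K : CubeConstraints C) {A : Bracketing S lo hi} (hA : IsNormal A F) :
    Realizes K A F := by
  induction hA with
  | block h hlo => exact .block h hlo
  | cut hl hm hc hA hB e ihA ihB => exact ihA.cut_of_shape ihB (hA.meets hB hc.isAdjacent).2 e

theorem IsMerge.isCoherence {hc : IsCut i m lo hi₁ lo₂ hi}
    {e : C.FunctorMeets (IsFace.erase i.2) F G} {μ : C.opFunctor (IsFace.erase i.2) F G e ≅ N}
    (hμ : IsMerge K hc e μ) {A : Bracketing S lo hi₁} {B : Bracketing S lo₂ hi}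
    {D : Bracketing S lo hi} (hA : IsNormal A F) (hB : IsNormal B G) (hD : IsNormal D N) :
    IsCoherence K (Bracketing.cut i m hc A B) D μ := by
  induction hμ with
  | first hl hm hc nA nB e =>
    obtain ⟨rfl, -⟩ := hD.unique (hA.cut hl hm hc hB e)
    exact .refl (hD.realizes K)
  | @assoc _ _ _ _ _ _ j _ _ hl hm₀ hlt hc hs hs' hr _ _ _ _ _ nA e₁ e₂ e _ hρ a ih =>
    obtain ⟨⟨Y, nY⟩, -, ⟨D', nD'⟩⟩ := hρ.isNormal
    obtain ⟨rfl, -⟩ := hA.unique (nA.cut (hl.left_of_lt hc (hm₀ ▸ hlt)) hm₀ hs' nY e₁)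
    obtain ⟨rfl, -⟩ := hD.unique (nA.cut hl hm₀ hs nD' e)
    have rX := nA.realizes K
    have rY := nY.realizes K
    have rZ := hB.realizes K
    have r := rX.cut_of_shape (hc := hs)
      (rY.cut_of_shape (hc := hr) rZ (nY.meets hB hr.isAdjacent).2 e₂)
      (by simpa [Bracketing.srcShape] using (nA.meets nY hs'.isAdjacent).2)
      (meets_opFunctor e₁ e₂)
    exact .trans
      (.assoc hs' hc hr hs rX rY rZ e₁ e₂ ((hA.realizes K).cut_of_shape rZ
        (hA.meets hB hc.isAdjacent).2 _) r)
      (.comp hs (.refl rX) (ih nY hB nD') a _ e r (hD.realizes K))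
  | @inter _ _ _ _ _ _ _ _ i j _ _ hl hm₀ hij hc hs hs₁ hs₂ hP hR _ _ _ _ _ _ e₁ e₂ eP eR e _ _
      hπ hρ a ihπ ihρ =>
    obtain ⟨⟨X, nX⟩, ⟨X', nX'⟩, ⟨P, nP⟩⟩ := hπ.isNormal
    obtain ⟨⟨Y, nY⟩, ⟨Y', nY'⟩, ⟨R, nR⟩⟩ := hρ.isNormal
    have hij' : i ≠ j := fun h => hij (congrArg Subtype.val h)
    obtain ⟨rfl, -⟩ := hA.unique (nX.cut (hl.left_of_ne hc hij') hm₀ hs₁ nY e₁)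
    obtain ⟨rfl, -⟩ := hB.unique (nX'.cut (hl.right_of_ne hc hij')
      (by rw [hm₀, hc.lower_apply_of_ne hij']) hs₂ nY' e₂)
    obtain ⟨rfl, -⟩ := hD.unique (nP.cut hl hm₀ hs nR e)
    have rX := nX.realizes K
    have rY := nY.realizes K
    have rX' := nX'.realizes K
    have rY' := nY'.realizes K
    have r := (rX.cut_of_shape (hc := hP) rX' (nX.meets nX' hP.isAdjacent).2 eP).cut_of_shape
      (hc := hs) (rY.cut_of_shape (hc := hR) rY' (nY.meets nY' hR.isAdjacent).2 eR)
      (by simp [Bracketing.srcShape, Bracketing.tgtShape, hij'.symm,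
        (nX.meets nY hs₁.isAdjacent).2, (nX'.meets nY' hs₂.isAdjacent).2])
      (opFunctor_meets_opFunctor hij.symm eP eR e₁ e₂)
    exact .trans
      (.inter hij hs₁ hs₂ hc hP hR hs rX rY rX' rY' e₁ e₂ eP eR
        ((hA.realizes K).cut_of_shape (hB.realizes K) (hA.meets hB hc.isAdjacent).2 _) r)
      (.comp hs (ihπ nX nX' nP) (ihρ nY nY' nR) a _ e r (hD.realizes K))

theorem IsCanonical.isCoherence {A : Bracketing S lo hi} {φ : F ≅ N} (hφ : IsCanonical K A φ) :
    Realizes K A F ∧ ∃ B : Bracketing S lo hi, IsNormal B N ∧ IsCoherence K A B φ := by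
  induction hφ with
  | block h hlo =>
    exact ⟨.block h hlo, _, .block h hlo, .refl (.block h hlo)⟩
  | cut hc hA hB a e e' hμ ihA ihB =>
    obtain ⟨rA, A', nA, cA⟩ := ihA
    obtain ⟨rB, B', nB, cB⟩ := ihB
    obtain ⟨-, -, D, nD⟩ := hμ.isNormal
    have hs := (nA.meets nB hc.isAdjacent).2
    have r := Realizes.cut hc cA cB hs a e
    exact ⟨r, D, nD, .trans (.comp hc cA cB a e e' r
      ((nA.realizes K).cut_of_shape (nB.realizes K) hs e')) (hμ.isCoherence nA nB nD)⟩

end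

/-! ### Coherence isomorphisms are canonical -/

section

variable {n : ℕ} {C : CubeCompositions.{v, u} n} {K : CubeConstraints C} {S : Finset (Fin n)}
  {p : S → ℕ} {lo hi : S → ℕ} {F G : Grid C.toCubeFaces S p ⥤ C.Mor S}

/-- Every coherence isomorphism is compatible with the canonical isomorphisms to the normal
form. The proof is a simultaneous induction, in which it is also shown that every bracketing that is
defined has a canonical isomorphism. -/
theorem IsCoherence.exists_canonical (hK : K.Coherent) {A B : Bracketing S lo hi} {φ : F ≅ G}
    (hφ : IsCoherence K A B φ) :
    ∃ (N : Grid C.toCubeFaces S p ⥤ C.Mor S) (c : F ≅ N) (d : G ≅ N),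
      IsCanonical K A c ∧ IsCanonical K B d ∧ φ ≪≫ d = c := by
  refine IsCoherence.rec (motive_1 := fun A F _ =>
      ∃ (N : Grid C.toCubeFaces S p ⥤ C.Mor S) (c : F ≅ N), IsCanonical K A c)
    (motive_2 := fun {_ _} A B {F G} φ _ =>
      ∃ (N : Grid C.toCubeFaces S p ⥤ C.Mor S) (c : F ≅ N) (d : G ≅ N),
        IsCanonical K A c ∧ IsCanonical K B d ∧ φ ≪≫ d = c)
    ?_ ?_ ?_ ?_ ?_ ?_ ?_ ?_ hφ
  · intro lo hi h hlo
    exact ⟨_, _, .block h hlo⟩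
  · rintro lo hi₁ lo₂ hi i m hc A A' B B' F F' G G' φ ψ - - hs a e ⟨N, c, c', hA, hA', w⟩
      ⟨M, d, d', hB, hB', w'⟩
    -- The canonical isomorphisms of `A` and `B` factor through those of `A'` and `B'`, which agree
    -- on the common face because the formal faces match.
    have b := IsoMeets.trans a (hA'.isoMeets hB' hc.isAdjacent hs)
    rw [w, w'] at b
    exact hA.exists_cut hc hB b e
  · rintro lo hi A F - ⟨N, c, hA⟩
    exact ⟨N, c, c, hA, hA, Iso.refl_trans c⟩
  · rintro lo hi A B F G φ - ⟨N, c, d, hA, hB, w⟩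
    exact ⟨N, d, c, hB, hA, by rw [← w, Iso.symm_self_id_assoc]⟩
  · rintro lo hi A B D F G H φ ψ - - ⟨N, c, d, hA, hB, w⟩ ⟨M, d', c', hB', hD, w'⟩
    obtain ⟨-, rfl, h⟩ := hB.unique hB'
    obtain rfl := eq_of_heq h
    exact ⟨N, c, c', hA, hD, by rw [Iso.trans_assoc, w', w]⟩
  · rintro lo hi₁ lo₂ hi i m hc A A' B B' F F' G G' φ ψ - - a e e' - - ⟨N, c, c', hA, hA', w⟩
      ⟨M, d, d', hB, hB', w'⟩ ⟨_, _, h⟩ ⟨_, _, h'⟩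
    obtain ⟨_, R, e₀, μ, -, hμ⟩ := hA.exists_isMerge hc hB
    subst w w'
    have x := h'.agree hA' hB'
    refine ⟨R, _, _, hA.cut hc hB (h.agree hA hB) e e₀ hμ, hA'.cut hc hB' x e' e₀ hμ, ?_⟩
    rw [opIso_trans e' a x, Iso.trans_assoc]
  · rintro a b c d f g i m m' h₁ h₁₂ h₂ h₂₁ X Y Z F G H - - - e₁ e₂ - - ⟨NX, cX, hX⟩ ⟨NY, cY, hY⟩
      ⟨NZ, cZ, hZ⟩ ⟨_, _, h⟩ ⟨_, _, h'⟩
    obtain ⟨_, _, _, _, _, _, hXY, -, -⟩ := h.exists_pieces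
    obtain ⟨_, _, _, _, _, _, -, hYZ, -⟩ := h'.exists_pieces
    have xy := hXY.agree hX hY
    have yz := hYZ.agree hY hZ
    obtain ⟨_, N₁, n₁, μ₁, -, hμ₁⟩ := hX.exists_isMerge h₁ hY
    obtain ⟨_, N₂, n₂, μ₂, -, hμ₂⟩ := hY.exists_isMerge h₂ hZ
    have kXY := hX.cut h₁ hY xy e₁ n₁ hμ₁
    have kYZ := hY.cut h₂ hZ yz e₂ n₂ hμ₂
    obtain ⟨D, N, n₁₂, μ₁₂, nD, hμ₁₂⟩ := kXY.exists_isMerge h₁₂ hZ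
    obtain ⟨D', N', n₂₁, μ₂₁, nD', hμ₂₁⟩ := hX.exists_isMerge h₂₁ kYZ
    obtain rfl := nD.functor_unique nD'
    refine ⟨N, _, _, kXY.cut h₁₂ hZ (h.agree kXY hZ) _ n₁₂ hμ₁₂,
      hX.cut h₂₁ kYZ (h'.agree hX kYZ) _ n₂₁ hμ₂₁, ?_⟩
    -- Both canonical isomorphisms first normalize `X`, `Y`, `Z`, which commutes with the
    -- associator, and then merge the three normal forms.
    rw [opIso_trans_left (opFunctor_meets n₁ n₂) (xy.opIso_left yz) (hμ₁.isoMeets_refl n₂),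
      opIso_trans_right (meets_opFunctor n₁ n₂) (yz.opIso_right xy) (hμ₂.refl_isoMeets n₁),
      Iso.trans_assoc, Iso.trans_assoc, nD.assoc_square hK hμ₁ hμ₁₂ hμ₂ hμ₂₁]
    exact (Iso.trans_trans_eq_of_eq (K.assocFunctor_naturality ..) _).symm
  · rintro a b c d a' b' c' d' i j m m' hij h₁ h₁' h₂ k₁ k₁' k₂ X Y X' Y' F G F' G' - - - -
      e e' eF eG - - ⟨N₁, c₁, hX⟩ ⟨N₂, c₂, hY⟩ ⟨N₃, c₃, hX'⟩ ⟨N₄, c₄, hY'⟩ ⟨_, _, h⟩ ⟨_, _, h'⟩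
    obtain ⟨_, _, _, _, _, _, hXY, hXY', -⟩ := h.exists_pieces
    obtain ⟨_, _, _, _, _, _, hXX', hYY', -⟩ := h'.exists_pieces
    have x₁ := hXY.agree hX hY
    have x₂ := hXY'.agree hX' hY'
    have y₁ := hXX'.agree hX hX'
    have y₂ := hYY'.agree hY hY'
    obtain ⟨_, M₁, n₁, μ, -, hμ⟩ := hX.exists_isMerge h₁ hY
    obtain ⟨_, M₂, n₂, μ', -, hμ'⟩ := hX'.exists_isMerge h₁' hY'
    obtain ⟨_, M₃, n₃, κ, -, hκ⟩ := hX.exists_isMerge k₁ hX'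
    obtain ⟨_, M₄, n₄, κ', -, hκ'⟩ := hY.exists_isMerge k₁' hY'
    have kXY := hX.cut h₁ hY x₁ e n₁ hμ
    have kXY' := hX'.cut h₁' hY' x₂ e' n₂ hμ'
    have kXX' := hX.cut k₁ hX' y₁ eF n₃ hκ
    have kYY' := hY.cut k₁' hY' y₂ eG n₄ hκ'
    obtain ⟨D, N, f, ν, nD, hν⟩ := kXY.exists_isMerge h₂ kXY'
    obtain ⟨D', N', g, ξ, nD', hξ⟩ := kXX'.exists_isMerge k₂ kYY'
    obtain rfl := nD.functor_unique nD'
    have hij' : i ≠ j := fun w => hij (congrArg Subtype.val w)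
    have z := hμ.isoMeets hμ' h₂.isAdjacent rfl rfl hij'
    have z' := hκ.isoMeets hκ' k₂.isAdjacent rfl rfl hij'.symm
    have w := IsoMeets.opIso hij e n₁ e' n₂ x₁ x₂ y₁ y₂
    have w' := IsoMeets.opIso hij.symm eF n₃ eG n₄ y₁ y₂ x₁ x₂
    -- As for the associator: normalize the four parts, then merge their normal forms.
    refine ⟨N, _, _, kXY.cut h₂ kXY' (w.trans z) _ f hν, kXX'.cut k₂ kYY' (w'.trans z') _ g hξ, ?_⟩
    rw [opIso_trans (opFunctor_meets_opFunctor hij n₁ n₂ n₃ n₄) w z,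
      opIso_trans (opFunctor_meets_opFunctor hij.symm n₃ n₄ n₁ n₂) w' z',
      Iso.trans_assoc, Iso.trans_assoc, nD.inter_square hK hij hμ hμ' hν hκ hκ' hξ z z']
    exact (Iso.trans_trans_eq_of_eq (K.interFunctor_naturality hij ..) _).symm

theorem Realizes.exists_canonical (hK : K.Coherent) {A : Bracketing S lo hi}
    (hA : Realizes K A F) :
    ∃ (N : Grid C.toCubeFaces S p ⥤ C.Mor S) (c : F ≅ N), IsCanonical K A c := by
  obtain ⟨N, c, -, h, -⟩ := (IsCoherence.refl hA).exists_canonical hK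
  exact ⟨N, c, h⟩

end

theorem mainTheorem1 {n : ℕ} (C : PseudoFoldCategory.{v, u} n) (S : Finset (Fin n)) (p : S → ℕ)
    (hp : ∀ i, 0 < p i) :
    (∀ A : Bracketing S 0 p, A.Matching →
      ∃! F : Grid C.toCubeFaces S p ⥤ C.Mor S, Realizes C.constraints A F) ∧
    ∀ (A B : Bracketing S 0 p) (F G : Grid C.toCubeFaces S p ⥤ C.Mor S),
      Realizes C.constraints A F → Realizes C.constraints B G →
        ∃! φ : F ≅ G, IsCoherence C.constraints A B φ := by
  have hK := C.coherent
  refine ⟨fun A hA => ?_, fun A B F G hF hG => ?_⟩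
  · obtain ⟨F, N, φ, hφ⟩ := IsCanonical.exists_of_matching C.constraints hA fun _ => le_rfl
    refine ⟨F, hφ.isCoherence.1, fun F' hF' => ?_⟩
    obtain ⟨_, _, hφ'⟩ := hF'.exists_canonical hK
    exact (hφ'.unique hφ).1
  · obtain ⟨N, c, hc⟩ := hF.exists_canonical hK
    obtain ⟨N', d, hd⟩ := hG.exists_canonical hK
    obtain ⟨-, X, nX, kc⟩ := hc.isCoherence
    obtain ⟨-, Y, nY, kd⟩ := hd.isCoherence
    obtain ⟨rfl, rfl⟩ := nX.unique nY
    refine ⟨c ≪≫ d.symm, .trans kc (.symm kd), fun φ hφ => ?_⟩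
    obtain ⟨_, c', d', hc', hd', rfl⟩ := hφ.exists_canonical hK
    obtain ⟨-, rfl, h⟩ := hc.unique hc'
    obtain rfl := eq_of_heq h
    obtain ⟨-, -, h⟩ := hd.unique hd'
    obtain rfl := eq_of_heq h
    rw [Iso.trans_assoc, Iso.self_symm_id, Iso.trans_refl]
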